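/- Let $A$ be a connected semi-local commutative ring (finitely many maximal ideals, $\operatorname{Spec} A$ connected) all of whose residue fields are infinite, and let $M$ be a finitely generated projective $A$-module of constant rank $d\le 3$. Let $\mathrm{Sub}(M)$ be the poset of direct summands of $M$. A functor $\varphi\colon [p]\times[q]\to \mathrm{Sub}(M)$ (where $[p]=\{0<1<\dots<p\}$) is called a *lattice* if for all $(a,b)\le(a',b')$ the natural map from the colimit of $\varphi$ (in $A$-modules) over the punctured cube $\{a,a'\}\times\{b,b'\}\setminus\{(a',b')\}$ to $\varphi(a',b')$ is a monomorphism onto a direct summand; it is *full* if moreover $\varphi(0,b)=0=\varphi(a,0)$ for all $a,b$ and $\varphi(p,q)=M$. The two-dimensional building $D^2(M)$ is the geometric realisation of the bisimplicial pointed set whose $(p,q)$-simplices are the lattices $[p]\times[q]\to\mathrm{Sub}(M)$ with all non-full lattices identified to the base point. Put $\mathrm{St}^2(M)=\widetilde H_{2d}(D^2(M);\mathbb Z)$, with its action of $\mathrm{GL}(M)=\mathrm{Aut}_A(M)$. Let $\mathfrak m\subset A$ be any maximal ideal, $F=A/\mathfrak m$, and $V=M\otimes_A F$. Base change of summands induces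 a homomorphism of coinvariants $$\mathrm{St}^2(M)_{\mathrm{GL}(M)}\longrightarrow \mathrm{St}^2(V)_{\mathrm{GL}(V)}.$$ A non-degenerate full lattice $\varphi\colon[d]\times[d]\to\mathrm{Sub}(V)$ has two complete flags $(\varphi(a,d))_{0\le a\le d}$ and $(\varphi(d,b))_{0\le b\le d}$ in $V$; sending $\varphi$ to $1$ if these flags are equal and to $0$ otherwise defines a $\mathrm{GL}(V)$-invariant homomorphism $\mathrm{St}^2(V)\to\mathbb Z$ (the invariant pairing on $\mathrm{St}^2(V)\cong \mathrm{St}(V)\otimes\mathrm{St}(V)$ for which the complete flags are orthonormal), and hence a map $\mathrm{St}^2(V)_{\mathrm{GL}(V)}\to\mathbb Z$. Then the composition $$\mathrm{St}^2(M)_{\mathrm{GL}(M)}\longrightarrow \mathrm{St}^2(V)_{\mathrm{GL}(V)}\longrightarrow\mathbb Z$$ is an isomorphism. -/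

import Mathlib

open scoped TensorProduct

noncomputable section

namespace DoubleBuilding

/-! ### Grids of summands

The two-dimensional building of a module only depends on the bounded modular lattice of its
submodules, so the simplices are defined for a bounded lattice `L`; it is applied to
`L = Submodule A M`, where `IsComplemented P` says that `P` is a direct summand of `M`. -/

section Grids

/-- Functors `[p] × [q] → L`. -/
abbrev Grid (L : Type*) [PartialOrder L] (p q : ℕ) : Type _ :=
  (Fin (p + 1) × Fin (q + 1)) →o L

variable {L : Type*} [Lattice L] [BoundedOrder L] {p q : ℕ}

/-- A functor `φ : [p] × [q] → Sub(M)` with values in summands is a *lattice* if for all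
`(a, b) ≤ (a', b')` the map to `φ (a', b')` from the colimit of `φ` over the punctured cube
`{a, a'} × {b, b'} \ {(a', b')}` is a monomorphism onto a summand.  For `a < a'`, `b < b'` the
colimit is the pushout of `φ (a, b')` and `φ (a', b)` along `φ (a, b)`; its map to `M` has kernel
`(φ (a, b') ⊓ φ (a', b)) / φ (a, b)` and image `φ (a, b') ⊔ φ (a', b)`.  For `a = a'` or `b = b'`
the condition is automatic, and so are the two fields below. -/
structure IsLattice (φ : Grid L p q) : Prop where
  isComplemented : ∀ x, IsComplemented (φ x)
  inf_eq : ∀ a a' b b', a ≤ a' → b ≤ b' → φ (a, b') ⊓ φ (a', b) = φ (a, b)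
  sup_isComplemented : ∀ a a' b b', a ≤ a' → b ≤ b' → IsComplemented (φ (a, b') ⊔ φ (a', b))

/-- Fullness: `φ` vanishes if one coordinate is `0`, and its terminal value is everything. -/
structure IsFull (φ : Grid L p q) : Prop where
  zero_left : ∀ b, φ (0, b) = ⊥
  zero_right : ∀ a, φ (a, 0) = ⊥
  last : φ (Fin.last p, Fin.last q) = ⊤

/-- `φ` is non-degenerate: it is not pulled back along a codegeneracy `[p] → [p - 1]` in the first
or `[q] → [q - 1]` in the second direction, i.e. no two consecutive rows or columns are equal. -/
structure IsNondegenerate (φ : Grid L p q) : Prop where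
  left : ∀ i : Fin p, ∃ b, φ (i.castSucc, b) ≠ φ (i.succ, b)
  right : ∀ j : Fin q, ∃ a, φ (a, j.castSucc) ≠ φ (a, j.succ)

/-- The non-degenerate `(p, q)`-simplices of the two-dimensional building `D²` other than the base
point, i.e. its `(p + q)`-cells of bidegree `(p, q)`. -/
structure IsCell (φ : Grid L p q) : Prop where
  isLattice : IsLattice φ
  isFull : IsFull φ
  isNondegenerate : IsNondegenerate φ

variable (L) in
/-- The cells, other than the base point, of the geometric realisation of the bisimplicial pointed
set `D²`. -/
structure Cell where
  /-- first simplicial degree -/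
  p : ℕ
  /-- second simplicial degree -/
  q : ℕ
  /-- the full lattice -/
  grid : Grid L p q
  isCell : IsCell grid

/-- The `i`-th face in the first simplicial direction. -/
def faceLeft (i : Fin (p + 2)) (φ : Grid L (p + 1) q) : Grid L p q :=
  φ.comp (OrderHom.prodMap i.succAboveOrderEmb.toOrderHom OrderHom.id)

/-- The `j`-th face in the second simplicial direction. -/
def faceRight (j : Fin (q + 2)) (φ : Grid L p (q + 1)) : Grid L p q :=
  φ.comp (OrderHom.prodMap OrderHom.id j.succAboveOrderEmb.toOrderHom)

end Grids

/-! ### The reduced cellular chain complex of `D²`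

This is the total complex of the bicomplex of normalised chains of the bisimplicial pointed set
`D²` modulo the base point. -/

section Chains

variable (L : Type*) [Lattice L] [BoundedOrder L]

/-- Reduced cellular chains, in all degrees. -/
abbrev Chain : Type _ := Cell L →₀ ℤ

variable {L}

open Classical in
/-- The class of a simplex in the normalised reduced chains: degenerate simplices and the base
point (the common class of all lattices which are not full) become zero. -/
def gen {p q : ℕ} (φ : Grid L p q) : Chain L :=
  if h : IsCell φ then Finsupp.single ⟨p, q, φ, h⟩ 1 else 0

/-- The alternating sum of the faces in the first direction. -/
def bdryLeft : {p q : ℕ} → Grid L p q → Chain L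
  | 0, _, _ => 0
  | p + 1, _, φ => ∑ i : Fin (p + 2), (-1 : ℤ) ^ (i : ℕ) • gen (faceLeft i φ)

/-- The alternating sum of the faces in the second direction. -/
def bdryRight : {p q : ℕ} → Grid L p q → Chain L
  | _, 0, _ => 0
  | _, q + 1, φ => ∑ j : Fin (q + 2), (-1 : ℤ) ^ (j : ℕ) • gen (faceRight j φ)

variable (L)

/-- The differential of the total complex. -/
def bdry : Chain L →ₗ[ℤ] Chain L :=
  Finsupp.linearCombination ℤ fun c => bdryLeft c.grid + (-1 : ℤ) ^ c.p • bdryRight c.grid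

/-- The chains of degree `n`. -/
def chains (n : ℕ) : Submodule ℤ (Chain L) :=
  Finsupp.supported ℤ ℤ {c | c.p + c.q = n}

/-- The cycles of degree `n`. -/
def cycles (n : ℕ) : Submodule ℤ (Chain L) := chains L n ⊓ LinearMap.ker (bdry L)

/-- The boundaries of degree `n`. -/
def boundaries (n : ℕ) : Submodule ℤ (Chain L) := (chains L (n + 1)).map (bdry L)

/-- The reduced homology group `H̃ₙ(D²; ℤ)`. -/
abbrev Homology (n : ℕ) : Type _ := cycles L n ⧸ (boundaries L n).submoduleOf (cycles L n)

end Chains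

/-! ### Functoriality -/

/-- Maps of lattices inducing maps of buildings. -/
structure BuildingHom (L L' : Type*) [Lattice L] [BoundedOrder L] [Lattice L'] [BoundedOrder L']
    where
  /-- the underlying map -/
  toFun : L → L'
  map_sup : ∀ x y, toFun (x ⊔ y) = toFun x ⊔ toFun y
  map_bot : toFun ⊥ = ⊥
  map_top : toFun ⊤ = ⊤
  map_disjoint : ∀ x y, IsCompl x y → Disjoint (toFun x) (toFun y)
  eq_bot : ∀ x, IsComplemented x → toFun x = ⊥ → x = ⊥

namespace BuildingHom

variable {L L' : Type*} [Lattice L] [BoundedOrder L] [Lattice L'] [BoundedOrder L']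
  (f : BuildingHom L L')

lemma monotone : Monotone f.toFun := fun x y h => by
  have := f.map_sup x y
  rw [sup_eq_right.2 h] at this
  exact this ▸ le_sup_left

lemma map_isCompl {x y : L} (h : IsCompl x y) : IsCompl (f.toFun x) (f.toFun y) :=
  ⟨f.map_disjoint x y h, codisjoint_iff.2 (by rw [← f.map_sup, h.sup_eq_top, f.map_top])⟩

lemma map_isComplemented {x : L} (h : IsComplemented x) : IsComplemented (f.toFun x) := by
  obtain ⟨y, hy⟩ := h
  exact ⟨_, f.map_isCompl hy⟩

/-- The image of a grid. -/
def mapGrid {p q : ℕ} (φ : Grid L p q) : Grid L' p q :=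
  (⟨f.toFun, f.monotone⟩ : L →o L').comp φ

@[simp] lemma mapGrid_apply {p q : ℕ} (φ : Grid L p q) (x) : f.mapGrid φ x = f.toFun (φ x) := rfl

/-- The isomorphism of buildings induced by an isomorphism of lattices. -/
def ofOrderIso (e : L ≃o L') : BuildingHom L L' where
  toFun := e
  map_sup := e.map_sup
  map_bot := e.map_bot
  map_top := e.map_top
  map_disjoint _ _ h := h.disjoint.map_orderIso e
  eq_bot _ _ h := by simpa using h

lemma map_inf [IsModularLattice L] [IsModularLattice L'] {x y : L}
    (hi : IsComplemented (x ⊓ y)) (hs : IsComplemented (x ⊔ y)) :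
    f.toFun x ⊓ f.toFun y = f.toFun (x ⊓ y) := by
  obtain ⟨r, hr⟩ := hi
  obtain ⟨t, ht⟩ := hs
  have hx : x = (x ⊓ y) ⊔ (r ⊓ x) := by
    rw [← sup_inf_assoc_of_le r (inf_le_left : x ⊓ y ≤ x), hr.sup_eq_top, top_inf_eq]
  have hc : IsCompl y ((r ⊓ x) ⊔ t) := by
    constructor
    · have h1 : Disjoint y (r ⊓ x) := by
        rw [disjoint_iff, ← le_bot_iff]
        calc y ⊓ (r ⊓ x) ≤ (x ⊓ y) ⊓ r :=
              le_inf (le_inf (inf_le_right.trans inf_le_right) inf_le_left)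
                (inf_le_right.trans inf_le_left)
          _ = ⊥ := hr.inf_eq_bot
          _ ≤ ⊥ := le_rfl
      have h2 : Disjoint (y ⊔ (r ⊓ x)) t :=
        ht.disjoint.mono_left (sup_le le_sup_right (inf_le_right.trans le_sup_left))
      exact h1.disjoint_sup_right_of_disjoint_sup_left h2
    · rw [codisjoint_iff, ← sup_assoc]
      have : y ⊔ (r ⊓ x) = x ⊔ y := by
        apply le_antisymm
        · exact sup_le le_sup_right (inf_le_right.trans le_sup_left)
        · refine sup_le ?_ le_sup_left
          conv_lhs => rw [hx]
          exact sup_le (inf_le_right.trans le_sup_left) le_sup_right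
      rw [this, ht.sup_eq_top]
  have hd : f.toFun (r ⊓ x) ⊓ f.toFun y = ⊥ := by
    rw [← disjoint_iff]
    exact ((f.map_disjoint _ _ hc).mono_right (f.monotone le_sup_left)).symm
  conv_lhs => rw [hx]
  rw [f.map_sup, sup_inf_assoc_of_le _ (f.monotone inf_le_right), hd, sup_bot_eq]

lemma injOn [IsModularLattice L] {x y : L} (hx : IsComplemented x) (hy : IsComplemented y)
    (hxy : x ≤ y) (h : f.toFun x = f.toFun y) : x = y := by
  obtain ⟨x', hx'⟩ := hx
  obtain ⟨y', hy'⟩ := hy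
  have hyx : y = x ⊔ (x' ⊓ y) := by
    rw [← sup_inf_assoc_of_le x' hxy, hx'.sup_eq_top, top_inf_eq]
  have hc : IsCompl (x' ⊓ y) (x ⊔ y') := by
    constructor
    · have h1 : Disjoint (x' ⊓ y) x := hx'.symm.disjoint.mono_left inf_le_left
      refine h1.disjoint_sup_right_of_disjoint_sup_left ?_
      rw [sup_comm, ← hyx]
      exact hy'.disjoint
    · rw [codisjoint_iff, ← sup_assoc, sup_comm (x' ⊓ y) x, ← hyx, hy'.sup_eq_top]
  have h0 : x' ⊓ y = ⊥ := by
    refine f.eq_bot _ ⟨_, hc⟩ ?_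
    have h1 : Disjoint (f.toFun (x' ⊓ y)) (f.toFun x) :=
      (f.map_disjoint _ _ hc).mono_right (f.monotone le_sup_left)
    rw [h] at h1
    exact h1.eq_bot_of_le (f.monotone inf_le_right)
  rw [hyx, h0, sup_bot_eq]

variable [IsModularLattice L] [IsModularLattice L']

lemma isLattice {p q : ℕ} {φ : Grid L p q} (h : IsLattice φ) : IsLattice (f.mapGrid φ) where
  isComplemented x := f.map_isComplemented (h.isComplemented x)
  inf_eq a a' b b' ha hb := by
    have hi := h.inf_eq a a' b b' ha hb
    have := f.map_inf (hi ▸ h.isComplemented (a, b)) (h.sup_isComplemented a a' b b' ha hb)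
    simpa only [mapGrid_apply, hi] using this
  sup_isComplemented a a' b b' ha hb := by
    have := f.map_isComplemented (h.sup_isComplemented a a' b b' ha hb)
    rwa [f.map_sup] at this

lemma eq_iff {p q : ℕ} {φ : Grid L p q} (h : IsLattice φ) {x y} (hxy : x ≤ y) :
    f.toFun (φ x) = f.toFun (φ y) ↔ φ x = φ y :=
  ⟨f.injOn (h.isComplemented x) (h.isComplemented y) (φ.monotone hxy), fun h => h ▸ rfl⟩

lemma eq_bot_iff' {x : L} (h : IsComplemented x) : f.toFun x = ⊥ ↔ x = ⊥ :=
  ⟨f.eq_bot x h, fun h => h ▸ f.map_bot⟩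

lemma eq_top_iff' {x : L} (h : IsComplemented x) : f.toFun x = ⊤ ↔ x = ⊤ :=
  ⟨fun e => f.injOn h isComplemented_top le_top (e.trans f.map_top.symm), fun h => h ▸ f.map_top⟩

lemma isCell_iff {p q : ℕ} {φ : Grid L p q} (h : IsLattice φ) :
    IsCell (f.mapGrid φ) ↔ IsCell φ := by
  have hF : IsFull (f.mapGrid φ) ↔ IsFull φ := by
    constructor
    · rintro ⟨h1, h2, h3⟩
      exact ⟨fun b => (f.eq_bot_iff' (h.isComplemented _)).1 (h1 b),
        fun a => (f.eq_bot_iff' (h.isComplemented _)).1 (h2 a),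
        (f.eq_top_iff' (h.isComplemented _)).1 h3⟩
    · rintro ⟨h1, h2, h3⟩
      exact ⟨fun b => (f.eq_bot_iff' (h.isComplemented _)).2 (h1 b),
        fun a => (f.eq_bot_iff' (h.isComplemented _)).2 (h2 a),
        (f.eq_top_iff' (h.isComplemented _)).2 h3⟩
  have hN : IsNondegenerate (f.mapGrid φ) ↔ IsNondegenerate φ := by
    have e1 : ∀ (i : Fin p) (b : Fin (q + 1)), (i.castSucc, b) ≤ (i.succ, b) :=
      fun i b => ⟨Fin.castSucc_le_succ i, le_rfl⟩
    have e2 : ∀ (j : Fin q) (a : Fin (p + 1)), (a, j.castSucc) ≤ (a, j.succ) :=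
      fun j a => ⟨le_rfl, Fin.castSucc_le_succ j⟩
    constructor
    · rintro ⟨h1, h2⟩
      refine ⟨fun i => (h1 i).imp fun b hb => ?_, fun j => (h2 j).imp fun a ha => ?_⟩
      · exact fun e => hb ((f.eq_iff h (e1 i b)).2 e)
      · exact fun e => ha ((f.eq_iff h (e2 j a)).2 e)
    · rintro ⟨h1, h2⟩
      refine ⟨fun i => (h1 i).imp fun b hb => ?_, fun j => (h2 j).imp fun a ha => ?_⟩
      · exact fun e => hb ((f.eq_iff h (e1 i b)).1 e)
      · exact fun e => ha ((f.eq_iff h (e2 j a)).1 e)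
  exact ⟨fun c => ⟨h, hF.1 c.2, hN.1 c.3⟩, fun c => ⟨f.isLattice h, hF.2 c.2, hN.2 c.3⟩⟩

/-- The map on cells. -/
def mapCell (c : Cell L) : Cell L' :=
  ⟨c.p, c.q, f.mapGrid c.grid, (f.isCell_iff c.isCell.isLattice).2 c.isCell⟩

/-- The map on chains. -/
def mapChain : Chain L →ₗ[ℤ] Chain L' := Finsupp.lmapDomain ℤ ℤ f.mapCell

lemma mapChain_single (c : Cell L) (n : ℤ) :
    f.mapChain (Finsupp.single c n) = Finsupp.single (f.mapCell c) n :=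
  Finsupp.mapDomain_single

lemma mapChain_gen {p q : ℕ} {φ : Grid L p q} (h : IsLattice φ) :
    f.mapChain (gen φ) = gen (f.mapGrid φ) := by
  classical
  by_cases hc : IsCell φ
  · rw [gen, dif_pos hc, gen, dif_pos ((f.isCell_iff h).2 hc), mapChain_single]
    rfl
  · rw [gen, dif_neg hc, gen, dif_neg (mt (f.isCell_iff h).1 hc), map_zero]

end BuildingHom

section Faces

variable {L : Type*} [Lattice L] [BoundedOrder L] {p q : ℕ}

lemma IsLattice.faceLeft {φ : Grid L (p + 1) q} (h : IsLattice φ) (i : Fin (p + 2)) :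
    IsLattice (faceLeft i φ) where
  isComplemented _ := h.isComplemented _
  inf_eq _ _ _ _ ha hb := h.inf_eq _ _ _ _ (i.succAboveOrderEmb.monotone ha) hb
  sup_isComplemented _ _ _ _ ha hb :=
    h.sup_isComplemented _ _ _ _ (i.succAboveOrderEmb.monotone ha) hb

lemma IsLattice.faceRight {φ : Grid L p (q + 1)} (h : IsLattice φ) (j : Fin (q + 2)) :
    IsLattice (faceRight j φ) where
  isComplemented _ := h.isComplemented _
  inf_eq _ _ _ _ ha hb := h.inf_eq _ _ _ _ ha (j.succAboveOrderEmb.monotone hb)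
  sup_isComplemented _ _ _ _ ha hb :=
    h.sup_isComplemented _ _ _ _ ha (j.succAboveOrderEmb.monotone hb)

end Faces

namespace BuildingHom

variable {L L' L'' : Type*} [Lattice L] [BoundedOrder L] [Lattice L'] [BoundedOrder L']
  [Lattice L''] [BoundedOrder L'']
  [IsModularLattice L] [IsModularLattice L'] [IsModularLattice L'']
  (f : BuildingHom L L')

lemma mapChain_bdryLeft {p q : ℕ} {φ : Grid L p q} (h : IsLattice φ) :
    f.mapChain (bdryLeft φ) = bdryLeft (f.mapGrid φ) := by
  cases p with
  | zero => exact map_zero f.mapChain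
  | succ p =>
    simp only [bdryLeft, map_sum, map_smul, f.mapChain_gen (h.faceLeft _)]
    rfl

lemma mapChain_bdryRight {p q : ℕ} {φ : Grid L p q} (h : IsLattice φ) :
    f.mapChain (bdryRight φ) = bdryRight (f.mapGrid φ) := by
  cases q with
  | zero => exact map_zero f.mapChain
  | succ q =>
    simp only [bdryRight, map_sum, map_smul, f.mapChain_gen (h.faceRight _)]
    rfl

lemma mapChain_bdry (x : Chain L) : f.mapChain (bdry L x) = bdry L' (f.mapChain x) := by
  induction x using Finsupp.induction_linear with
  | zero => simp
  | add x y hx hy => simp only [map_add, hx, hy]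
  | single c n =>
    rw [mapChain_single, bdry, bdry, Finsupp.linearCombination_single,
      Finsupp.linearCombination_single, map_smul, map_add, map_smul,
      f.mapChain_bdryLeft c.isCell.isLattice, f.mapChain_bdryRight c.isCell.isLattice]
    rfl

lemma mapChain_mem_chains {n : ℕ} {x : Chain L} (hx : x ∈ chains L n) :
    f.mapChain x ∈ chains L' n := by
  have : chains L n ≤ (chains L' n).comap f.mapChain := by
    rw [chains, Finsupp.supported_eq_span_single, Submodule.span_le]
    rintro _ ⟨c, hc, rfl⟩
    change f.mapChain _ ∈ chains L' n
    rw [mapChain_single]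
    exact Finsupp.single_mem_supported ℤ _ hc
  exact this hx

lemma mapChain_mem_cycles {n : ℕ} {x : Chain L} (hx : x ∈ cycles L n) :
    f.mapChain x ∈ cycles L' n := by
  refine ⟨f.mapChain_mem_chains hx.1, ?_⟩
  have h2 : bdry L x = 0 := hx.2
  change bdry L' (f.mapChain x) = 0
  rw [← mapChain_bdry, h2, map_zero]

lemma mapChain_mem_boundaries {n : ℕ} {x : Chain L} (hx : x ∈ boundaries L n) :
    f.mapChain x ∈ boundaries L' n := by
  obtain ⟨y, hy, rfl⟩ := hx
  exact ⟨f.mapChain y, f.mapChain_mem_chains hy, (f.mapChain_bdry y).symm⟩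

/-- The map on homology. -/
def mapHomology (n : ℕ) : Homology L n →ₗ[ℤ] Homology L' n :=
  Submodule.mapQ _ _ (f.mapChain.restrict fun _ => f.mapChain_mem_cycles)
    fun _ hx => f.mapChain_mem_boundaries hx

lemma mapHomology_congr {L₁ L₂ : Type*} [Lattice L₁] [BoundedOrder L₁] [Lattice L₂]
    [BoundedOrder L₂] [IsModularLattice L₁] [IsModularLattice L₂]
    (f : BuildingHom L L₁) (g : BuildingHom L₁ L') (f' : BuildingHom L L₂)
    (g' : BuildingHom L₂ L') (h : ∀ x, g.toFun (f.toFun x) = g'.toFun (f'.toFun x)) (n : ℕ)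
    (x : Homology L n) :
    g.mapHomology n (f.mapHomology n x) = g'.mapHomology n (f'.mapHomology n x) := by
  have hc : ∀ c, g.mapCell (f.mapCell c) = g'.mapCell (f'.mapCell c) := by
    rintro ⟨p, q, φ, hφ⟩
    have : g.mapGrid (f.mapGrid φ) = g'.mapGrid (f'.mapGrid φ) := by
      ext x
      exact h _
    simp only [mapCell, this]
  have hch : ∀ y, g.mapChain (f.mapChain y) = g'.mapChain (f'.mapChain y) := by
    intro y
    induction y using Finsupp.induction_linear with
    | zero => simp
    | add x y hx hy => simp only [map_add, hx, hy]
    | single c n => simp only [mapChain_single, hc]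
  obtain ⟨x, rfl⟩ := Submodule.Quotient.mk_surjective _ x
  change Submodule.Quotient.mk _ = Submodule.Quotient.mk _
  congr 1
  exact Subtype.ext (hch x)

lemma mapHomology_eq_self (f : BuildingHom L L) (h : ∀ x, f.toFun x = x) (n : ℕ)
    (x : Homology L n) : f.mapHomology n x = x := by
  have hc : ∀ c, f.mapCell c = c := by
    rintro ⟨p, q, φ, hφ⟩
    have : f.mapGrid φ = φ := by
      ext x
      exact h _
    simp only [mapCell, this]
  have hch : ∀ y, f.mapChain y = y := by
    intro y
    induction y using Finsupp.induction_linear with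
    | zero => simp
    | add x y hx hy => simp only [map_add, hx, hy]
    | single c n => simp only [mapChain_single, hc]
  obtain ⟨x, rfl⟩ := Submodule.Quotient.mk_surjective _ x
  change Submodule.Quotient.mk _ = Submodule.Quotient.mk _
  congr 1
  exact Subtype.ext (hch x)

end BuildingHom

/-! ### The Steinberg module `St²(M)` and its coinvariants -/

section Steinberg

variable (A : Type*) [CommRing A] (M : Type*) [AddCommGroup M] [Module A M]

/-- `St²(M) = H̃_{2d}(D²(M); ℤ)`, for a module `M` of rank `d`. -/
abbrev St2 (d : ℕ) : Type _ := Homology (Submodule A M) (2 * d)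

variable {A M} in
/-- The automorphism of the building of `M` induced by an automorphism of `M`. -/
def autHom (g : M ≃ₗ[A] M) : BuildingHom (Submodule A M) (Submodule A M) :=
  BuildingHom.ofOrderIso (Submodule.orderIsoMapComap g)

variable {A M} in
lemma autHom_apply (g : M ≃ₗ[A] M) (P : Submodule A M) :
    (autHom g).toFun P = P.map (g : M →ₗ[A] M) := rfl

/-- The action of `GL(M)` on `St²(M)`. -/
def rho (d : ℕ) : Representation ℤ (M ≃ₗ[A] M) (St2 A M d) where
  toFun g := (autHom g).mapHomology (2 * d)
  map_one' := by
    refine LinearMap.ext fun x => BuildingHom.mapHomology_eq_self _ (fun P => ?_) _ _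
    rw [autHom_apply]
    exact Submodule.map_id P
  map_mul' g h := by
    refine LinearMap.ext fun x => ?_
    rw [← BuildingHom.mapHomology_eq_self (autHom (1 : M ≃ₗ[A] M)) (fun P => ?_)
      (2 * d) ((autHom (g * h)).mapHomology (2 * d) x)]
    · refine BuildingHom.mapHomology_congr _ _ _ _ (fun P => ?_) _ _
      simp only [autHom_apply, ← Submodule.map_comp]
      rfl
    · rw [autHom_apply]
      exact Submodule.map_id P

end Steinberg

/-! ### The pairing over a field -/

section Pairing

variable {L : Type*} [Lattice L] [BoundedOrder L] {p q : ℕ}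

/-- The flag `a ↦ φ (a, q)`, the first component of the map `D² → D¹ ∧ D¹`. -/
def flagLeft (φ : Grid L p q) (a : Fin (p + 1)) : L := φ (a, Fin.last q)

/-- The flag `b ↦ φ (p, b)`, the second component of the map `D² → D¹ ∧ D¹`. -/
def flagRight (φ : Grid L p q) (b : Fin (q + 1)) : L := φ (Fin.last p, b)

lemma IsCell.strictMono_flagLeft {φ : Grid L p q} (h : IsCell φ) : StrictMono (flagLeft φ) := by
  refine Fin.strictMono_iff_lt_succ.2 fun i => ?_
  refine lt_of_le_of_ne (φ.monotone ⟨Fin.castSucc_le_succ i, le_rfl⟩) fun e => ?_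
  obtain ⟨b, hb⟩ := h.isNondegenerate.left i
  apply hb
  rw [← h.isLattice.inf_eq i.castSucc (Fin.last p) b (Fin.last q) (Fin.le_last _) (Fin.le_last _),
    ← h.isLattice.inf_eq i.succ (Fin.last p) b (Fin.last q) (Fin.le_last _) (Fin.le_last _)]
  exact congrArg (· ⊓ _) e

lemma IsCell.strictMono_flagRight {φ : Grid L p q} (h : IsCell φ) : StrictMono (flagRight φ) := by
  refine Fin.strictMono_iff_lt_succ.2 fun j => ?_
  refine lt_of_le_of_ne (φ.monotone ⟨le_rfl, Fin.castSucc_le_succ j⟩) fun e => ?_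
  obtain ⟨a, ha⟩ := h.isNondegenerate.right j
  apply ha
  rw [← h.isLattice.inf_eq a (Fin.last p) j.castSucc (Fin.last q) (Fin.le_last _) (Fin.le_last _),
    ← h.isLattice.inf_eq a (Fin.last p) j.succ (Fin.last q) (Fin.le_last _) (Fin.le_last _)]
  exact congrArg (_ ⊓ ·) e

variable (L) in
open Classical in
/-- The functional on chains sending a cell `φ` to `1` if its two flags (viewed as chains of
elements of `L`) agree, and to `0` otherwise.  In top degree over a field both flags are complete,
and this is the pairing for which the complete flags are orthonormal. -/
def chainPairing : Chain L →ₗ[ℤ] ℤ :=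
  Finsupp.linearCombination ℤ fun c =>
    if Set.range (flagLeft c.grid) = Set.range (flagRight c.grid) then 1 else 0

lemma chains_eq_bot {d n : ℕ} (hL : ∀ k (s : Fin (k + 1) → L), StrictMono s → k ≤ d)
    (hn : 2 * d < n) : chains L n = ⊥ := by
  have : {c : Cell L | c.p + c.q = n} = ∅ := by
    ext c
    simp only [Set.mem_ofPred_eq, Set.mem_empty_iff_false, iff_false]
    have h1 := hL _ _ c.isCell.strictMono_flagLeft
    have h2 := hL _ _ c.isCell.strictMono_flagRight
    omega
  rw [chains, this, Finsupp.supported_empty]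

variable (F : Type*) [Field F] (V : Type*) [AddCommGroup V] [Module F V] [Module.Finite F V]

lemma le_finrank_of_strictMono {k : ℕ} (s : Fin (k + 1) → Submodule F V) (hs : StrictMono s) :
    k ≤ Module.finrank F V := by
  have h : ∀ i : Fin (k + 1), (i : ℕ) ≤ Module.finrank F (s i) := by
    intro i
    induction i using Fin.induction with
    | zero => simp
    | succ i ih =>
      have := Submodule.finrank_lt_finrank_of_lt (hs (Fin.castSucc_lt_succ (i := i)))
      simp only [Fin.val_castSucc, Fin.val_succ] at ih ⊢
      omega
  exact (h (Fin.last k)).trans (Submodule.finrank_le _)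

/-- The pairing `St²(V) = St(V) ⊗ St(V) → ℤ` for a vector space `V` of dimension `d`. -/
def pairing (d : ℕ) (hV : Module.finrank F V = d) : St2 F V d →ₗ[ℤ] ℤ :=
  Submodule.liftQ _ (chainPairing (Submodule F V) ∘ₗ (cycles (Submodule F V) (2 * d)).subtype) <| by
    rintro x ⟨y, hy, hyx⟩
    rw [chains_eq_bot (fun k s hs => hV ▸ le_finrank_of_strictMono F V s hs)
      (Nat.lt_succ_self _)] at hy
    have hy0 : y = 0 := hy
    rw [hy0, map_zero] at hyx
    have hx : (x : Chain (Submodule F V)) = 0 := hyx.symm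
    rw [LinearMap.mem_ker, LinearMap.comp_apply, Submodule.subtype_apply, hx, map_zero]

lemma pairing_rho (d : ℕ) (hV : Module.finrank F V = d) (g : V ≃ₗ[F] V) :
    pairing F V d hV ∘ₗ rho F V d g = pairing F V d hV := by
  have hc : ∀ y, chainPairing _ ((autHom g).mapChain y) = chainPairing (Submodule F V) y := by
    intro y
    induction y using Finsupp.induction_linear with
    | zero => simp
    | add x y hx hy => simp only [map_add, hx, hy]
    | single c n =>
      rw [BuildingHom.mapChain_single, chainPairing, Finsupp.linearCombination_single,
        Finsupp.linearCombination_single]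
      have h1 : Set.range (flagLeft ((autHom g).mapCell c).grid) =
          Submodule.orderIsoMapComap g '' Set.range (flagLeft c.grid) :=
        Set.range_comp (Submodule.orderIsoMapComap g) (flagLeft c.grid)
      have h2 : Set.range (flagRight ((autHom g).mapCell c).grid) =
          Submodule.orderIsoMapComap g '' Set.range (flagRight c.grid) :=
        Set.range_comp (Submodule.orderIsoMapComap g) (flagRight c.grid)
      simp only [h1, h2, (Submodule.orderIsoMapComap g).injective.image_injective.eq_iff]
  refine LinearMap.ext fun x => ?_
  obtain ⟨x, rfl⟩ := Submodule.Quotient.mk_surjective _ x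
  exact hc x

/-- The map `St²(V)_{GL(V)} → ℤ` induced by the pairing. -/
def coinvariantsPairing (d : ℕ) (hV : Module.finrank F V = d) :
    (rho F V d).Coinvariants →ₗ[ℤ] ℤ :=
  Representation.Coinvariants.lift _ (pairing F V d hV) (pairing_rho F V d hV)

end Pairing

/-! ### Reduction to a field -/

section Reduction

variable {A : Type*} [CommRing A] {M : Type*} [AddCommGroup M] [Module A M]
  (F : Type*) [Field F] [Algebra A F]

lemma baseChange_sup (P Q : Submodule A M) :
    (P ⊔ Q).baseChange F = P.baseChange F ⊔ Q.baseChange F := by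
  apply le_antisymm
  · rw [Submodule.baseChange_eq_span, Submodule.span_le]
    rintro _ ⟨x, hx, rfl⟩
    obtain ⟨y, hy, z, hz, rfl⟩ := Submodule.mem_sup.1 hx
    change (1 : F) ⊗ₜ[A] (y + z) ∈ _
    rw [TensorProduct.tmul_add]
    exact Submodule.add_mem_sup (Submodule.tmul_mem_baseChange_of_mem _ hy)
      (Submodule.tmul_mem_baseChange_of_mem _ hz)
  · exact sup_le (Submodule.baseChange_mono F le_sup_left) (Submodule.baseChange_mono F le_sup_right)

lemma baseChange_map {N : Type*} [AddCommGroup N] [Module A N] (f : M →ₗ[A] N)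
    (P : Submodule A M) : (P.map f).baseChange F = (P.baseChange F).map (f.baseChange F) := by
  rw [Submodule.baseChange_eq_span, Submodule.baseChange_eq_span, Submodule.map_span]
  congr 1
  ext x
  simp

lemma baseChange_disjoint {P Q : Submodule A M} (h : IsCompl P Q) :
    Disjoint (P.baseChange F) (Q.baseChange F) := by
  let e : M →ₗ[A] M := P.subtype ∘ₗ P.projectionOnto Q h
  have h1 : ∀ x ∈ P.baseChange F, e.baseChange F x = x := by
    intro x hx
    rw [Submodule.baseChange_eq_span] at hx
    induction hx using Submodule.span_induction with
    | mem x hx =>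
      obtain ⟨y, hy, rfl⟩ := hx
      have : e y = y := by
        exact congrArg Subtype.val (Submodule.projectionOnto_apply_left h ⟨y, hy⟩)
      simp [this]
    | zero => simp
    | add x y _ _ hx hy => rw [map_add, hx, hy]
    | smul a x _ hx => rw [map_smul, hx]
  have h2 : ∀ x ∈ Q.baseChange F, e.baseChange F x = 0 := by
    intro x hx
    rw [Submodule.baseChange_eq_span] at hx
    induction hx using Submodule.span_induction with
    | mem x hx =>
      obtain ⟨y, hy, rfl⟩ := hx
      have : e y = 0 := by
        exact congrArg Subtype.val (Submodule.projectionOnto_apply_right h ⟨y, hy⟩)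
      simp [this]
    | zero => simp
    | add x y _ _ hx hy => rw [map_add, hx, hy, add_zero]
    | smul a x _ hx => rw [map_smul, hx, smul_zero]
  rw [Submodule.disjoint_def]
  intro x hx hx'
  rw [← h1 x hx, h2 x hx']

lemma eq_bot_of_baseChange_eq_bot [ConnectedSpace (PrimeSpectrum A)] [Module.Finite A M]
    [Module.Projective A M] {P : Submodule A M} (hP : IsComplemented P)
    (h : P.baseChange F = ⊥) : P = ⊥ := by
  obtain ⟨Q, hQ⟩ := hP
  let r : M →ₗ[A] P := P.projectionOnto Q hQ
  have hr : r ∘ₗ P.subtype = LinearMap.id :=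
    LinearMap.ext fun x => Submodule.projectionOnto_apply_left hQ x
  have : Module.Projective A P := Module.Projective.of_split P.subtype r hr
  have : Module.Finite A P := Module.Finite.of_surjective r fun x => ⟨x, LinearMap.congr_fun hr x⟩
  have : Module.FinitePresentation A P := Module.finitePresentation_of_projective A P
  have : Subsingleton (F ⊗[A] P) := by
    refine subsingleton_of_forall_eq 0 fun x => ?_
    have h1 : P.subtype.baseChange F x = 0 := by
      have : P.subtype.baseChange F x ∈ P.baseChange F := by
        induction x using TensorProduct.induction_on with
        | zero => simp
        | tmul a y => exact Submodule.tmul_mem_baseChange_of_mem a y.2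
        | add x y hx hy => rw [map_add]; exact add_mem hx hy
      rwa [h, Submodule.mem_bot] at this
    have h2 : r.baseChange F (P.subtype.baseChange F x) = x := by
      rw [← LinearMap.comp_apply, ← LinearMap.baseChange_comp, hr, LinearMap.baseChange_id]
      rfl
    rw [← h2, h1, map_zero]
  have h0 : Module.rankAtStalk (R := A) P = 0 := by
    let p : PrimeSpectrum F := ⟨⊥, Ideal.isPrime_bot⟩
    have h1 : Module.rankAtStalk (R := A) P (p.comap (algebraMap A F)) = 0 := by
      rw [← Module.rankAtStalk_baseChange, Module.rankAtStalk_eq_zero_of_subsingleton]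
      rfl
    funext x
    have hl : IsLocallyConstant (Module.rankAtStalk (R := A) P) :=
      Module.isLocallyConstant_rankAtStalk
    rw [hl.apply_eq_of_preconnectedSpace x (p.comap (algebraMap A F)), h1]
    rfl
  rw [Module.rankAtStalk_eq_zero_iff_subsingleton] at h0
  exact Submodule.subsingleton_iff_eq_bot.1 h0

variable (A M) in
lemma finrank_tensor [Module.Finite A M] [Module.Projective A M] {d : ℕ} (hM : ∀ p : PrimeSpectrum A, Module.rankAtStalk M p = d) :
    Module.finrank F (F ⊗[A] M) = d := by
  let p : PrimeSpectrum F := ⟨⊥, Ideal.isPrime_bot⟩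
  have h := Module.rankAtStalk_baseChange (R := A) (M := M) (S := F) p
  rw [Module.rankAtStalk_eq_finrank_of_free, hM] at h
  exact h

variable (A M) [ConnectedSpace (PrimeSpectrum A)] [Module.Finite A M] [Module.Projective A M]

/-- The map of buildings `D²(M) → D²(F ⊗ M)` sending a summand `P ⊆ M` to `F ⊗ P ⊆ F ⊗ M`. -/
def reduction : BuildingHom (Submodule A M) (Submodule F (F ⊗[A] M)) where
  toFun P := P.baseChange F
  map_sup := baseChange_sup F
  map_bot := Submodule.baseChange_bot F
  map_top := Submodule.baseChange_top F
  map_disjoint _ _ := baseChange_disjoint F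
  eq_bot _ := eq_bot_of_baseChange_eq_bot F

lemma reduction_equivariant (d : ℕ) (g : M ≃ₗ[A] M) (x : St2 A M d) :
    (reduction A M F).mapHomology (2 * d) (rho A M d g x) =
      rho F (F ⊗[A] M) d (g.baseChange A F M M) ((reduction A M F).mapHomology (2 * d) x) :=
  BuildingHom.mapHomology_congr _ _ _ _ (fun P => baseChange_map F (g : M →ₗ[A] M) P) _ _

/-- The map `St²(M)_{GL(M)} → St²(F ⊗ M)_{GL(F ⊗ M)}` induced by reduction. -/
def coinvariantsReduction (d : ℕ) :
    (rho A M d).Coinvariants →ₗ[ℤ] (rho F (F ⊗[A] M) d).Coinvariants :=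
  Representation.Coinvariants.lift _
    (Representation.Coinvariants.mk _ ∘ₗ (reduction A M F).mapHomology (2 * d)) fun g => by
      refine LinearMap.ext fun x => ?_
      change Representation.Coinvariants.mk _ ((reduction A M F).mapHomology (2 * d) _) = _
      rw [reduction_equivariant, Representation.Coinvariants.mk_self_apply]
      rfl

/-- The composition `St²(M)_{GL(M)} → St²(M ⊗ A/𝔪)_{GL(M ⊗ A/𝔪)} → ℤ`, for a projective module `M`
of rank `d` and a maximal ideal `𝔪`. -/
def augmentation (d : ℕ) (hM : ∀ p : PrimeSpectrum A, Module.rankAtStalk M p = d)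
    (m : Ideal A) [m.IsMaximal] : (rho A M d).Coinvariants →ₗ[ℤ] ℤ :=
  letI : Field (A ⧸ m) := Ideal.Quotient.field m
  coinvariantsPairing (A ⧸ m) ((A ⧸ m) ⊗[A] M) d (finrank_tensor A M (A ⧸ m) hM) ∘ₗ
    coinvariantsReduction A M (A ⧸ m) d

end Reduction

end DoubleBuilding

end

/-! No flag in a summand lattice of rank `d` is longer than `d`, so the cells of degree `2d` are
those of bidegree `(d, d)`. Such a cell is recovered from its two complete flags by intersecting
them. A chain of top degree is therefore a combination of pairs of flags. It is a cycle iff, in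
either flag and at each inner rank, the coefficients of the cells that differ only in that entry sum
to zero (`sum_left_eq_zero`, `sum_right_eq_zero`). Base change preserves and reflects equality of
the two flags of a cell, so the augmentation of a cycle is the sum of its coefficients at cells with
equal flags (`augmentation_cls`).

By `bijective_augmentation` it is enough to find a class `t` in the coinvariants such that every
cycle `x` has class `⟨x⟩ t`, where `⟨x⟩` is that sum, together with one cycle with `⟨x⟩ ≠ 0`.
Products `z ⊗ z` of a cycle of flags with itself serve for the latter, since `⟨z ⊗ z⟩` is a sum of
squares.

To find `t`, write `x` as a combination of products of standard cycles whose points lie in one of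
finitely many types of position. `GL(M)` is transitive on the bases of `M`, hence on each type, so
each type has a single class. The number of products of each type, counted with coefficients, is a
multiple of `⟨x⟩` by the cycle relations.

In rank two, `x = ∑ n (a - c) ⊗ (b - c)` for any point `c`. If `c` is complementary to all points
that occur, the types are `a = b` and `a ≠ b`, with counts `⟨x⟩` and `-⟨x⟩`, and `t = t₁ - t₂`.

In rank three, a cell is a pair of flags `(p, l)`, `(p', l')` of a point on a line. With `c` outside
all the lines, `x` is a combination of products of triangles `(c, p, q) ⊗ (c, p', q)`. Here `q` is
an auxiliary point on `l` if `l = l'`, and `q = l ∩ l'` otherwise. The product vanishes if `l ≠ l'`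
and `p` lies on `l'` or `p'` on `l`. Three types remain: `l = l'` with `p = p'`; `l = l'` with `p ≠
p'`; and four points in general position. Their counts are `⟨x⟩`, `-⟨x⟩`, `-⟨x⟩`, and `t = t₁ - t₂ -
t₃`.

Over a ring two flags form a cell only if their intersections and the relevant sums are summands.
The auxiliary points must therefore be in good position with respect to everything in the finite
support of `x`. Infinite residue fields provide them: finitely many summands of corank one have a
common complement (`exists_common_complement`). In rank at most one there is only one top cell. -/

noncomputable section

set_option linter.unusedSectionVars false

namespace DoubleBuilding

/-! ### Flags, intersection grids, and the faces of a cell. -/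

section Flags

variable {L : Type*} [Lattice L] [BoundedOrder L] {p q : ℕ}

/-- A flag with its `i`-th entry removed. -/
def flagFace (i : Fin (p + 2)) (F : Fin (p + 2) →o L) : Fin (p + 1) →o L :=
  F.comp i.succAboveOrderEmb.toOrderHom

/-- The grid of intersections of two flags. -/
def meetGrid (F : Fin (p + 1) →o L) (G : Fin (q + 1) →o L) : Grid L p q where
  toFun x := F x.1 ⊓ G x.2
  monotone' _ _ h := inf_le_inf (F.monotone h.1) (G.monotone h.2)

@[simp] lemma meetGrid_apply (F : Fin (p + 1) →o L) (G : Fin (q + 1) →o L) (x) :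
    meetGrid F G x = F x.1 ⊓ G x.2 := rfl

lemma faceLeft_meetGrid (i : Fin (p + 2)) (F : Fin (p + 2) →o L) (G : Fin (q + 1) →o L) :
    faceLeft i (meetGrid F G) = meetGrid (flagFace i F) G := rfl

lemma faceRight_meetGrid (i : Fin (q + 2)) (F : Fin (p + 1) →o L) (G : Fin (q + 2) →o L) :
    faceRight i (meetGrid F G) = meetGrid F (flagFace i G) := rfl

/-- The entries of the first flag of a cell, continued constantly. -/
def Cell.left (c : Cell L) (n : ℕ) : L :=
  c.grid (⟨min n c.p, by omega⟩, Fin.last _)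

/-- The entries of the second flag of a cell, continued constantly. -/
def Cell.right (c : Cell L) (n : ℕ) : L :=
  c.grid (Fin.last _, ⟨min n c.q, by omega⟩)

lemma IsFull.apply_eq_top {φ : Grid L p q} (h : IsFull φ) {a b} (ha : a = Fin.last p)
    (hb : b = Fin.last q) : φ (a, b) = ⊤ := by
  rw [ha, hb, h.last]

lemma Cell.left_zero (c : Cell L) : c.left 0 = ⊥ := c.isCell.isFull.zero_left _

lemma Cell.right_zero (c : Cell L) : c.right 0 = ⊥ := c.isCell.isFull.zero_right _

lemma Cell.left_top (c : Cell L) {n : ℕ} (h : c.p ≤ n) : c.left n = ⊤ :=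
  c.isCell.isFull.apply_eq_top (Fin.ext (by simp [h])) rfl

lemma Cell.right_top (c : Cell L) {n : ℕ} (h : c.q ≤ n) : c.right n = ⊤ :=
  c.isCell.isFull.apply_eq_top rfl (Fin.ext (by simp [h]))

lemma Cell.left_lt (c : Cell L) {m n : ℕ} (h : m < n) (hn : n ≤ c.p) : c.left m < c.left n :=
  c.isCell.strictMono_flagLeft (Fin.mk_lt_mk.2 (by omega))

lemma Cell.right_lt (c : Cell L) {m n : ℕ} (h : m < n) (hn : n ≤ c.q) : c.right m < c.right n :=
  c.isCell.strictMono_flagRight (Fin.mk_lt_mk.2 (by omega))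

lemma Cell.left_isComplemented (c : Cell L) (n : ℕ) : IsComplemented (c.left n) :=
  c.isCell.isLattice.isComplemented _

lemma Cell.right_isComplemented (c : Cell L) (n : ℕ) : IsComplemented (c.right n) :=
  c.isCell.isLattice.isComplemented _

lemma Cell.inf_isComplemented (c : Cell L) (m n : ℕ) :
    IsComplemented (c.left m ⊓ c.right n) := by
  rw [Cell.left, Cell.right, c.isCell.isLattice.inf_eq _ _ _ _ (Fin.le_last _) (Fin.le_last _)]
  exact c.isCell.isLattice.isComplemented _

lemma Cell.sup_isComplemented (c : Cell L) (m n : ℕ) :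
    IsComplemented (c.left m ⊔ c.right n) :=
  c.isCell.isLattice.sup_isComplemented _ _ _ _ (Fin.le_last _) (Fin.le_last _)

/-- An inner face keeps the bottom and the top entry. Non-degeneracy can be tested on the two flags,
which remain strictly increasing. -/
lemma IsCell.faceLeft {φ : Grid L (p + 1) q} (h : IsCell φ) {i : Fin (p + 2)} (h0 : i ≠ 0)
    (hl : i ≠ Fin.last _) : IsCell (faceLeft i φ) where
  isLattice := h.isLattice.faceLeft i
  isFull := by
    refine ⟨fun b => ?_, fun a => h.isFull.zero_right _, ?_⟩
    · change φ (i.succAbove 0, b) = ⊥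
      rw [Fin.succAbove_ne_zero_zero h0, h.isFull.zero_left]
    · change φ (i.succAbove (Fin.last _), _) = ⊤
      rw [Fin.succAbove_ne_last_last hl]
      exact h.isFull.last
  isNondegenerate := by
    refine ⟨fun j => ⟨Fin.last _, fun e => ?_⟩, fun j => ⟨Fin.last _, fun e => ?_⟩⟩
    · have := i.succAbove_right_injective (h.strictMono_flagLeft.injective e)
      exact (Fin.castSucc_lt_succ (i := j)).ne this
    · change φ (i.succAbove (Fin.last _), _) = φ (i.succAbove (Fin.last _), _) at e
      rw [Fin.succAbove_ne_last_last hl] at e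
      exact (Fin.castSucc_lt_succ (i := j)).ne (h.strictMono_flagRight.injective e)

lemma IsCell.faceRight {φ : Grid L p (q + 1)} (h : IsCell φ) {i : Fin (q + 2)} (h0 : i ≠ 0)
    (hl : i ≠ Fin.last _) : IsCell (faceRight i φ) where
  isLattice := h.isLattice.faceRight i
  isFull := by
    refine ⟨fun b => h.isFull.zero_left _, fun a => ?_, ?_⟩
    · change φ (a, i.succAbove 0) = ⊥
      rw [Fin.succAbove_ne_zero_zero h0, h.isFull.zero_right]
    · change φ (_, i.succAbove (Fin.last _)) = ⊤
      rw [Fin.succAbove_ne_last_last hl]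
      exact h.isFull.last
  isNondegenerate := by
    refine ⟨fun j => ⟨Fin.last _, fun e => ?_⟩, fun j => ⟨Fin.last _, fun e => ?_⟩⟩
    · change φ (_, i.succAbove (Fin.last _)) = φ (_, i.succAbove (Fin.last _)) at e
      rw [Fin.succAbove_ne_last_last hl] at e
      exact (Fin.castSucc_lt_succ (i := j)).ne (h.strictMono_flagLeft.injective e)
    · have := i.succAbove_right_injective (h.strictMono_flagRight.injective e)
      exact (Fin.castSucc_lt_succ (i := j)).ne this

lemma gen_of_isCell {φ : Grid L p q} (h : IsCell φ) :
    gen φ = Finsupp.single ⟨p, q, φ, h⟩ 1 := dif_pos h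

lemma gen_of_not_isCell {φ : Grid L p q} (h : ¬ IsCell φ) : gen φ = 0 := dif_neg h

/-- The index of the `n`-th entry of a flag from which the `i`-th entry was removed. -/
def skip (i n : ℕ) : ℕ := if n < i then n else n + 1

lemma val_succAbove {n : ℕ} (i : Fin (n + 1)) (j : Fin n) :
    (i.succAbove j : ℕ) = skip i j := by
  rw [skip]
  by_cases h : (j : ℕ) < i
  · rw [if_pos h, Fin.succAbove_of_castSucc_lt _ _ (Fin.lt_def.2 h)]
    rfl
  · rw [if_neg h, Fin.succAbove_of_le_castSucc _ _ (Fin.le_def.2 (not_lt.1 h))]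
    rfl

lemma left_faceLeft {φ : Grid L (p + 1) q} (h : IsCell φ) {i : Fin (p + 2)}
    (hl : i ≠ Fin.last _) (h' : IsCell (faceLeft i φ)) (n : ℕ) :
    Cell.left ⟨p, q, _, h'⟩ n = Cell.left ⟨p + 1, q, φ, h⟩ (skip i n) := by
  change φ (i.succAbove _, _) = φ (_, _)
  congr 2
  apply Fin.ext
  have := Fin.val_lt_last hl
  rw [val_succAbove]
  simp only [skip]
  split_ifs <;> omega

lemma right_faceRight {φ : Grid L p (q + 1)} (h : IsCell φ) {i : Fin (q + 2)}
    (hl : i ≠ Fin.last _) (h' : IsCell (faceRight i φ)) (n : ℕ) :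
    Cell.right ⟨p, q, _, h'⟩ n = Cell.right ⟨p, q + 1, φ, h⟩ (skip i n) := by
  change φ (_, i.succAbove _) = φ (_, _)
  congr 2
  apply Fin.ext
  have := Fin.val_lt_last hl
  rw [val_succAbove]
  simp only [skip]
  split_ifs <;> omega

lemma right_faceLeft {φ : Grid L (p + 1) q} (h : IsCell φ) {i : Fin (p + 2)}
    (hl : i ≠ Fin.last _) (h' : IsCell (faceLeft i φ)) (n : ℕ) :
    Cell.right ⟨p, q, _, h'⟩ n = Cell.right ⟨p + 1, q, φ, h⟩ n := by
  change φ (i.succAbove _, _) = φ (_, _)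
  rw [Fin.succAbove_ne_last_last hl]
  rfl

lemma left_faceRight {φ : Grid L p (q + 1)} (h : IsCell φ) {i : Fin (q + 2)}
    (hl : i ≠ Fin.last _) (h' : IsCell (faceRight i φ)) (n : ℕ) :
    Cell.left ⟨p, q, _, h'⟩ n = Cell.left ⟨p, q + 1, φ, h⟩ n := by
  change φ (_, i.succAbove _) = φ (_, _)
  rw [Fin.succAbove_ne_last_last hl]
  rfl

/-- The outer faces go to the base point, so that only inner faces contribute to the boundary of a
cell. -/
lemma not_isFull_faceLeft_zero {φ : Grid L (p + 1) q} (h : IsCell φ) :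
    ¬ IsFull (faceLeft 0 φ) := fun hF =>
  (h.strictMono_flagLeft (Fin.succ_pos 0)).ne
    ((h.isFull.zero_left _).trans (hF.zero_left (Fin.last q)).symm)

lemma not_isFull_faceLeft_last {φ : Grid L (p + 1) q} (h : IsCell φ) :
    ¬ IsFull (faceLeft (Fin.last _) φ) := fun hF => by
  have := hF.last
  change φ ((Fin.last _).succAbove _, _) = ⊤ at this
  rw [Fin.succAbove_last_apply] at this
  exact (h.strictMono_flagLeft (Fin.castSucc_lt_last _)).ne (this.trans h.isFull.last.symm)

lemma not_isFull_faceRight_zero {φ : Grid L p (q + 1)} (h : IsCell φ) :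
    ¬ IsFull (faceRight 0 φ) := fun hF =>
  (h.strictMono_flagRight (Fin.succ_pos 0)).ne
    ((h.isFull.zero_right _).trans (hF.zero_right (Fin.last p)).symm)

lemma not_isFull_faceRight_last {φ : Grid L p (q + 1)} (h : IsCell φ) :
    ¬ IsFull (faceRight (Fin.last _) φ) := fun hF => by
  have := hF.last
  change φ (_, (Fin.last _).succAbove _) = ⊤ at this
  rw [Fin.succAbove_last_apply] at this
  exact (h.strictMono_flagRight (Fin.castSucc_lt_last _)).ne (this.trans h.isFull.last.symm)

end Flags

/-! ### Rank functions and the cycle relations in top degree. -/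

section Ranked

variable {L : Type*} [Lattice L] [BoundedOrder L] {N : Type*} [AddCommGroup N]

/-- A rank function on the complemented elements of a bounded lattice of rank `d`. -/
structure IsRanked (rk : L → ℕ) (d : ℕ) : Prop where
  lt : ∀ x y, IsComplemented x → IsComplemented y → x < y → rk x < rk y
  top : rk ⊤ = d

variable {rk : L → ℕ} {d : ℕ}

lemma IsRanked.add_le_of_chain (hr : IsRanked rk d) {f : ℕ → L} {p : ℕ}
    (hf : ∀ m n, m < n → n ≤ p → f m < f n) (hc : ∀ n, IsComplemented (f n)) (n k : ℕ)
    (h : n + k ≤ p) : rk (f n) + k ≤ rk (f (n + k)) := by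
  induction k with
  | zero => simp
  | succ k ih =>
    have h1 := ih (by omega)
    have h2 := hr.lt _ _ (hc (n + k)) (hc (n + k + 1)) (hf _ _ (by omega) (by omega))
    rw [← add_assoc, ← add_assoc]
    omega

lemma IsRanked.le_of_chain (hr : IsRanked rk d) {f : ℕ → L} {p : ℕ}
    (hf : ∀ m n, m < n → n ≤ p → f m < f n) (hc : ∀ n, IsComplemented (f n)) (ht : f p = ⊤) :
    p ≤ d := by
  have := hr.add_le_of_chain hf hc 0 p (by omega)
  rw [zero_add, ht, hr.top] at this
  omega

/-- The rank rises by at least one at each of the `d` steps and ends at `d`, so it rises by exactly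
one, starting from zero. -/
lemma IsRanked.eq_of_chain (hr : IsRanked rk d) {f : ℕ → L}
    (hf : ∀ m n, m < n → n ≤ d → f m < f n) (hc : ∀ n, IsComplemented (f n)) (ht : f d = ⊤)
    {n : ℕ} (hn : n ≤ d) : rk (f n) = n := by
  have h1 := hr.add_le_of_chain hf hc 0 n (by omega)
  have h2 := hr.add_le_of_chain hf hc n (d - n) (by omega)
  rw [Nat.add_sub_cancel' hn, ht, hr.top] at h2
  rw [zero_add] at h1
  omega

lemma IsRanked.p_le (hr : IsRanked rk d) (c : Cell L) : c.p ≤ d :=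
  hr.le_of_chain (fun _ _ => c.left_lt) c.left_isComplemented (c.left_top le_rfl)

lemma IsRanked.q_le (hr : IsRanked rk d) (c : Cell L) : c.q ≤ d :=
  hr.le_of_chain (fun _ _ => c.right_lt) c.right_isComplemented (c.right_top le_rfl)

lemma IsRanked.rk_left (hr : IsRanked rk d) {c : Cell L} (hc : c.p = d) {n : ℕ} (hn : n ≤ d) :
    rk (c.left n) = n :=
  hr.eq_of_chain (fun _ _ h h' => c.left_lt h (hc ▸ h')) c.left_isComplemented
    (c.left_top hc.le) hn

lemma IsRanked.rk_right (hr : IsRanked rk d) {c : Cell L} (hc : c.q = d) {n : ℕ} (hn : n ≤ d) :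
    rk (c.right n) = n :=
  hr.eq_of_chain (fun _ _ h h' => c.right_lt h (hc ▸ h')) c.right_isComplemented
    (c.right_top hc.le) hn

lemma IsRanked.p_eq_of_mem (hr : IsRanked rk d) {x : Chain L} (hx : x ∈ chains L (2 * d))
    {c : Cell L} (hc : c ∈ x.support) : c.p = d := by
  have h1 : c.p + c.q = 2 * d := hx hc
  have := hr.p_le c
  have := hr.q_le c
  omega

lemma IsRanked.q_eq_of_mem (hr : IsRanked rk d) {x : Chain L} (hx : x ∈ chains L (2 * d))
    {c : Cell L} (hc : c ∈ x.support) : c.q = d := by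
  have h1 : c.p + c.q = 2 * d := hx hc
  have := hr.p_le c
  have := hr.q_le c
  omega

lemma bdry_single (c : Cell L) :
    bdry L (Finsupp.single c 1) = bdryLeft c.grid + (-1 : ℤ) ^ c.p • bdryRight c.grid := by
  rw [bdry, Finsupp.linearCombination_single, one_smul]

lemma linearCombination_gen_eq_zero (v : Cell L → N) {p q : ℕ} (φ : Grid L p q)
    (h : ∀ hφ : IsCell φ, v ⟨p, q, φ, hφ⟩ = 0) : Finsupp.linearCombination ℤ v (gen φ) = 0 := by
  by_cases hφ : IsCell φ
  · rw [gen_of_isCell hφ, Finsupp.linearCombination_single, h hφ, smul_zero]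
  · rw [gen_of_not_isCell hφ, map_zero]

open Classical in
/-- The functional on chains which evaluates `h` on the cells of bidegree `(d, d + 1)` whose first
flag misses exactly the rank `i`. -/
def leftFunctional (rk : L → ℕ) (d i : ℕ) (h : (ℕ → L) → (ℕ → L) → N) : Chain L →ₗ[ℤ] N :=
  Finsupp.linearCombination ℤ fun c =>
    if c.p = d ∧ c.q = d + 1 ∧ ∀ n ≤ d, rk (c.left n) = skip i n then h c.left c.right else 0

open Classical in
/-- The functional on chains which evaluates `h` on the cells of bidegree `(d + 1, d)` whose second
flag misses exactly the rank `i`. -/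
def rightFunctional (rk : L → ℕ) (d i : ℕ) (h : (ℕ → L) → (ℕ → L) → N) : Chain L →ₗ[ℤ] N :=
  Finsupp.linearCombination ℤ fun c =>
    if c.p = d + 1 ∧ c.q = d ∧ ∀ n ≤ d, rk (c.right n) = skip i n then h c.left c.right else 0

lemma skip_le {i n d : ℕ} (h : n ≤ d) : skip i n ≤ d + 1 := by
  rw [skip]; split_ifs <;> omega

lemma eq_of_skip_eq {i j d : ℕ} (hi : i ≤ d) (hj : j ≤ d)
    (h : ∀ n ≤ d, skip i n = skip j n) : i = j := by
  have h1 := h i hi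
  have h2 := h j hj
  simp only [skip] at h1 h2
  split_ifs at h1 h2 <;> omega

/-- The lattice has rank `d + 1`. Faces in the second direction keep first degree `d + 1` and are
not seen by the functional. Among the faces in the first direction, the ranks in the shortened flag
tell which entry was removed, so only the `i`-th survives. As `h` is arbitrary with values in any
group, it serves as a test function for the coefficients of cycles. -/
lemma leftFunctional_bdry (hr : IsRanked rk (d + 1)) {i : ℕ} (hi0 : 0 < i) (hi : i ≤ d)
    (h : (ℕ → L) → (ℕ → L) → N) {c : Cell L} (hp : c.p = d + 1) (hq : c.q = d + 1) :
    leftFunctional rk d i h (bdry L (Finsupp.single c 1)) =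
      (-1 : ℤ) ^ i • h (fun n => c.left (skip i n)) c.right := by
  have hleft := fun {n} => hr.rk_left hp (n := n)
  obtain ⟨p, q, φ, hφ⟩ := c
  obtain rfl : p = d + 1 := hp
  obtain rfl : q = d + 1 := hq
  rw [bdry_single, map_add, map_smul]
  simp only [bdryLeft, bdryRight, map_sum, map_smul]
  rw [Finset.sum_eq_single (⟨i, by omega⟩ : Fin (d + 2)), Finset.sum_eq_zero, smul_zero, add_zero]
  · have h0 : (⟨i, by omega⟩ : Fin (d + 2)) ≠ 0 := by simp [Fin.ext_iff]; omega
    have hl : (⟨i, by omega⟩ : Fin (d + 2)) ≠ Fin.last _ := by simp [Fin.ext_iff]; omega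
    rw [gen_of_isCell (hφ.faceLeft h0 hl), leftFunctional, Finsupp.linearCombination_single,
      one_smul, if_pos]
    · congr 2
      · exact funext fun n => left_faceLeft hφ hl _ n
      · exact funext fun n => right_faceLeft hφ hl _ n
    · refine ⟨rfl, rfl, fun n hn => ?_⟩
      rw [left_faceLeft hφ hl, hleft (skip_le hn)]
  · intro j _
    rw [leftFunctional, linearCombination_gen_eq_zero, smul_zero]
    exact fun _ => if_neg fun e => absurd e.1 (by simp)
  · intro j _ hj
    rw [leftFunctional, linearCombination_gen_eq_zero, smul_zero]
    refine fun hc => if_neg fun e => hj ?_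
    have hl : j ≠ Fin.last _ := by
      rintro rfl
      exact not_isFull_faceLeft_last hφ hc.isFull
    have := Fin.val_lt_last hl
    refine Fin.ext (eq_of_skip_eq (d := d) (by omega) hi fun n hn => ?_)
    rw [← e.2.2 n hn, left_faceLeft hφ hl, hleft (skip_le hn)]
  · simp

/-- The mirror image of `leftFunctional_bdry`; the extra sign is that of the total complex. -/
lemma rightFunctional_bdry (hr : IsRanked rk (d + 1)) {i : ℕ} (hi0 : 0 < i) (hi : i ≤ d)
    (h : (ℕ → L) → (ℕ → L) → N) {c : Cell L} (hp : c.p = d + 1) (hq : c.q = d + 1) :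
    rightFunctional rk d i h (bdry L (Finsupp.single c 1)) =
      (-1 : ℤ) ^ (d + 1) • (-1 : ℤ) ^ i • h c.left (fun n => c.right (skip i n)) := by
  have hright := fun {n} => hr.rk_right hq (n := n)
  obtain ⟨p, q, φ, hφ⟩ := c
  obtain rfl : p = d + 1 := hp
  obtain rfl : q = d + 1 := hq
  rw [bdry_single, map_add, map_smul]
  simp only [bdryLeft, bdryRight, map_sum, map_smul]
  rw [Finset.sum_eq_zero, zero_add, Finset.sum_eq_single (⟨i, by omega⟩ : Fin (d + 2))]
  · have h0 : (⟨i, by omega⟩ : Fin (d + 2)) ≠ 0 := by simp [Fin.ext_iff]; omega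
    have hl : (⟨i, by omega⟩ : Fin (d + 2)) ≠ Fin.last _ := by simp [Fin.ext_iff]; omega
    rw [gen_of_isCell (hφ.faceRight h0 hl), rightFunctional, Finsupp.linearCombination_single,
      one_smul, if_pos]
    · congr 3
      · exact funext fun n => left_faceRight hφ hl _ n
      · exact funext fun n => right_faceRight hφ hl _ n
    · refine ⟨rfl, rfl, fun n hn => ?_⟩
      rw [right_faceRight hφ hl, hright (skip_le hn)]
  · intro j _ hj
    rw [rightFunctional, linearCombination_gen_eq_zero, smul_zero]
    refine fun hc => if_neg fun e => hj ?_
    have hl : j ≠ Fin.last _ := by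
      rintro rfl
      exact not_isFull_faceRight_last hφ hc.isFull
    have := Fin.val_lt_last hl
    refine Fin.ext (eq_of_skip_eq (d := d) (by omega) hi fun n hn => ?_)
    rw [← e.2.2 n hn, right_faceRight hφ hl, hright (skip_le hn)]
  · simp
  · intro j _
    rw [rightFunctional, linearCombination_gen_eq_zero, smul_zero]
    exact fun _ => if_neg fun e => absurd e.1 (by simp)

lemma apply_bdry_eq_sum (Φ : Chain L →ₗ[ℤ] N) (x : Chain L) :
    Φ (bdry L x) = x.sum fun c n => n • Φ (bdry L (Finsupp.single c 1)) := by
  conv_lhs => rw [← Finsupp.sum_single x]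
  simp only [Finsupp.sum, map_sum]
  refine Finset.sum_congr rfl fun c _ => ?_
  rw [← map_smul, ← map_smul, Finsupp.smul_single_one]

/-- In a cycle of top degree, the coefficients of the cells that differ only in the entry of rank
`i` of the first flag sum to zero. -/
lemma sum_left_eq_zero (hr : IsRanked rk (d + 1)) {i : ℕ} (hi0 : 0 < i) (hi : i ≤ d)
    (h : (ℕ → L) → (ℕ → L) → N) {x : Chain L} (hx : x ∈ cycles L (2 * (d + 1))) :
    (x.sum fun c n => n • h (fun n => c.left (skip i n)) c.right) = 0 := by
  have h1 : leftFunctional rk d i h (bdry L x) = 0 := by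
    rw [show bdry L x = 0 from hx.2, map_zero]
  rw [apply_bdry_eq_sum, Finsupp.sum] at h1
  have h2 := congrArg ((-1 : ℤ) ^ i • ·) h1
  simp only [smul_zero, Finset.smul_sum] at h2
  rw [Finsupp.sum, ← h2]
  refine Finset.sum_congr rfl fun c hc => ?_
  rw [leftFunctional_bdry hr hi0 hi h (hr.p_eq_of_mem hx.1 hc) (hr.q_eq_of_mem hx.1 hc),
    smul_comm (x c), smul_smul, ← mul_pow]
  simp

/-- In a cycle of top degree, the coefficients of the cells that differ only in the entry of rank
`i` of the second flag sum to zero. -/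
lemma sum_right_eq_zero (hr : IsRanked rk (d + 1)) {i : ℕ} (hi0 : 0 < i) (hi : i ≤ d)
    (h : (ℕ → L) → (ℕ → L) → N) {x : Chain L} (hx : x ∈ cycles L (2 * (d + 1))) :
    (x.sum fun c n => n • h c.left (fun n => c.right (skip i n))) = 0 := by
  have h1 : rightFunctional rk d i h (bdry L x) = 0 := by
    rw [show bdry L x = 0 from hx.2, map_zero]
  rw [apply_bdry_eq_sum, Finsupp.sum] at h1
  have h2 := congrArg (((-1 : ℤ) ^ (d + 1) * (-1 : ℤ) ^ i) • ·) h1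
  simp only [smul_zero, Finset.smul_sum] at h2
  rw [Finsupp.sum, ← h2]
  refine Finset.sum_congr rfl fun c hc => ?_
  rw [rightFunctional_bdry hr hi0 hi h (hr.p_eq_of_mem hx.1 hc) (hr.q_eq_of_mem hx.1 hc),
    smul_smul ((-1 : ℤ) ^ (d + 1)), smul_comm _ (x c), smul_smul ((-1 : ℤ) ^ (d + 1) * (-1) ^ i),
    mul_mul_mul_comm, ← mul_pow, ← mul_pow]
  simp

end Ranked

/-! ### Products of flag cycles and their self-pairing. -/

section Products

variable {L : Type*} [Lattice L] [BoundedOrder L] {p q : ℕ}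

/-- The bilinear extension of the map sending a pair of flags to its grid of intersections. -/
def tens : ((Fin (p + 1) →o L) →₀ ℤ) →ₗ[ℤ] ((Fin (q + 1) →o L) →₀ ℤ) →ₗ[ℤ] Chain L :=
  Finsupp.linearCombination ℤ fun F => Finsupp.linearCombination ℤ fun G => gen (meetGrid F G)

lemma tens_apply (a : (Fin (p + 1) →o L) →₀ ℤ) (b : (Fin (q + 1) →o L) →₀ ℤ) :
    tens a b = ∑ F ∈ a.support, ∑ G ∈ b.support, (a F * b G) • gen (meetGrid F G) := by
  simp only [tens, Finsupp.linearCombination_apply, Finsupp.sum, LinearMap.sum_apply,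
    LinearMap.smul_apply, Finset.smul_sum, smul_smul]

@[simp] lemma tens_single (F : Fin (p + 1) →o L) (G : Fin (q + 1) →o L) :
    tens (Finsupp.single F 1) (Finsupp.single G 1) = gen (meetGrid F G) := by
  simp [tens]

lemma tens_mapDomain {p' q' : ℕ} (f : (Fin (p + 1) →o L) → (Fin (p' + 1) →o L))
    (g : (Fin (q + 1) →o L) → (Fin (q' + 1) →o L))
    (a : (Fin (p + 1) →o L) →₀ ℤ) (b : (Fin (q + 1) →o L) →₀ ℤ) :
    tens (a.mapDomain f) (b.mapDomain g) =
      ∑ F ∈ a.support, ∑ G ∈ b.support, (a F * b G) • gen (meetGrid (f F) (g G)) := by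
  rw [tens, Finsupp.linearCombination_mapDomain, Finsupp.linearCombination_apply, Finsupp.sum,
    LinearMap.sum_apply]
  refine Finset.sum_congr rfl fun F _ => ?_
  rw [LinearMap.smul_apply, Function.comp_apply, Finsupp.linearCombination_mapDomain,
    Finsupp.linearCombination_apply, Finsupp.sum, Finset.smul_sum]
  simp only [smul_smul, Function.comp_apply]

lemma tens_mapDomain_left {p' : ℕ} (f : (Fin (p + 1) →o L) → (Fin (p' + 1) →o L))
    (a : (Fin (p + 1) →o L) →₀ ℤ) (b : (Fin (q + 1) →o L) →₀ ℤ) :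
    tens (a.mapDomain f) b =
      ∑ F ∈ a.support, ∑ G ∈ b.support, (a F * b G) • gen (meetGrid (f F) G) := by
  simpa only [Finsupp.mapDomain_id, id] using tens_mapDomain f id a b

lemma tens_mapDomain_right {q' : ℕ} (f : (Fin (q + 1) →o L) → (Fin (q' + 1) →o L))
    (a : (Fin (p + 1) →o L) →₀ ℤ) (b : (Fin (q + 1) →o L) →₀ ℤ) :
    tens a (b.mapDomain f) =
      ∑ F ∈ a.support, ∑ G ∈ b.support, (a F * b G) • gen (meetGrid F (f G)) := by
  simpa only [Finsupp.mapDomain_id, id] using tens_mapDomain id f a b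

/-- Products of cycles of flags in pairwise good position are cycles. -/
lemma tens_mem_cycles {d : ℕ} {a b : (Fin (d + 1 + 1) →o L) →₀ ℤ}
    (hcell : ∀ F ∈ a.support, ∀ G ∈ b.support, IsCell (meetGrid F G))
    (ha : ∀ i, i ≠ 0 → i ≠ Fin.last _ → a.mapDomain (flagFace i) = 0)
    (hb : ∀ i, i ≠ 0 → i ≠ Fin.last _ → b.mapDomain (flagFace i) = 0) :
    tens a b ∈ cycles L (2 * (d + 1)) := by
  refine ⟨?_, ?_⟩
  · rw [tens_apply]
    refine sum_mem fun F hF => sum_mem fun G hG => Submodule.smul_mem _ _ ?_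
    rw [gen_of_isCell (hcell F hF G hG)]
    exact Finsupp.single_mem_supported ℤ _ (two_mul _).symm
  · have h1 : ∀ i, ∑ F ∈ a.support, ∑ G ∈ b.support,
        (a F * b G) • gen (faceLeft i (meetGrid F G)) = 0 := by
      intro i
      by_cases hi : i = 0 ∨ i = Fin.last _
      · refine Finset.sum_eq_zero fun F hF => Finset.sum_eq_zero fun G hG => ?_
        rw [gen_of_not_isCell, smul_zero]
        intro hc
        rcases hi with rfl | rfl
        · exact not_isFull_faceLeft_zero (hcell F hF G hG) hc.isFull
        · exact not_isFull_faceLeft_last (hcell F hF G hG) hc.isFull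
      -- An inner face of an intersection grid is the intersection grid of a shortened flag, so the
      -- sum is the product of the vanishing boundary of `a` with `b`.
      · rw [not_or] at hi
        simp only [faceLeft_meetGrid]
        rw [← tens_mapDomain_left, ha i hi.1 hi.2, map_zero, LinearMap.zero_apply]
    have h2 : ∀ i, ∑ F ∈ a.support, ∑ G ∈ b.support,
        (a F * b G) • gen (faceRight i (meetGrid F G)) = 0 := by
      intro i
      by_cases hi : i = 0 ∨ i = Fin.last _
      · refine Finset.sum_eq_zero fun F hF => Finset.sum_eq_zero fun G hG => ?_
        rw [gen_of_not_isCell, smul_zero]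
        intro hc
        rcases hi with rfl | rfl
        · exact not_isFull_faceRight_zero (hcell F hF G hG) hc.isFull
        · exact not_isFull_faceRight_last (hcell F hF G hG) hc.isFull
      · rw [not_or] at hi
        simp only [faceRight_meetGrid]
        rw [← tens_mapDomain_right, hb i hi.1 hi.2, map_zero]
    have h3 : ∀ F ∈ a.support, ∀ G ∈ b.support, bdry L ((a F * b G) • gen (meetGrid F G)) =
        ∑ i : Fin (d + 2), (-1 : ℤ) ^ (i : ℕ) • (a F * b G) • gen (faceLeft i (meetGrid F G)) +
        (-1 : ℤ) ^ (d + 1) • ∑ i : Fin (d + 2), (-1 : ℤ) ^ (i : ℕ) •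
          (a F * b G) • gen (faceRight i (meetGrid F G)) := by
      intro F hF G hG
      rw [map_smul, gen_of_isCell (hcell F hF G hG), bdry_single]
      simp only [bdryLeft, bdryRight, smul_add, smul_comm (a F * b G), Finset.smul_sum]
    change bdry L (tens a b) = 0
    rw [tens_apply]
    simp only [map_sum]
    rw [Finset.sum_congr rfl fun F hF => Finset.sum_congr rfl fun G hG => h3 F hF G hG]
    simp only [Finset.sum_add_distrib, ← Finset.smul_sum]
    have e : ∀ f : (Fin (d + 1 + 1) →o L) → (Fin (d + 1 + 1) →o L) → Fin (d + 2) → Chain L,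
        (∀ i, ∑ F ∈ a.support, ∑ G ∈ b.support, f F G i = 0) →
        ∑ F ∈ a.support, ∑ G ∈ b.support, ∑ i : Fin (d + 2), (-1 : ℤ) ^ (i : ℕ) • f F G i = 0 := by
      intro f hf
      rw [Finset.sum_congr rfl fun F _ => Finset.sum_comm, Finset.sum_comm]
      refine Finset.sum_eq_zero fun i _ => ?_
      simp only [← Finset.smul_sum, hf, smul_zero]
    rw [e _ h1, e _ h2, smul_zero, add_zero]

/-- The image of a flag under an automorphism of the lattice. -/
def mapFlag (e : L ≃o L) (F : Fin (p + 1) →o L) : Fin (p + 1) →o L :=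
  (e : L →o L).comp F

lemma mapChain_tens [IsModularLattice L] (e : L ≃o L) {a : (Fin (p + 1) →o L) →₀ ℤ}
    {b : (Fin (q + 1) →o L) →₀ ℤ}
    (hcell : ∀ F ∈ a.support, ∀ G ∈ b.support, IsCell (meetGrid F G)) :
    (BuildingHom.ofOrderIso e).mapChain (tens a b) =
      tens (a.mapDomain (mapFlag e)) (b.mapDomain (mapFlag e)) := by
  rw [tens_mapDomain, tens_apply]
  simp only [map_sum]
  refine Finset.sum_congr rfl fun F hF => Finset.sum_congr rfl fun G hG => ?_
  rw [map_smul, BuildingHom.mapChain_gen _ (hcell F hF G hG).isLattice]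
  congr 2
  ext x
  exact e.map_inf _ _

lemma range_eq_range_iff {f g : Fin (p + 1) → L} (hf : StrictMono f) (hg : StrictMono g) :
    Set.range f = Set.range g ↔ f = g :=
  ⟨fun h => (hf.range_inj hg).1 h, fun h => h ▸ rfl⟩

/-- Both flags end in `⊤`, so the flags of the cell `meetGrid F G` are `F` and `G` themselves, and
terms with `F ≠ G` pair to zero. Being a sum of squares, the value is positive for `a ≠ 0`, which
yields a cycle with non-zero augmentation. -/
lemma chainPairing_tens_self {d : ℕ} {a : (Fin (d + 1) →o L) →₀ ℤ}
    (hcell : ∀ F ∈ a.support, ∀ G ∈ a.support, IsCell (meetGrid F G)) :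
    chainPairing L (tens a a) = ∑ F ∈ a.support, a F * a F := by
  rw [tens_apply]
  simp only [map_sum]
  refine Finset.sum_congr rfl fun F hF => ?_
  have hF0 : ∀ F ∈ a.support, ∀ i, flagLeft (meetGrid F F) i = F i := by
    intro F hF i
    have h := (hcell F hF F hF).isFull.last
    rw [meetGrid_apply, inf_idem] at h
    rw [flagLeft, meetGrid_apply, h, inf_top_eq]
  rw [Finset.sum_eq_single F]
  · rw [map_smul, gen_of_isCell (hcell F hF F hF), chainPairing,
      Finsupp.linearCombination_single, if_pos, one_smul, smul_eq_mul, mul_one]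
    congr 1
    ext i
    exact inf_comm _ _
  · intro G hG hne
    rw [map_smul, gen_of_isCell (hcell F hF G hG), chainPairing,
      Finsupp.linearCombination_single, if_neg, smul_zero, smul_zero]
    intro h
    rw [range_eq_range_iff (hcell F hF G hG).strictMono_flagLeft
      (hcell F hF G hG).strictMono_flagRight] at h
    have hl := (hcell F hF G hG).isFull.last
    rw [meetGrid_apply, inf_eq_top_iff] at hl
    refine hne (OrderHom.ext _ _ (funext fun i => ?_))
    have := congrFun h i
    rw [flagLeft, flagRight, meetGrid_apply, meetGrid_apply, hl.1, hl.2, inf_top_eq,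
      top_inf_eq] at this
    exact this.symm
  · exact fun h => absurd hF h

lemma chainPairing_tens_self_pos {d : ℕ} {a : (Fin (d + 1) →o L) →₀ ℤ}
    (hcell : ∀ F ∈ a.support, ∀ G ∈ a.support, IsCell (meetGrid F G)) (ha : a ≠ 0) :
    0 < chainPairing L (tens a a) := by
  rw [chainPairing_tens_self hcell]
  exact Finset.sum_pos (fun F hF => mul_self_pos.2 (Finsupp.mem_support_iff.1 hF))
    (Finsupp.support_nonempty_iff.2 ha)

end Products

/-- Injectivity of `f` is known only for comparable summands. In a cell the join of an entry of the
first flag and one of the second is again a summand, so two entries with the same image are both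
equal to their join. -/
lemma BuildingHom.chainPairing_mapChain {L L' : Type*} [Lattice L] [BoundedOrder L] [Lattice L']
    [BoundedOrder L'] [IsModularLattice L] [IsModularLattice L'] (f : BuildingHom L L')
    (x : Chain L) : chainPairing L' (f.mapChain x) = chainPairing L x := by
  induction x using Finsupp.induction_linear with
  | zero => simp
  | add x y hx hy => simp only [map_add, hx, hy]
  | single c n =>
    rw [f.mapChain_single, chainPairing, chainPairing, Finsupp.linearCombination_single,
      Finsupp.linearCombination_single]
    congr 1
    have key : ∀ a b, f.toFun (flagLeft c.grid a) = f.toFun (flagRight c.grid b) ↔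
        flagLeft c.grid a = flagRight c.grid b := by
      refine fun a b => ⟨fun h => ?_, fun h => h ▸ rfl⟩
      have hs : IsComplemented (flagLeft c.grid a ⊔ flagRight c.grid b) :=
        c.isCell.isLattice.sup_isComplemented _ _ _ _ (Fin.le_last _) (Fin.le_last _)
      have h1 := f.injOn (c.isCell.isLattice.isComplemented _) hs le_sup_left
        (by rw [f.map_sup, ← h]; exact (sup_idem _).symm)
      have h2 := f.injOn (c.isCell.isLattice.isComplemented _) hs le_sup_right
        (by rw [f.map_sup, h]; exact (sup_idem _).symm)
      exact h1.trans h2.symm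
    refine if_congr ?_ rfl rfl
    simp only [Set.ext_iff, Set.mem_range]
    constructor
    · intro h y
      constructor
      · rintro ⟨a, rfl⟩
        obtain ⟨b, hb⟩ := (h _).1 ⟨a, rfl⟩
        exact ⟨b, ((key _ _).1 hb.symm).symm⟩
      · rintro ⟨b, rfl⟩
        obtain ⟨a, ha⟩ := (h _).2 ⟨b, rfl⟩
        exact ⟨a, (key _ _).1 ha⟩
    · intro h y
      constructor
      · rintro ⟨a, rfl⟩
        obtain ⟨b, hb⟩ := (h _).1 ⟨a, rfl⟩
        exact ⟨b, congrArg f.toFun hb⟩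
      · rintro ⟨b, rfl⟩
        obtain ⟨a, ha⟩ := (h _).2 ⟨b, rfl⟩
        exact ⟨a, congrArg f.toFun ha⟩

/-! ### Classes of cycles in the coinvariants, and the criterion for bijectivity. -/

section Coinvariants

variable (A : Type*) [CommRing A] (M : Type*) [AddCommGroup M] [Module A M] (d : ℕ)

/-- The class of a cycle in the coinvariants of `St²(M)`. -/
def cls : cycles (Submodule A M) (2 * d) →ₗ[ℤ] (rho A M d).Coinvariants :=
  Representation.Coinvariants.mk _ ∘ₗ Submodule.mkQ _

lemma cls_surjective : Function.Surjective (cls A M d) :=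
  (Representation.Coinvariants.mk_surjective _).comp (Submodule.mkQ_surjective _)

variable {A M d} in
lemma cls_mapChain (g : M ≃ₗ[A] M) (x : cycles (Submodule A M) (2 * d)) :
    cls A M d ⟨(autHom g).mapChain x, (autHom g).mapChain_mem_cycles x.2⟩ = cls A M d x :=
  Representation.Coinvariants.mk_self_apply (rho A M d) g (Submodule.Quotient.mk x)

variable [ConnectedSpace (PrimeSpectrum A)] [Module.Finite A M] [Module.Projective A M]

/-- The augmentation becomes a count made over `A` itself, in which the chosen maximal ideal no
longer appears. -/
lemma augmentation_cls (hM : ∀ p : PrimeSpectrum A, Module.rankAtStalk M p = d)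
    (m : Ideal A) [m.IsMaximal] (x : cycles (Submodule A M) (2 * d)) :
    augmentation A M d hM m (cls A M d x) = chainPairing _ (x : Chain (Submodule A M)) := by
  let : Field (A ⧸ m) := Ideal.Quotient.field m
  exact (reduction A M (A ⧸ m)).chainPairing_mapChain x

/-- The augmentation is bijective if the coinvariants are generated by one element `t`, with the
pairing as coefficient, and the pairing does not vanish. -/
lemma bijective_augmentation (hM : ∀ p : PrimeSpectrum A, Module.rankAtStalk M p = d)
    (m : Ideal A) [m.IsMaximal] (t : (rho A M d).Coinvariants)
    (ht : ∀ x : cycles (Submodule A M) (2 * d),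
      cls A M d x = chainPairing _ (x : Chain (Submodule A M)) • t)
    (x₀ : cycles (Submodule A M) (2 * d))
    (hx₀ : chainPairing _ (x₀ : Chain (Submodule A M)) ≠ 0) :
    Function.Bijective (augmentation A M d hM m) := by
  -- The hypothesis at `x₀` says that the pairing of `x₀` is unchanged when multiplied by the
  -- augmentation of `t`. Being a non-zero integer, it can be cancelled, so no cycle of pairing one
  -- has to be exhibited.
  have h1 : augmentation A M d hM m t = 1 := by
    have h := augmentation_cls A M d hM m x₀
    rw [ht, map_smul, smul_eq_mul] at h
    exact (mul_eq_left₀ hx₀).1 h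
  refine ⟨(injective_iff_map_eq_zero _).2 fun y hy => ?_, fun n => ⟨n • t, ?_⟩⟩
  · obtain ⟨x, rfl⟩ := cls_surjective A M d y
    rw [augmentation_cls] at hy
    rw [ht, hy, zero_smul]
  · rw [map_smul, h1, smul_eq_mul, mul_one]

end Coinvariants

/-! ### The pairing on chains of top degree. -/

section Pairing

variable {L : Type*} [Lattice L] [BoundedOrder L] {rk : L → ℕ} {d : ℕ}

lemma Cell.range_eq_iff {c : Cell L} (h : c.p = c.q) :
    Set.range (flagLeft c.grid) = Set.range (flagRight c.grid) ↔ c.left = c.right := by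
  obtain ⟨p, q, φ, hφ⟩ := c
  obtain rfl : p = q := h
  rw [range_eq_range_iff hφ.strictMono_flagLeft hφ.strictMono_flagRight]
  constructor
  · exact fun h => funext fun n => congrFun h _
  · intro h
    funext i
    have h1 := congrFun h i
    have h2 : (⟨min (i : ℕ) p, by omega⟩ : Fin (p + 1)) = i := by
      apply Fin.ext
      simp only
      omega
    simp only [Cell.left, Cell.right, h2] at h1
    exact h1

open Classical in
lemma IsRanked.chainPairing_eq (hr : IsRanked rk d) {x : Chain L} (hx : x ∈ chains L (2 * d)) :
    chainPairing L x = x.sum fun c n => n • (if c.left = c.right then 1 else 0 : ℤ) := by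
  rw [chainPairing, Finsupp.linearCombination_apply]
  refine Finset.sum_congr rfl fun c hc => ?_
  simp only [Cell.range_eq_iff ((hr.p_eq_of_mem hx hc).trans (hr.q_eq_of_mem hx hc).symm)]

end Pairing

/-! ### When two flags in good position form a cell. -/

section Construction

variable {L : Type*} [Lattice L] [BoundedOrder L] {p q : ℕ}

/-- The pullback condition is formal for a grid of intersections. The join in the remaining
condition is itself an entry of the grid unless both lower indices are non-zero and both steps are
strict. -/
lemma isCell_meetGrid {F : Fin (p + 1) →o L} {G : Fin (q + 1) →o L} (hF : StrictMono F)
    (hG : StrictMono G) (hF0 : F 0 = ⊥) (hG0 : G 0 = ⊥) (hF1 : F (Fin.last _) = ⊤)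
    (hG1 : G (Fin.last _) = ⊤) (hi : ∀ a b, IsComplemented (F a ⊓ G b))
    (hs : ∀ a a' b b', a ≠ 0 → b ≠ 0 → a < a' → b < b' →
      IsComplemented (F a ⊓ G b' ⊔ F a' ⊓ G b)) : IsCell (meetGrid F G) where
  isLattice := by
    refine ⟨fun x => hi _ _, fun a a' b b' ha hb => ?_, fun a a' b b' ha hb => ?_⟩
    · simp only [meetGrid_apply]
      rw [inf_inf_inf_comm, inf_eq_left.2 (F.monotone ha), inf_comm (G b'),
        inf_eq_left.2 (G.monotone hb)]
    · simp only [meetGrid_apply]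
      rcases eq_or_ne a 0 with rfl | ha0
      · rw [hF0, bot_inf_eq, bot_sup_eq]
        exact hi _ _
      rcases eq_or_ne b 0 with rfl | hb0
      · rw [hG0, inf_bot_eq, sup_bot_eq]
        exact hi _ _
      rcases ha.eq_or_lt with rfl | ha
      · rw [sup_eq_left.2 (inf_le_inf_left _ (G.monotone hb))]
        exact hi _ _
      rcases hb.eq_or_lt with rfl | hb
      · rw [sup_eq_right.2 (inf_le_inf_right _ (F.monotone ha.le))]
        exact hi _ _
      exact hs a a' b b' ha0 hb0 ha hb
  isFull := by
    refine ⟨fun b => ?_, fun a => ?_, ?_⟩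
    · rw [meetGrid_apply, hF0, bot_inf_eq]
    · rw [meetGrid_apply, hG0, inf_bot_eq]
    · rw [meetGrid_apply, hF1, hG1, inf_top_eq]
  isNondegenerate := by
    refine ⟨fun i => ⟨Fin.last _, ?_⟩, fun i => ⟨Fin.last _, ?_⟩⟩
    · rw [meetGrid_apply, meetGrid_apply, hG1, inf_top_eq, inf_top_eq]
      exact (hF Fin.castSucc_lt_succ).ne
    · rw [meetGrid_apply, meetGrid_apply, hF1, top_inf_eq, top_inf_eq]
      exact (hG Fin.castSucc_lt_succ).ne

/-- The flag `0 ≤ a ≤ 1`. -/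
def midFlag (a : L) : Fin 3 →o L :=
  ⟨![⊥, a, ⊤], Fin.monotone_iff_le_succ.2 fun i => by fin_cases i <;> simp⟩

/-- The flag `0 ≤ p ≤ p ⊔ q ≤ 1`. -/
def lineFlag (p q : L) : Fin 4 →o L :=
  ⟨![⊥, p, p ⊔ q, ⊤], Fin.monotone_iff_le_succ.2 fun i => by fin_cases i <;> simp⟩

lemma flagFace_one_lineFlag (p q : L) : flagFace 1 (lineFlag p q) = midFlag (p ⊔ q) := by
  ext i
  fin_cases i <;> rfl

lemma flagFace_two_lineFlag (p q : L) : flagFace 2 (lineFlag p q) = midFlag p := by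
  ext i
  fin_cases i <;> rfl

lemma mapFlag_midFlag (e : L ≃o L) (a : L) : mapFlag e (midFlag a) = midFlag (e a) := by
  ext i
  fin_cases i
  · exact e.map_bot
  · rfl
  · exact e.map_top

lemma mapFlag_lineFlag (e : L ≃o L) (p q : L) :
    mapFlag e (lineFlag p q) = lineFlag (e p) (e q) := by
  ext i
  fin_cases i
  · exact e.map_bot
  · rfl
  · exact e.map_sup p q
  · exact e.map_top

lemma isCell_midFlag {a b : L} (ha : IsComplemented a) (hb : IsComplemented b) (ha0 : a ≠ ⊥)
    (ha1 : a ≠ ⊤) (hb0 : b ≠ ⊥) (hb1 : b ≠ ⊤) (h : a = b ∨ IsCompl a b) :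
    IsCell (meetGrid (midFlag a) (midFlag b)) := by
  have hm : ∀ {a : L}, a ≠ ⊥ → a ≠ ⊤ → StrictMono (midFlag a) := fun h0 h1 =>
    Fin.strictMono_iff_lt_succ.2 fun i => by
      fin_cases i
      · exact bot_lt_iff_ne_bot.2 h0
      · exact lt_top_iff_ne_top.2 h1
  refine isCell_meetGrid (hm ha0 ha1) (hm hb0 hb1) rfl rfl rfl rfl ?_ ?_
  · have hab : IsComplemented (a ⊓ b) := by
      rcases h with rfl | h
      · rwa [inf_idem]
      · rw [h.inf_eq_bot]
        exact isComplemented_bot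
    intro i j
    fin_cases i <;> fin_cases j <;>
      simp [midFlag, isComplemented_bot, isComplemented_top, ha, hb, hab]
  · intro i i' j j' hi hj hii hjj
    have e : ∀ i i' : Fin 3, i ≠ 0 → i < i' → i = 1 ∧ i' = 2 := by decide
    obtain ⟨rfl, rfl⟩ := e i i' hi hii
    obtain ⟨rfl, rfl⟩ := e j j' hj hjj
    change IsComplemented (a ⊓ ⊤ ⊔ ⊤ ⊓ b)
    rw [inf_top_eq, top_inf_eq]
    rcases h with rfl | h
    · rwa [sup_idem]
    · rw [h.sup_eq_top]
      exact isComplemented_top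

/-- A complete flag `0 < p < l < 1` of complemented elements. -/
structure IsPointLine (p l : L) : Prop where
  point : IsComplemented p
  line : IsComplemented l
  bot_lt : ⊥ < p
  lt : p < l
  lt_top : l < ⊤

/-- The complete flags `(p, l)` and `(p', l')` are in good relative position. -/
structure IsGoodPair (p l p' l' : L) : Prop where
  left : IsPointLine p l
  right : IsPointLine p' l'
  points : p = p' ∨ (Disjoint p p' ∧ IsComplemented (p ⊔ p'))
  point_line : p ≤ l' ∨ IsCompl p l'
  line_point : p' ≤ l ∨ IsCompl p' l
  lines : l = l' ∨ (l ⊔ l' = ⊤ ∧ IsComplemented (l ⊓ l'))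

lemma IsPointLine.strictMono {p q : L} (h : IsPointLine p (p ⊔ q)) :
    StrictMono (lineFlag p q) :=
  Fin.strictMono_iff_lt_succ.2 fun i => by
    fin_cases i
    · exact h.bot_lt
    · exact h.lt
    · exact h.lt_top

/-- Every intersection and join that has to be a summand is reduced to an entry of one of the flags,
to `⊥` or `⊤`, or to one of the summands in `IsGoodPair`. -/
lemma isCell_lineFlag [IsModularLattice L] {p q p' q' : L}
    (h : IsGoodPair p (p ⊔ q) p' (p' ⊔ q')) :
    IsCell (meetGrid (lineFlag p q) (lineFlag p' q')) := by
  refine isCell_meetGrid h.left.strictMono h.right.strictMono rfl rfl rfl rfl ?_ ?_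
  all_goals
    have e : ∀ p q : L, lineFlag p q 0 = ⊥ ∧ lineFlag p q 1 = p ∧ lineFlag p q 2 = p ⊔ q ∧
      lineFlag p q 3 = ⊤ := fun _ _ => ⟨rfl, rfl, rfl, rfl⟩
    obtain ⟨e0, e1, e2, e3⟩ := e p q
    obtain ⟨f0, f1, f2, f3⟩ := e p' q'
    generalize lineFlag p q = F at *
    generalize lineFlag p' q' = G at *
    generalize p ⊔ q = l at *
    generalize p' ⊔ q' = l' at *
    have hpl' : p ⊓ l' = p ∨ p ⊓ l' = ⊥ := h.point_line.imp inf_eq_left.2 (·.inf_eq_bot)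
    have hlp' : l ⊓ p' = p' ∨ l ⊓ p' = ⊥ :=
      h.line_point.imp inf_eq_right.2 fun h => h.symm.inf_eq_bot
    have hp := h.left.point
    have hl := h.left.line
    have hp' := h.right.point
    have hl' := h.right.line
    have hle := h.left.lt.le
    have hle' := h.right.lt.le
  · have h1 : IsComplemented (p ⊓ p') := by
      rcases h.points with rfl | h
      · rwa [inf_idem]
      · rw [h.1.eq_bot]
        exact isComplemented_bot
    have h2 : IsComplemented (p ⊓ l') := by
      rcases hpl' with h | h <;> rw [h]
      exacts [hp, isComplemented_bot]
    have h3 : IsComplemented (l ⊓ p') := by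
      rcases hlp' with h | h <;> rw [h]
      exacts [hp', isComplemented_bot]
    have h4 : IsComplemented (l ⊓ l') := by
      rcases h.lines with rfl | h
      · rwa [inf_idem]
      · exact h.2
    have e' : ∀ i : Fin 4, i = 0 ∨ i = 1 ∨ i = 2 ∨ i = 3 := by decide
    intro i j
    rcases e' i with rfl | rfl | rfl | rfl <;> rcases e' j with rfl | rfl | rfl | rfl <;>
      simp only [e0, e1, e2, e3, f0, f1, f2, f3, bot_inf_eq, inf_bot_eq, top_inf_eq,
        inf_top_eq] <;> first | assumption | exact isComplemented_bot | exact isComplemented_top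
  · have h1 : IsComplemented (p ⊔ p') := by
      rcases h.points with rfl | h
      · rwa [sup_idem]
      · exact h.2
    have h2 : IsComplemented (p ⊔ l') := by
      rcases h.point_line with h | h
      · rwa [sup_eq_right.2 h]
      · rw [h.sup_eq_top]
        exact isComplemented_top
    have h3 : IsComplemented (l ⊔ p') := by
      rcases h.line_point with h | h
      · rwa [sup_eq_left.2 h]
      · rw [h.symm.sup_eq_top]
        exact isComplemented_top
    have h4 : IsComplemented (l ⊔ l') := by
      rcases h.lines with rfl | h
      · rwa [sup_idem]
      · rw [h.1]
        exact isComplemented_top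
    have h5 : IsComplemented (p ⊓ l' ⊔ p') := by
      rcases hpl' with h | h <;> rw [h]
      exacts [h1, by rwa [bot_sup_eq]]
    have h6 : IsComplemented (p ⊔ l ⊓ p') := by
      rcases hlp' with h | h <;> rw [h]
      exacts [h1, by rwa [sup_bot_eq]]
    have h7 : IsComplemented (p ⊓ l' ⊔ l ⊓ p') := by
      rcases hpl' with h | h <;> rw [h]
      · exact h6
      · rw [bot_sup_eq]
        rcases hlp' with h | h <;> rw [h]
        exacts [hp', isComplemented_bot]
    -- For distinct lines, either `p` lies on both and the join is `l ⊓ l'`, or `p` is complementary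
    -- to `l'` and the modular law gives `(p ⊔ l') ⊓ l = l`.
    have h8 : IsComplemented (p ⊔ l ⊓ l') := by
      rcases h.lines with rfl | hll
      · rwa [inf_idem, sup_eq_right.2 hle]
      · rcases h.point_line with h | h
        · rw [sup_eq_right.2 (le_inf hle h)]
          exact hll.2
        · rwa [inf_comm, ← sup_inf_assoc_of_le _ hle, h.sup_eq_top, top_inf_eq]
    have h9 : IsComplemented (l ⊓ l' ⊔ p') := by
      rcases h.lines with rfl | hll
      · rwa [inf_idem, sup_eq_left.2 hle']
      · rcases h.line_point with h | h
        · rw [sup_eq_left.2 (le_inf h hle')]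
          exact hll.2
        · rwa [sup_comm, ← sup_inf_assoc_of_le _ hle', h.sup_eq_top, top_inf_eq]
    intro i i' j j' hi hj hii hjj
    have e' : ∀ i i' : Fin 4, i ≠ 0 → i < i' →
      (i = 1 ∧ i' = 2) ∨ (i = 1 ∧ i' = 3) ∨ (i = 2 ∧ i' = 3) := by decide
    rcases e' i i' hi hii with ⟨rfl, rfl⟩ | ⟨rfl, rfl⟩ | ⟨rfl, rfl⟩ <;>
      rcases e' j j' hj hjj with ⟨rfl, rfl⟩ | ⟨rfl, rfl⟩ | ⟨rfl, rfl⟩ <;>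
      simp only [e1, e2, e3, f1, f2, f3, top_inf_eq, inf_top_eq] <;> assumption

end Construction

/-! ### Expansion of top-degree cycles into products of standard cycles. -/

section Expansion

variable {L : Type*} [Lattice L] [BoundedOrder L] {rk : L → ℕ} {d : ℕ}
  {Q : Type*} [AddCommGroup Q]

/-- The pullback condition for the square reaching to the last row and column recovers each entry
from the two flags. -/
lemma meetGrid_flags {p q : ℕ} {φ : Grid L p q} (h : IsCell φ) (F : Fin (p + 1) →o L)
    (G : Fin (q + 1) →o L) (hF : ∀ a, F a = φ (a, Fin.last _))
    (hG : ∀ b, G b = φ (Fin.last _, b)) : meetGrid F G = φ := by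
  ext ⟨a, b⟩
  rw [meetGrid_apply, hF, hG]
  exact h.isLattice.inf_eq _ _ _ _ (Fin.le_last _) (Fin.le_last _)

lemma Cell.single_eq_midFlag {c : Cell L} (hp : c.p = 2) (hq : c.q = 2) :
    Finsupp.single c 1 = gen (meetGrid (midFlag (c.left 1)) (midFlag (c.right 1))) := by
  have l0 := c.left_zero
  have r0 := c.right_zero
  have l2 := c.left_top hp.le
  have r2 := c.right_top hq.le
  obtain ⟨p, q, φ, hφ⟩ := c
  obtain rfl : p = 2 := hp
  obtain rfl : q = 2 := hq
  rw [meetGrid_flags hφ, gen_of_isCell hφ]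
  · intro a
    fin_cases a
    exacts [l0.symm, rfl, l2.symm]
  · intro a
    fin_cases a
    exacts [r0.symm, rfl, r2.symm]

lemma Cell.single_eq_lineFlag {c : Cell L} (hp : c.p = 3) (hq : c.q = 3) :
    Finsupp.single c 1 =
      gen (meetGrid (lineFlag (c.left 1) (c.left 2)) (lineFlag (c.right 1) (c.right 2))) := by
  have l0 := c.left_zero
  have r0 := c.right_zero
  have l3 := c.left_top hp.le
  have r3 := c.right_top hq.le
  have l12 := sup_eq_right.2 (c.left_lt (m := 1) (n := 2) (by omega) (by omega)).le
  have r12 := sup_eq_right.2 (c.right_lt (m := 1) (n := 2) (by omega) (by omega)).le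
  obtain ⟨p, q, φ, hφ⟩ := c
  obtain rfl : p = 3 := hp
  obtain rfl : q = 3 := hq
  rw [meetGrid_flags hφ, gen_of_isCell hφ]
  · intro a
    fin_cases a
    exacts [l0.symm, rfl, l12, l3.symm]
  · intro a
    fin_cases a
    exacts [r0.symm, rfl, r12, r3.symm]

lemma eq_sum_single (x : Chain L) : x = x.sum fun c n => n • Finsupp.single c 1 := by
  conv_lhs => rw [← Finsupp.sum_single x]
  simp

/-- The cycle of points `a - c` of a line. -/
def pointDiff (c a : L) : (Fin 3 →o L) →₀ ℤ :=
  Finsupp.single (midFlag a) 1 - Finsupp.single (midFlag c) 1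

/-- Expanding the product leaves, besides the cell itself, terms that do not depend on the first
point or do not depend on the second. These cancel in a cycle. No condition on `c` is needed for the
identity; position matters only for the single products to be cycles. -/
lemma eq_sum_pointDiff (hr : IsRanked rk 2) {x : Chain L} (hx : x ∈ cycles L 4) (c : L) :
    x = x.sum fun k n => n • tens (pointDiff c (k.left 1)) (pointDiff c (k.right 1)) := by
  have h1 := sum_left_eq_zero (d := 1) hr one_pos le_rfl (fun _ G =>
    tens (Finsupp.single (midFlag c) 1 : (Fin 3 →o L) →₀ ℤ)
      (Finsupp.single (midFlag (G 1)) 1 : (Fin 3 →o L) →₀ ℤ)) hx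
  have h2 := sum_right_eq_zero (d := 1) hr one_pos le_rfl (fun F _ =>
    tens (Finsupp.single (midFlag (F 1)) 1 : (Fin 3 →o L) →₀ ℤ)
      (Finsupp.single (midFlag c) 1 : (Fin 3 →o L) →₀ ℤ)) hx
  have h3 := sum_left_eq_zero (d := 1) hr one_pos le_rfl (fun _ _ =>
    tens (Finsupp.single (midFlag c) 1 : (Fin 3 →o L) →₀ ℤ)
      (Finsupp.single (midFlag c) 1 : (Fin 3 →o L) →₀ ℤ)) hx
  conv_lhs => rw [eq_sum_single x, ← sub_zero (x.sum _), ← h1, ← sub_zero (_ - _), ← h2,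
    ← add_zero (_ - _), ← h3]
  rw [← Finsupp.sum_sub, ← Finsupp.sum_sub, ← Finsupp.sum_add]
  refine Finset.sum_congr rfl fun k hk => ?_
  beta_reduce
  rw [Cell.single_eq_midFlag (hr.p_eq_of_mem hx.1 hk) (hr.q_eq_of_mem hx.1 hk)]
  simp only [pointDiff, map_sub, LinearMap.sub_apply, tens_single, smul_sub]
  abel

open Classical in
/-- Evaluation of a linear map on cycles of a building of rank two. -/
theorem map_eq_chainPairing_smul_of_rank_two (hr : IsRanked rk 2) {x : Chain L}
    (hx : x ∈ cycles L 4) (π : Chain L →ₗ[ℤ] Q) (s₁ s₂ : Q) (c : L)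
    (h₁ : ∀ k ∈ x.support, k.left 1 = k.right 1 →
      π (tens (pointDiff c (k.left 1)) (pointDiff c (k.right 1))) = s₁)
    (h₂ : ∀ k ∈ x.support, k.left 1 ≠ k.right 1 →
      π (tens (pointDiff c (k.left 1)) (pointDiff c (k.right 1))) = s₂) :
    π x = chainPairing L x • (s₁ - s₂) := by
  -- The coefficients of `x` sum to zero, so those of the cells with distinct points sum to minus
  -- the pairing.
  have h := sum_left_eq_zero (d := 1) hr one_pos le_rfl (fun _ _ => s₂) hx
  conv_lhs => rw [eq_sum_pointDiff hr hx c]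
  rw [hr.chainPairing_eq hx.1, Finsupp.sum, map_sum, Finsupp.sum, Finset.sum_smul, eq_comm,
    ← add_zero (∑ _ ∈ _, _), ← h, Finsupp.sum, ← Finset.sum_add_distrib]
  refine Finset.sum_congr rfl fun k hk => ?_
  have hp := hr.p_eq_of_mem hx.1 hk
  have hq := hr.q_eq_of_mem hx.1 hk
  have e : k.left = k.right ↔ k.left 1 = k.right 1 := by
    refine ⟨fun h => congrFun h 1, fun h => funext fun n => ?_⟩
    match n with
    | 0 => rw [k.left_zero, k.right_zero]
    | 1 => exact h
    | n + 2 => rw [k.left_top (by omega), k.right_top (by omega)]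
  rw [map_smul, e]
  split_ifs with h
  · rw [h₁ k hk h, smul_assoc, one_smul, smul_sub, sub_add_cancel]
  · rw [h₂ k hk h]
    simp

/-- The boundary of the triangle with vertices `c`, `p`, `q`. -/
def triangle (c p q : L) : (Fin 4 →o L) →₀ ℤ :=
  Finsupp.single (lineFlag p q) 1 - Finsupp.single (lineFlag p c) 1
    + Finsupp.single (lineFlag c p) 1 - (Finsupp.single (lineFlag q p) 1
    - Finsupp.single (lineFlag q c) 1 + Finsupp.single (lineFlag c q) 1)

/-- The path from the line `l` through the point `p` to the point `c`. -/
def pathTo (c p l : L) : (Fin 4 →o L) →₀ ℤ :=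
  Finsupp.single (lineFlag p l) 1 - Finsupp.single (lineFlag p c) 1
    + Finsupp.single (lineFlag c p) 1

lemma lineFlag_sup (p q : L) : lineFlag p (p ⊔ q) = lineFlag p q := by
  rw [lineFlag, lineFlag]
  simp

lemma triangle_eq {c p q l : L} (h : p ⊔ q = l) : triangle c p q = pathTo c p l - pathTo c q l := by
  subst h
  rw [triangle, pathTo, pathTo, lineFlag_sup, sup_comm p q, lineFlag_sup]

/-- Beyond the flag `(p, l)` itself, the path to `c` depends on `p` only. Its contribution cancels
when the sum is taken over the lines through `p`. -/
lemma eq_sum_pathTo (hr : IsRanked rk 3) {x : Chain L} (hx : x ∈ cycles L 6) (c : L) :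
    x = x.sum fun k n => n • tens (pathTo c (k.left 1) (k.left 2))
      (pathTo c (k.right 1) (k.right 2)) := by
  let η (p : L) : (Fin 4 →o L) →₀ ℤ :=
    Finsupp.single (lineFlag c p) 1 - Finsupp.single (lineFlag p c) 1
  have h1 := sum_left_eq_zero (d := 2) hr two_pos le_rfl (fun F G =>
    tens (η (F 1)) (pathTo c (G 1) (G 2))) hx
  have h2 := sum_right_eq_zero (d := 2) hr two_pos le_rfl (fun F G =>
    tens (Finsupp.single (lineFlag (F 1) (F 2)) 1 : (Fin 4 →o L) →₀ ℤ) (η (G 1))) hx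
  conv_lhs => rw [eq_sum_single x, ← add_zero (x.sum _), ← h1, ← add_zero (_ + _), ← h2]
  rw [← Finsupp.sum_add, ← Finsupp.sum_add]
  refine Finset.sum_congr rfl fun k hk => ?_
  beta_reduce
  rw [Cell.single_eq_lineFlag (hr.p_eq_of_mem hx.1 hk) (hr.q_eq_of_mem hx.1 hk), ← tens_single]
  have e : ∀ p l, pathTo c p l = Finsupp.single (lineFlag p l) 1 + η p := by
    intro p l
    simp only [pathTo, η]
    abel
  simp only [show skip 2 1 = 1 from rfl, e (k.left 1) (k.left 2), e (k.right 1) (k.right 2),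
    map_add, LinearMap.add_apply, smul_add]
  abel

/-- The auxiliary point `q` may depend on both lines but not on the points, so each correction term
is constant in one of the points and cancels when the sum is taken over it. -/
lemma eq_sum_triangle (hr : IsRanked rk 3) {x : Chain L} (hx : x ∈ cycles L 6) (c : L)
    (q : L → L → L) :
    x = x.sum fun k n => n • tens
      (pathTo c (k.left 1) (k.left 2) - pathTo c (q (k.left 2) (k.right 2)) (k.left 2))
      (pathTo c (k.right 1) (k.right 2) - pathTo c (q (k.left 2) (k.right 2)) (k.right 2)) := by
  have h1 := sum_left_eq_zero (d := 2) hr one_pos one_le_two (fun F G =>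
    tens (pathTo c (q (F 1) (G 2)) (F 1)) (pathTo c (G 1) (G 2))) hx
  have h2 := sum_right_eq_zero (d := 2) hr one_pos one_le_two (fun F G =>
    tens (pathTo c (F 1) (F 2)) (pathTo c (q (F 2) (G 1)) (G 1))) hx
  have h3 := sum_left_eq_zero (d := 2) hr one_pos one_le_two (fun F G =>
    tens (pathTo c (q (F 1) (G 2)) (F 1)) (pathTo c (q (F 1) (G 2)) (G 2))) hx
  conv_lhs => rw [eq_sum_pathTo hr hx c, ← sub_zero (x.sum _), ← h1, ← sub_zero (_ - _), ← h2,
    ← add_zero (_ - _), ← h3]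
  rw [← Finsupp.sum_sub, ← Finsupp.sum_sub, ← Finsupp.sum_add]
  refine Finset.sum_congr rfl fun k hk => ?_
  simp only [show skip 1 1 = 2 from rfl, map_sub, LinearMap.sub_apply, smul_sub]
  abel

/-- In a building of rank three, the classes of cycles are determined by those of the products of
triangles in special position. -/
theorem map_eq_chainPairing_smul_of_rank_three (hr : IsRanked rk 3) {x : Chain L}
    (hx : x ∈ cycles L 6) (π : Chain L →ₗ[ℤ] Q) (s₁ s₂ s₃ : Q) (c : L) (q : L → L)
    (hq : ∀ k ∈ x.support, k.left 2 = k.right 2 →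
      k.left 1 ⊔ q (k.left 2) = k.left 2 ∧ k.right 1 ⊔ q (k.left 2) = k.left 2)
    (h₁ : ∀ k ∈ x.support, k.left 2 = k.right 2 → k.left 1 = k.right 1 →
      π (tens (triangle c (k.left 1) (q (k.left 2))) (triangle c (k.left 1) (q (k.left 2)))) = s₁)
    (h₂ : ∀ k ∈ x.support, k.left 2 = k.right 2 → k.left 1 ≠ k.right 1 →
      π (tens (triangle c (k.left 1) (q (k.left 2))) (triangle c (k.right 1) (q (k.left 2)))) = s₂)
    (h₃ : ∀ k ∈ x.support, k.left 2 ≠ k.right 2 → ¬ k.left 1 ≤ k.right 2 → ¬ k.right 1 ≤ k.left 2 →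
      k.left 1 ⊔ k.left 2 ⊓ k.right 2 = k.left 2 ∧ k.right 1 ⊔ k.left 2 ⊓ k.right 2 = k.right 2 ∧
      π (tens (triangle c (k.left 1) (k.left 2 ⊓ k.right 2))
        (triangle c (k.right 1) (k.left 2 ⊓ k.right 2))) = s₃)
    (h₄ : ∀ k ∈ x.support, k.left 2 ≠ k.right 2 → k.left 1 ≤ k.right 2 →
      k.left 1 = k.left 2 ⊓ k.right 2)
    (h₅ : ∀ k ∈ x.support, k.left 2 ≠ k.right 2 → k.right 1 ≤ k.left 2 →
      k.right 1 = k.left 2 ⊓ k.right 2) :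
    π x = chainPairing L x • (s₁ - s₂ - s₃) := by
  classical
  -- For flags `(p, l)` and `(p', l')`, the coefficients of the cells with `l = l'` sum to zero,
  -- since `p` is free. So do those with `p = p'` and those with `p` off `l'`, since `l` is free,
  -- and those with `l ≠ l'` and `p'` on `l`, since `p` is free. For `l ≠ l'` the conditions "`p` on
  -- `l'`" and "`p'` on `l`" together mean `p = p'`. Inclusion-exclusion then gives minus the
  -- pairing both for the cells with `l = l'`, `p ≠ p'` and for those with neither point on the
  -- other line.
  have e1 := sum_left_eq_zero (d := 2) hr one_pos one_le_two
    (fun F G => if F 1 = G 2 then s₂ else 0) hx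
  have e2 := sum_left_eq_zero (d := 2) hr two_pos le_rfl
    (fun F G => (if F 1 = G 1 then s₃ else 0) + if F 1 ≤ G 2 then 0 else s₃) hx
  have e3 := sum_left_eq_zero (d := 2) hr one_pos one_le_two
    (fun F G => if F 1 ≠ G 2 ∧ G 1 ≤ F 1 then s₃ else 0) hx
  have e4 := congrArg₂ (· - ·) (congrArg₂ (· + ·) e1 e2) e3
  simp only [show skip 1 1 = 2 from rfl, show skip 2 1 = 1 from rfl, add_zero, sub_zero] at e4
  -- The third vertex has to lie on both lines: it is their intersection if they differ and a chosen
  -- point if they coincide.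
  conv_lhs => rw [eq_sum_triangle hr hx c fun l l' => if l = l' then q l else l ⊓ l']
  rw [hr.chainPairing_eq hx.1, Finsupp.sum, map_sum, Finsupp.sum, Finset.sum_smul, eq_comm,
    ← add_zero (∑ _ ∈ _, _), ← e4]
  simp only [Finsupp.sum]
  rw [← Finset.sum_add_distrib, ← Finset.sum_sub_distrib, ← Finset.sum_add_distrib]
  refine Finset.sum_congr rfl fun k hk => ?_
  have hp3 := hr.p_eq_of_mem hx.1 hk
  have hq3 := hr.q_eq_of_mem hx.1 hk
  have hpl := (k.left_lt (m := 1) (n := 2) (by omega) (by omega)).le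
  have hpl' := (k.right_lt (m := 1) (n := 2) (by omega) (by omega)).le
  have e : k.left = k.right ↔ k.left 1 = k.right 1 ∧ k.left 2 = k.right 2 := by
    refine ⟨fun h => ⟨congrFun h 1, congrFun h 2⟩, fun h => funext fun n => ?_⟩
    match n with
    | 0 => rw [k.left_zero, k.right_zero]
    | 1 => exact h.1
    | 2 => exact h.2
    | n + 3 => rw [k.left_top (by omega), k.right_top (by omega)]
  replace hq := hq k hk
  replace h₁ := h₁ k hk
  replace h₂ := h₂ k hk
  replace h₃ := h₃ k hk
  replace h₄ := h₄ k hk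
  replace h₅ := h₅ k hk
  rw [map_smul, e, smul_assoc, ← smul_add, ← smul_sub, ← smul_add]
  congr 1
  generalize k.left 1 = p at *
  generalize k.left 2 = l at *
  generalize k.right 1 = p' at *
  generalize k.right 2 = l' at *
  by_cases hll : l = l'
  · subst hll
    obtain ⟨hq1, hq2⟩ := hq rfl
    simp only [if_true]
    rw [← triangle_eq hq1, ← triangle_eq hq2]
    by_cases hpp : p = p'
    · subst hpp
      rw [h₁ rfl rfl]
      simp [hpl]
    · rw [h₂ rfl hpp]
      simp [hpl, hpp]
  · simp only [if_neg hll]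
    by_cases h1 : p ≤ l'
    · rw [← h₄ hll h1, sub_self, map_zero, LinearMap.zero_apply, map_zero]
      by_cases hpp : p = p'
      · subst hpp
        simp [hll, h1, hpl]
      · have : ¬ p' ≤ l := fun h => hpp ((h₄ hll h1).trans (h₅ hll h).symm)
        simp [hll, h1, hpp, this]
    · have hpp : p ≠ p' := fun h => h1 (h ▸ hpl')
      by_cases h2 : p' ≤ l
      · rw [← h₅ hll h2, sub_self (pathTo c p' l'), map_zero, map_zero]
        simp [hll, h1, hpp, h2]
      · obtain ⟨u1, u2, u3⟩ := h₃ hll h1 h2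
        rw [← triangle_eq u1, ← triangle_eq u2, u3]
        simp [hll, h1, hpp, h2]

end Expansion

/-! ### Configurations of points in good relative position. -/

section Configurations

variable {L : Type*} [Lattice L] [BoundedOrder L]

lemma mapDomain_flagFace_pointDiff (c a : L) {i : Fin 3} (h0 : i ≠ 0) (hl : i ≠ Fin.last _) :
    (pointDiff c a).mapDomain (flagFace i) = 0 := by
  have hi : ∀ i : Fin 3, i ≠ 0 → i ≠ Fin.last _ → i = 1 := by decide
  obtain rfl := hi i h0 hl
  have h : flagFace 1 (midFlag a) = flagFace 1 (midFlag c) := by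
    ext j
    fin_cases j <;> rfl
  rw [pointDiff, Finsupp.mapDomain_sub, Finsupp.mapDomain_single, Finsupp.mapDomain_single, h,
    sub_self]

lemma mapDomain_flagFace_triangle (c p q : L) {i : Fin 4} (h0 : i ≠ 0) (hl : i ≠ Fin.last _) :
    (triangle c p q).mapDomain (flagFace i) = 0 := by
  have hi : ∀ i : Fin 4, i ≠ 0 → i ≠ Fin.last _ → i = 1 ∨ i = 2 := by decide
  rcases hi i h0 hl with rfl | rfl
  · simp only [triangle, Finsupp.mapDomain_sub, Finsupp.mapDomain_add, Finsupp.mapDomain_single,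
      flagFace_one_lineFlag, sup_comm q p, sup_comm p c, sup_comm q c]
    abel
  · simp only [triangle, Finsupp.mapDomain_sub, Finsupp.mapDomain_add, Finsupp.mapDomain_single,
      flagFace_two_lineFlag]
    abel

lemma mapDomain_mapFlag_pointDiff (e : L ≃o L) (c a : L) :
    (pointDiff c a).mapDomain (mapFlag e) = pointDiff (e c) (e a) := by
  simp only [pointDiff, Finsupp.mapDomain_sub, Finsupp.mapDomain_single, mapFlag_midFlag]

lemma mapDomain_mapFlag_triangle (e : L ≃o L) (c p q : L) :
    (triangle c p q).mapDomain (mapFlag e) = triangle (e c) (e p) (e q) := by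
  simp only [triangle, Finsupp.mapDomain_sub, Finsupp.mapDomain_add, Finsupp.mapDomain_single,
    mapFlag_lineFlag]

lemma eq_or_eq_of_mem_support_pointDiff {c a : L} {F : Fin 3 →o L}
    (h : F ∈ (pointDiff c a).support) : F = midFlag a ∨ F = midFlag c := by
  by_contra hF
  rw [not_or] at hF
  exact Finsupp.mem_support_iff.1 h (by simp [pointDiff, hF.1, hF.2])

lemma exists_eq_of_mem_support_triangle {ι : Type*} {z : ι → L} {x : Fin 3 → ι}
    (hx : Function.Injective x) {F : Fin 4 →o L}
    (h : F ∈ (triangle (z (x 0)) (z (x 1)) (z (x 2))).support) :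
    ∃ i j, i ≠ j ∧ F = lineFlag (z i) (z j) := by
  by_contra! hF
  have hne : ∀ {i j : Fin 3}, i ≠ j → F ≠ lineFlag (z (x i)) (z (x j)) := fun h =>
    hF _ _ (hx.ne h)
  refine Finsupp.mem_support_iff.1 h ?_
  simp [triangle, hne (show (0 : Fin 3) ≠ 1 by decide), hne (show (0 : Fin 3) ≠ 2 by decide),
    hne (show (1 : Fin 3) ≠ 0 by decide), hne (show (1 : Fin 3) ≠ 2 by decide),
    hne (show (2 : Fin 3) ≠ 0 by decide), hne (show (2 : Fin 3) ≠ 1 by decide)]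

/-- Pairwise complementary points on a line. -/
structure IsPointSet {ι : Type*} (z : ι → L) : Prop where
  ne_bot : ∀ i, z i ≠ ⊥
  isCompl : ∀ i j, i ≠ j → IsCompl (z i) (z j)

lemma IsPointSet.isCell {ι : Type*} {z : ι → L} (hz : IsPointSet z) {i j i' j' : ι} (hij : i ≠ j)
    (hij' : i' ≠ j') {F G : Fin 3 →o L} (hF : F ∈ (pointDiff (z i) (z j)).support)
    (hG : G ∈ (pointDiff (z i') (z j')).support) : IsCell (meetGrid F G) := by
  have h : ∀ i j i' j' : ι, i ≠ j → i' ≠ j' →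
      IsCell (meetGrid (midFlag (z i)) (midFlag (z i'))) := by
    intro i j i' j' h h'
    have h1 : ∀ i j, i ≠ j → z i ≠ ⊤ := fun i j h e =>
      hz.ne_bot j (top_disjoint.1 (e ▸ (hz.isCompl i j h).disjoint))
    refine isCell_midFlag ⟨_, hz.isCompl _ _ h⟩ ⟨_, hz.isCompl _ _ h'⟩ (hz.ne_bot _) (h1 _ _ h)
      (hz.ne_bot _) (h1 _ _ h') ?_
    exact (eq_or_ne i i').imp (congrArg z) (hz.isCompl _ _)
  rcases eq_or_eq_of_mem_support_pointDiff hF with rfl | rfl <;>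
    rcases eq_or_eq_of_mem_support_pointDiff hG with rfl | rfl
  exacts [h _ _ _ _ hij.symm hij'.symm, h _ _ _ _ hij.symm hij', h _ _ _ _ hij hij'.symm,
    h _ _ _ _ hij hij']

/-- Three independent elements which span. -/
def IsFrame (x y z : L) : Prop := Disjoint x y ∧ IsCompl (x ⊔ y) z

lemma IsFrame.swap {x y z : L} (h : IsFrame x y z) : IsFrame y x z :=
  ⟨h.1.symm, sup_comm x y ▸ h.2⟩

/-- Together with `IsFrame.swap` this gives all permutations of a frame. -/
lemma IsFrame.rotate [IsModularLattice L] {x y z : L} (h : IsFrame x y z) : IsFrame y z x :=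
  ⟨h.2.disjoint.mono_left le_sup_right,
    (h.1.disjoint_sup_right_of_disjoint_sup_left h.2.disjoint).symm, by
      rw [codisjoint_iff, sup_right_comm, sup_comm y x, h.2.sup_eq_top]⟩

lemma IsFrame.isCompl [IsModularLattice L] {x y z : L} (h : IsFrame x y z) : IsCompl x (y ⊔ z) :=
  h.rotate.2.symm

lemma IsFrame.isComplemented_sup {x y z : L} (h : IsFrame x y z) : IsComplemented (x ⊔ y) :=
  ⟨z, h.2⟩

/-- Points in a plane in such relative positions that all lines joining two of them are in good
relative position. -/
structure IsConfiguration {ι : Type*} (z : ι → L) : Prop where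
  ne_bot : ∀ i, z i ≠ ⊥
  isComplemented : ∀ i, IsComplemented (z i)
  disjoint : ∀ i j, i ≠ j → Disjoint (z i) (z j)
  sup_isComplemented : ∀ i j, i ≠ j → IsComplemented (z i ⊔ z j)
  sup_ne_top : ∀ i j, i ≠ j → z i ⊔ z j ≠ ⊤
  le_or_isCompl : ∀ i j k, j ≠ k → z i ≤ z j ⊔ z k ∨ IsCompl (z i) (z j ⊔ z k)

lemma IsConfiguration.isPointLine {ι : Type*} {z : ι → L} (h : IsConfiguration z) {i j : ι}
    (hij : i ≠ j) : IsPointLine (z i) (z i ⊔ z j) where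
  point := h.isComplemented i
  line := h.sup_isComplemented i j hij
  bot_lt := bot_lt_iff_ne_bot.2 (h.ne_bot i)
  lt := left_lt_sup.2 fun hle => h.ne_bot j ((h.disjoint i j hij).symm.eq_bot_of_le hle)
  lt_top := lt_top_iff_ne_top.2 (h.sup_ne_top i j hij)

/-- The hypothesis `hinf` is the one input that is not lattice-theoretic; for submodules it comes
from projectivity, by `isComplemented_inf_of_sup_eq_top`. -/
lemma IsConfiguration.isGoodPair {ι : Type*} {z : ι → L} (h : IsConfiguration z)
    (hinf : ∀ x y : L, IsComplemented x → IsComplemented y → x ⊔ y = ⊤ → IsComplemented (x ⊓ y))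
    {i j i' j' : ι} (hij : i ≠ j) (hij' : i' ≠ j') :
    IsGoodPair (z i) (z i ⊔ z j) (z i') (z i' ⊔ z j') where
  left := h.isPointLine hij
  right := h.isPointLine hij'
  points := by
    rcases eq_or_ne i i' with rfl | hi
    · exact Or.inl rfl
    · exact Or.inr ⟨h.disjoint _ _ hi, h.sup_isComplemented _ _ hi⟩
  point_line := h.le_or_isCompl _ _ _ hij'
  line_point := h.le_or_isCompl _ _ _ hij
  lines := by
    by_cases ht : z i ⊔ z j ⊔ (z i' ⊔ z j') = ⊤
    · exact Or.inr ⟨ht, hinf _ _ (h.sup_isComplemented _ _ hij) (h.sup_isComplemented _ _ hij') ht⟩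
    -- If the two lines do not span everything, no point spanning one of them is complementary to
    -- the other. Each such point therefore lies on the other line, and the lines are equal.
    · left
      have key : ∀ {x l l' : L}, x ≤ l → l ⊔ l' ≠ ⊤ → (x ≤ l' ∨ IsCompl x l') → x ≤ l' :=
        fun hx hne hor => hor.resolve_right fun hc =>
          hne (top_le_iff.1 (hc.sup_eq_top ▸ sup_le_sup_right hx _))
      refine le_antisymm (sup_le ?_ ?_) (sup_le ?_ ?_)
      · exact key le_sup_left ht (h.le_or_isCompl _ _ _ hij')
      · exact key le_sup_right ht (h.le_or_isCompl _ _ _ hij')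
      · exact key le_sup_left (sup_comm (z i ⊔ z j) _ ▸ ht) (h.le_or_isCompl _ _ _ hij)
      · exact key le_sup_right (sup_comm (z i ⊔ z j) _ ▸ ht) (h.le_or_isCompl _ _ _ hij)

lemma IsConfiguration.isCell [IsModularLattice L] {ι : Type*} {z : ι → L} (h : IsConfiguration z)
    (hinf : ∀ x y : L, IsComplemented x → IsComplemented y → x ⊔ y = ⊤ → IsComplemented (x ⊓ y))
    {x y : Fin 3 → ι} (hx : Function.Injective x) (hy : Function.Injective y)
    {F G : Fin 4 →o L} (hF : F ∈ (triangle (z (x 0)) (z (x 1)) (z (x 2))).support)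
    (hG : G ∈ (triangle (z (y 0)) (z (y 1)) (z (y 2))).support) : IsCell (meetGrid F G) := by
  obtain ⟨i, j, hij, rfl⟩ := exists_eq_of_mem_support_triangle hx hF
  obtain ⟨i', j', hij', rfl⟩ := exists_eq_of_mem_support_triangle hy hG
  exact isCell_lineFlag (h.isGoodPair hinf hij hij')

/-- A third point forming a frame with two given ones makes their join a proper summand, so it
suffices to list the frames and the collinear triples. -/
lemma isConfiguration_of_isFrame [IsModularLattice L] {ι : Type*} {z : ι → L}
    (h0 : ∀ i, z i ≠ ⊥) (h : ∀ i j, i ≠ j → ∃ k, IsFrame (z i) (z j) (z k))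
    (h' : ∀ i j k, j ≠ k → z i ≤ z j ⊔ z k ∨ IsFrame (z i) (z j) (z k))
    (hi : ∀ i : ι, ∃ j, i ≠ j) : IsConfiguration z where
  ne_bot := h0
  isComplemented i := by
    obtain ⟨j, hij⟩ := hi i
    obtain ⟨k, hk⟩ := h i j hij
    exact ⟨_, hk.isCompl⟩
  disjoint i j hij := by
    obtain ⟨k, hk⟩ := h i j hij
    exact hk.1
  sup_isComplemented i j hij := by
    obtain ⟨k, hk⟩ := h i j hij
    exact hk.isComplemented_sup
  sup_ne_top i j hij e := by
    obtain ⟨k, hk⟩ := h i j hij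
    have := hk.2.disjoint
    rw [e] at this
    exact h0 k (top_disjoint.1 this)
  le_or_isCompl i j k hjk := (h' i j k hjk).imp_right IsFrame.isCompl

lemma isConfiguration_three [IsModularLattice L] {c p q : L} (hc : c ≠ ⊥) (hp : p ≠ ⊥)
    (hq : q ≠ ⊥) (h : IsFrame c p q) : IsConfiguration ![c, p, q] := by
  refine isConfiguration_of_isFrame ?_ ?_ ?_ (by decide)
  · intro i
    fin_cases i <;> assumption
  · intro i j hij
    fin_cases i <;> fin_cases j
    all_goals first
      | exact absurd rfl hij
      | exact ⟨2, h⟩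
      | exact ⟨2, h.swap⟩
      | exact ⟨0, h.rotate⟩
      | exact ⟨0, h.rotate.swap⟩
      | exact ⟨1, h.rotate.rotate⟩
      | exact ⟨1, h.rotate.rotate.swap⟩
  · intro i j k hjk
    fin_cases i <;> fin_cases j <;> fin_cases k
    all_goals first
      | exact absurd rfl hjk
      | exact Or.inl le_sup_left
      | exact Or.inl le_sup_right
      | exact Or.inr h
      | exact Or.inr h.swap
      | exact Or.inr h.rotate
      | exact Or.inr h.rotate.swap
      | exact Or.inr h.rotate.rotate
      | exact Or.inr h.rotate.rotate.swap

/-- Four points in general position. -/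
lemma isConfiguration_of_general_position [IsModularLattice L] {u p p' c : L} (hu : u ≠ ⊥) (hp : p ≠ ⊥) (hp' : p' ≠ ⊥)
    (hc : c ≠ ⊥) (h₃ : IsFrame u p p') (h₂ : IsFrame u p c) (h₁ : IsFrame u p' c)
    (h₀ : IsFrame p p' c) :
    IsConfiguration ![u, p, p', c] := by
  refine isConfiguration_of_isFrame ?_ ?_ ?_ (by decide)
  · intro i
    fin_cases i <;> assumption
  · intro i j hij
    fin_cases i <;> fin_cases j
    all_goals first
      | exact absurd rfl hij
      | exact ⟨2, h₃⟩
      | exact ⟨2, h₃.swap⟩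
      | exact ⟨0, h₃.rotate⟩
      | exact ⟨0, h₃.rotate.swap⟩
      | exact ⟨1, h₃.rotate.rotate⟩
      | exact ⟨1, h₃.rotate.rotate.swap⟩
      | exact ⟨3, h₂⟩
      | exact ⟨3, h₂.swap⟩
      | exact ⟨0, h₂.rotate⟩
      | exact ⟨0, h₂.rotate.swap⟩
      | exact ⟨1, h₂.rotate.rotate⟩
      | exact ⟨1, h₂.rotate.rotate.swap⟩
      | exact ⟨3, h₁⟩
      | exact ⟨3, h₁.swap⟩
      | exact ⟨0, h₁.rotate⟩
      | exact ⟨0, h₁.rotate.swap⟩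
  · intro i j k hjk
    fin_cases i <;> fin_cases j <;> fin_cases k
    all_goals first
      | exact absurd rfl hjk
      | exact Or.inl le_sup_left
      | exact Or.inl le_sup_right
      | exact Or.inr h₃
      | exact Or.inr h₃.swap
      | exact Or.inr h₃.rotate
      | exact Or.inr h₃.rotate.swap
      | exact Or.inr h₃.rotate.rotate
      | exact Or.inr h₃.rotate.rotate.swap
      | exact Or.inr h₂
      | exact Or.inr h₂.swap
      | exact Or.inr h₂.rotate
      | exact Or.inr h₂.rotate.swap
      | exact Or.inr h₂.rotate.rotate
      | exact Or.inr h₂.rotate.rotate.swap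
      | exact Or.inr h₁
      | exact Or.inr h₁.swap
      | exact Or.inr h₁.rotate
      | exact Or.inr h₁.rotate.swap
      | exact Or.inr h₁.rotate.rotate
      | exact Or.inr h₁.rotate.rotate.swap
      | exact Or.inr h₀
      | exact Or.inr h₀.swap
      | exact Or.inr h₀.rotate
      | exact Or.inr h₀.rotate.swap
      | exact Or.inr h₀.rotate.rotate
      | exact Or.inr h₀.rotate.rotate.swap

/-- Three collinear points and a fourth point. -/
lemma isConfiguration_of_collinear [IsModularLattice L] {c p p' q : L} (hc : c ≠ ⊥) (hp : p ≠ ⊥) (hp' : p' ≠ ⊥)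
    (hq : q ≠ ⊥) (h₃ : IsFrame c p p') (h₂ : IsFrame c p q) (h₁ : IsFrame c p' q)
    (e₁ : p ≤ p' ⊔ q) (e₂ : p' ≤ p ⊔ q) (e₃ : q ≤ p ⊔ p') :
    IsConfiguration ![c, p, p', q] := by
  refine isConfiguration_of_isFrame ?_ ?_ ?_ (by decide)
  · intro i
    fin_cases i <;> assumption
  · intro i j hij
    fin_cases i <;> fin_cases j
    all_goals first
      | exact absurd rfl hij
      | exact ⟨2, h₃⟩
      | exact ⟨2, h₃.swap⟩
      | exact ⟨0, h₃.rotate⟩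
      | exact ⟨0, h₃.rotate.swap⟩
      | exact ⟨1, h₃.rotate.rotate⟩
      | exact ⟨1, h₃.rotate.rotate.swap⟩
      | exact ⟨3, h₂⟩
      | exact ⟨3, h₂.swap⟩
      | exact ⟨0, h₂.rotate⟩
      | exact ⟨0, h₂.rotate.swap⟩
      | exact ⟨1, h₂.rotate.rotate⟩
      | exact ⟨1, h₂.rotate.rotate.swap⟩
      | exact ⟨3, h₁⟩
      | exact ⟨3, h₁.swap⟩
      | exact ⟨0, h₁.rotate⟩
      | exact ⟨0, h₁.rotate.swap⟩
  · intro i j k hjk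
    fin_cases i <;> fin_cases j <;> fin_cases k
    all_goals first
      | exact absurd rfl hjk
      | exact Or.inl le_sup_left
      | exact Or.inl le_sup_right
      | exact Or.inl e₁
      | exact Or.inl (e₁.trans (sup_comm _ _).le)
      | exact Or.inl e₂
      | exact Or.inl (e₂.trans (sup_comm _ _).le)
      | exact Or.inl e₃
      | exact Or.inl (e₃.trans (sup_comm _ _).le)
      | exact Or.inr h₃
      | exact Or.inr h₃.swap
      | exact Or.inr h₃.rotate
      | exact Or.inr h₃.rotate.swap
      | exact Or.inr h₃.rotate.rotate
      | exact Or.inr h₃.rotate.rotate.swap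
      | exact Or.inr h₂
      | exact Or.inr h₂.swap
      | exact Or.inr h₂.rotate
      | exact Or.inr h₂.rotate.swap
      | exact Or.inr h₂.rotate.rotate
      | exact Or.inr h₂.rotate.rotate.swap
      | exact Or.inr h₁
      | exact Or.inr h₁.swap
      | exact Or.inr h₁.rotate
      | exact Or.inr h₁.rotate.swap
      | exact Or.inr h₁.rotate.rotate
      | exact Or.inr h₁.rotate.rotate.swap

end Configurations

/-! ### Ranks of summands and points in general position over a semi-local ring. -/

section Ranks

variable {A : Type*} [CommRing A] {M : Type*} [AddCommGroup M] [Module A M]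

lemma projective_of_isComplemented [Module.Projective A M] {P : Submodule A M}
    (hP : IsComplemented P) : Module.Projective A P := by
  obtain ⟨Q, hQ⟩ := hP
  exact Module.Projective.of_split P.subtype (P.projectionOnto Q hQ)
    (LinearMap.ext fun x => Submodule.projectionOnto_apply_left hQ x)

lemma finite_of_isComplemented [Module.Finite A M] {P : Submodule A M}
    (hP : IsComplemented P) : Module.Finite A P := by
  obtain ⟨Q, hQ⟩ := hP
  exact Module.Finite.of_surjective (P.projectionOnto Q hQ) fun x =>
    ⟨x, Submodule.projectionOnto_apply_left hQ x⟩

/-- The projection of `P` to a complement `Q'` of `Q` is onto because `P + Q` is everything, and it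
splits because `Q'` is projective. The image `S` of the splitting is a complement of `P ∩ Q` in `P`,
and `P` has a complement in `M`. -/
lemma isComplemented_inf_of_sup_eq_top [Module.Projective A M] {P Q : Submodule A M}
    (hP : IsComplemented P) (hQ : IsComplemented Q) (h : P ⊔ Q = ⊤) : IsComplemented (P ⊓ Q) := by
  obtain ⟨P', hP'⟩ := hP
  obtain ⟨Q', hQ'⟩ := hQ
  have : Module.Projective A Q' := projective_of_isComplemented ⟨Q, hQ'.symm⟩
  let f : P →ₗ[A] Q' := (Q'.projectionOnto Q hQ'.symm) ∘ₗ P.subtype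
  have hf : Function.Surjective f := by
    intro y
    obtain ⟨a, ha, b, hb, hab⟩ := Submodule.mem_sup.1 (h ▸ Submodule.mem_top : (y : M) ∈ P ⊔ Q)
    refine ⟨⟨a, ha⟩, ?_⟩
    have h1 := Submodule.projectionOnto_apply_left hQ'.symm y
    rw [← hab, map_add, (Submodule.projectionOnto_apply_eq_zero_iff hQ'.symm).2 hb, add_zero] at h1
    exact h1
  obtain ⟨s, hs⟩ := Module.projective_lifting_property f LinearMap.id hf
  let S : Submodule A M := LinearMap.range (P.subtype ∘ₗ s)
  have hSP : S ≤ P := by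
    rintro _ ⟨y, rfl⟩
    exact (s y).2
  have hs' : ∀ y, Q'.projectionOnto Q hQ'.symm (s y : M) = y := fun y => LinearMap.congr_fun hs y
  have hSQ : IsCompl Q S := by
    constructor
    · rw [Submodule.disjoint_def]
      rintro _ hx ⟨y, rfl⟩
      have h1 := (Submodule.projectionOnto_apply_eq_zero_iff hQ'.symm).2 hx
      have h2 := hs' y
      change Q'.projectionOnto Q hQ'.symm (s y : M) = 0 at h1
      rw [h1] at h2
      rw [← h2, map_zero]
    · rw [codisjoint_iff, eq_top_iff]
      intro x _
      let y := Q'.projectionOnto Q hQ'.symm x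
      have h1 : x - s y ∈ Q := by
        rw [← Submodule.projectionOnto_apply_eq_zero_iff hQ'.symm, map_sub, hs', sub_self]
      rw [← sub_add_cancel x (s y : M)]
      exact Submodule.add_mem_sup h1 ⟨y, rfl⟩
  refine ⟨S ⊔ P', ?_, ?_⟩
  · have h1 : Disjoint (P ⊓ Q) S := hSQ.disjoint.mono_left inf_le_right
    exact h1.disjoint_sup_right_of_disjoint_sup_left
      (hP'.disjoint.mono_left (sup_le inf_le_left hSP))
  · rw [codisjoint_iff, ← sup_assoc, inf_comm, sup_comm (Q ⊓ P), ← sup_inf_assoc_of_le _ hSP,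
      sup_comm S, hSQ.sup_eq_top, top_inf_eq, hP'.sup_eq_top]

/-- Over a semi-local ring with infinite residue fields, finitely many functionals which do not
vanish at any closed point take invertible values simultaneously. -/
lemma exists_isUnit_apply [Finite (MaximalSpectrum A)]
    (hA : ∀ m : Ideal A, m.IsMaximal → Infinite (A ⧸ m)) {ι : Type*}
    (s : Finset ι) (f : ι → M →ₗ[A] A) (N : Submodule A M) (hf : ∀ i ∈ s, ∃ v ∈ N, f i v = 1) :
    ∃ w ∈ N, ∀ i ∈ s, IsUnit (f i w) := by
  classical
  have h1 : ∀ m : MaximalSpectrum A, ∃ w : N, ∀ i ∈ s, f i w ∉ m.1 := by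
    intro m
    -- Otherwise `N` is a finite union of the preimages of `m` under the functionals. One of these
    -- has finite index, although its quotient is the infinite field `A / m`.
    by_contra! hcon
    have hcov : ⋃ i ∈ s, ((Submodule.comap (f i ∘ₗ N.subtype) m.1 : Submodule A N) : Set N) =
        Set.univ := by
      refine Set.eq_univ_of_forall fun w => ?_
      obtain ⟨i, hi, hw⟩ := hcon w
      exact Set.mem_biUnion hi hw
    obtain ⟨i, hi, hfin⟩ := Submodule.exists_finiteIndex_of_cover hcov
    have := hA m.1 m.2
    let g : N →ₗ[A] A ⧸ m.1 := Submodule.mkQ m.1 ∘ₗ f i ∘ₗ N.subtype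
    have hg : Function.Surjective g := by
      obtain ⟨v, hv, hv1⟩ := hf i hi
      intro y
      obtain ⟨a, rfl⟩ := Submodule.mkQ_surjective _ y
      refine ⟨a • ⟨v, hv⟩, ?_⟩
      change Submodule.mkQ m.1 (f i (a • v)) = _
      rw [map_smul, hv1, smul_eq_mul, mul_one]
    have hk : LinearMap.ker g = Submodule.comap (f i ∘ₗ N.subtype) m.1 := by
      rw [LinearMap.ker_comp, Submodule.ker_mkQ]
    have : Finite (N ⧸ LinearMap.ker g) := by
      rw [hk]
      exact AddSubgroup.finite_quotient_of_finiteIndex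
    have := Finite.of_equiv _ (g.quotKerEquivOfSurjective hg).toEquiv
    exact not_finite (A ⧸ m.1)
  choose w hw using h1
  have := Fintype.ofFinite (MaximalSpectrum A)
  -- The vectors found at the different maximal ideals are glued by the Chinese remainder theorem.
  have h2 : ∀ m : MaximalSpectrum A, ∃ a : A, ∀ m' : MaximalSpectrum A,
      a - (if m' = m then 1 else 0) ∈ m'.1 := fun m =>
    Ideal.exists_forall_sub_mem_ideal
      (fun _ _ hne => Ideal.isCoprime_of_isMaximal (MaximalSpectrum.ext_iff.ne.mp hne))
      (fun m' => if m' = m then 1 else 0)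
  choose a ha using h2
  refine ⟨∑ m, a m • (w m : M), sum_mem fun m _ => N.smul_mem _ (w m).2, fun i hi => ?_⟩
  by_contra hu
  obtain ⟨m, hm, hmem⟩ := exists_max_ideal_of_mem_nonunits hu
  apply hw ⟨m, hm⟩ i hi
  have h3 : f i (w ⟨m, hm⟩) - f i (∑ m, a m • (w m : M)) ∈ m := by
    have e : f i (w ⟨m, hm⟩) - f i (∑ m, a m • (w m : M)) =
        -∑ m', (a m' - if ⟨m, hm⟩ = m' then 1 else 0) * f i (w m') := by
      simp [sub_mul, Finset.sum_sub_distrib, map_sum]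
    rw [e]
    exact neg_mem (sum_mem fun m' _ => m.mul_mem_right _ (ha m' ⟨m, hm⟩))
  exact (Submodule.sub_mem_iff_left _ hmem).1 h3

variable [ConnectedSpace (PrimeSpectrum A)]

/-- The rank of a direct summand. -/
def summandRank (P : Submodule A M) : ℕ :=
  Module.rankAtStalk (R := A) P (Classical.arbitrary (PrimeSpectrum A))

variable [Module.Finite A M] [Module.Projective A M]

/-- The rank of a summand is locally constant and the spectrum is connected, so the point chosen in
`summandRank` does not matter. -/
lemma rankAtStalk_eq_summandRank {P : Submodule A M} (hP : IsComplemented P)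
    (p : PrimeSpectrum A) : Module.rankAtStalk P p = summandRank P := by
  have := projective_of_isComplemented hP
  have := finite_of_isComplemented hP
  have := Module.finitePresentation_of_projective A P
  have hl : IsLocallyConstant (Module.rankAtStalk (R := A) P) :=
    Module.isLocallyConstant_rankAtStalk
  exact hl.apply_eq_of_preconnectedSpace _ _

lemma summandRank_sup {P Q : Submodule A M} (hP : IsComplemented P) (hQ : IsComplemented Q)
    (h : Disjoint P Q) : summandRank (P ⊔ Q) = summandRank P + summandRank Q := by
  have := projective_of_isComplemented hP
  have := finite_of_isComplemented hP
  have := projective_of_isComplemented hQ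
  have := finite_of_isComplemented hQ
  let f : (P × Q) →ₗ[A] M := P.subtype.coprod Q.subtype
  have hf : Function.Injective f := by
    rw [← LinearMap.ker_eq_bot, LinearMap.ker_coprod_of_disjoint_range]
    · simp
    · simpa using h
  let e : (P × Q) ≃ₗ[A] (P ⊔ Q : Submodule A M) :=
    (LinearEquiv.ofInjective f hf).trans (LinearEquiv.ofEq _ _ (Submodule.sup_eq_range P Q).symm)
  rw [summandRank, ← Module.rankAtStalk_eq_of_equiv e, Module.rankAtStalk_prod]
  rfl

lemma summandRank_pos {P : Submodule A M} (hP : IsComplemented P) (h : P ≠ ⊥) :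
    0 < summandRank P := by
  have := projective_of_isComplemented hP
  have := finite_of_isComplemented hP
  refine Nat.pos_of_ne_zero fun h0 => h ?_
  have h1 : Module.rankAtStalk (R := A) P = 0 := funext fun p => by
    rw [rankAtStalk_eq_summandRank hP, h0]
    rfl
  rw [Module.rankAtStalk_eq_zero_iff_subsingleton] at h1
  exact Submodule.subsingleton_iff_eq_bot.1 h1

lemma eq_bot_of_summandRank_eq_zero {P : Submodule A M} (hP : IsComplemented P)
    (h : summandRank P = 0) : P = ⊥ := by
  by_contra hne
  exact (summandRank_pos hP hne).ne' h

/-- By the modular law a complement of `P` in the whole module cuts out a complement of `P` in `Q`.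
-/
lemma exists_disjoint_sup_eq {P Q : Submodule A M} (hP : IsComplemented P) (hQ : IsComplemented Q)
    (h : P ≤ Q) : ∃ R, IsComplemented R ∧ Disjoint P R ∧ P ⊔ R = Q := by
  obtain ⟨P', hP'⟩ := hP
  obtain ⟨Q', hQ'⟩ := hQ
  have e : P ⊔ P' ⊓ Q = Q := by rw [← sup_inf_assoc_of_le _ h, hP'.sup_eq_top, top_inf_eq]
  have hd : Disjoint P (P' ⊓ Q) := hP'.disjoint.mono_right inf_le_left
  refine ⟨P' ⊓ Q, ⟨P ⊔ Q', ?_, ?_⟩, hd, e⟩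
  · refine hd.symm.disjoint_sup_right_of_disjoint_sup_left ?_
    rw [sup_comm, e]
    exact hQ'.disjoint
  · rw [codisjoint_iff, ← sup_assoc, sup_comm (P' ⊓ Q), e, hQ'.sup_eq_top]

lemma summandRank_lt {P Q : Submodule A M} (hP : IsComplemented P) (hQ : IsComplemented Q)
    (h : P < Q) : summandRank P < summandRank Q := by
  obtain ⟨R, hR, hd, rfl⟩ := exists_disjoint_sup_eq hP hQ h.le
  have hR0 : R ≠ ⊥ := by
    rintro rfl
    exact h.ne (sup_bot_eq P).symm
  have := summandRank_pos hR hR0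
  rw [summandRank_sup hP hR hd]
  omega

lemma eq_of_le_of_summandRank_eq {P Q : Submodule A M} (hP : IsComplemented P)
    (hQ : IsComplemented Q) (h : P ≤ Q) (hr : summandRank P = summandRank Q) : P = Q :=
  h.eq_of_not_lt fun hlt => (summandRank_lt hP hQ hlt).ne hr

lemma isRanked_summandRank {d : ℕ} (hM : ∀ p : PrimeSpectrum A, Module.rankAtStalk M p = d) :
    IsRanked (summandRank (A := A) (M := M)) d where
  lt _ _ := summandRank_lt
  top := by
    rw [summandRank, Module.rankAtStalk_eq_of_equiv (Submodule.topEquiv (R := A) (M := M)), hM]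

lemma summandRank_bot : summandRank (⊥ : Submodule A M) = 0 := by
  rw [summandRank, Module.rankAtStalk_eq_zero_of_subsingleton]
  rfl

variable [Finite (MaximalSpectrum A)]

/-- A summand of rank one is free, and a complement of it is the kernel of a functional. -/
lemma exists_generator {H P : Submodule A M} (h : IsCompl H P) (hP : summandRank P = 1) :
    ∃ (v : M) (f : M →ₗ[A] A), P = Submodule.span A {v} ∧ LinearMap.ker f = H ∧ f v = 1 := by
  have := projective_of_isComplemented (P := P) ⟨H, h.symm⟩
  have := finite_of_isComplemented (P := P) ⟨H, h.symm⟩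
  -- A finite projective module over a semi-local ring is free if its fibres at the maximal ideals
  -- all have the same dimension.
  obtain ⟨b⟩ := Module.nonempty_basis_of_flat_of_finrank_eq A P 1 fun m => by
    let : Field (A ⧸ m.1) := Ideal.Quotient.field m.1
    let p : PrimeSpectrum (A ⧸ m.1) := ⟨⊥, Ideal.isPrime_bot⟩
    have h1 := Module.rankAtStalk_baseChange (R := A) (M := P) (S := A ⧸ m.1) p
    rw [Module.rankAtStalk_eq_finrank_of_free, rankAtStalk_eq_summandRank ⟨H, h.symm⟩, hP] at h1
    exact h1
  let e : P →ₗ[A] A := b.coord 0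
  have he : ∀ x : P, e x • b 0 = x := fun x => by
    have := b.sum_repr x
    rwa [Fin.sum_univ_one] at this
  have he' : Function.Injective e := fun x y hxy => by rw [← he x, ← he y, hxy]
  refine ⟨b 0, e ∘ₗ P.projectionOnto H h.symm, ?_, ?_, ?_⟩
  · apply le_antisymm
    · intro x hx
      rw [Submodule.mem_span_singleton]
      exact ⟨e ⟨x, hx⟩, congrArg Subtype.val (he ⟨x, hx⟩)⟩
    · rw [Submodule.span_singleton_le_iff_mem]
      exact (b 0).2
  · ext x
    rw [LinearMap.mem_ker, LinearMap.comp_apply, map_eq_zero_iff e he',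
      Submodule.projectionOnto_apply_eq_zero_iff]
  · rw [LinearMap.comp_apply, Submodule.projectionOnto_apply_left]
    simp [e]

/-- Since `f w` is invertible, `x ↦ x - f(x) f(w)⁻¹ w` projects `P` onto `H` along `w`. -/
lemma span_isCompl_of_isUnit {H P : Submodule A M} {w : M} {f : M →ₗ[A] A} (hw : w ∈ P)
    (hu : IsUnit (f w)) (hf : LinearMap.ker f ⊓ P = H) :
    Disjoint H (Submodule.span A {w}) ∧ H ⊔ Submodule.span A {w} = P := by
  obtain ⟨u, hu⟩ := hu
  constructor
  · rw [Submodule.disjoint_def]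
    intro x hx hxw
    obtain ⟨a, rfl⟩ := Submodule.mem_span_singleton.1 hxw
    rw [← hf] at hx
    have h1 : f (a • w) = 0 := hx.1
    rw [map_smul, smul_eq_mul, ← hu, Units.mul_left_eq_zero] at h1
    rw [h1, zero_smul]
  · apply le_antisymm
    · rw [sup_le_iff, Submodule.span_singleton_le_iff_mem, ← hf]
      exact ⟨inf_le_right, hw⟩
    · intro x hx
      have h1 : x - (f x * (u⁻¹ : Aˣ)) • w ∈ H := by
        rw [← hf, Submodule.mem_inf, LinearMap.mem_ker, map_sub, map_smul, smul_eq_mul, ← hu,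
          Units.inv_mul_cancel_right, sub_self]
        exact ⟨rfl, P.sub_mem hx (P.smul_mem _ hw)⟩
      rw [← sub_add_cancel x ((f x * (u⁻¹ : Aˣ)) • w)]
      exact Submodule.add_mem_sup h1 (Submodule.mem_span_singleton.2 ⟨_, rfl⟩)

/-- Over a semi-local ring with infinite residue fields, finitely many summands of corank one in
`P` have a common complement in `P`. -/
lemma exists_common_complement (hA : ∀ m : Ideal A, m.IsMaximal → Infinite (A ⧸ m))
    {P : Submodule A M} (hP : IsComplemented P) (T : Finset (Submodule A M))
    (hT : ∀ H ∈ T, IsComplemented H ∧ H ≤ P ∧ summandRank P = summandRank H + 1) :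
    ∃ R : Submodule A M, ∀ H ∈ T, Disjoint H R ∧ H ⊔ R = P := by
  have h1 : ∀ H : Submodule A M, ∃ f : M →ₗ[A] A, H ∈ T →
      (∃ v ∈ P, f v = 1) ∧ LinearMap.ker f ⊓ P = H := by
    intro H
    by_cases hH : H ∈ T
    swap
    · exact ⟨0, fun h => absurd h hH⟩
    obtain ⟨hc, hle, hr⟩ := hT H hH
    obtain ⟨R, hR, hd, e⟩ := exists_disjoint_sup_eq hc hP hle
    obtain ⟨P', hP'⟩ := hP
    rw [← e, summandRank_sup hc hR hd, add_right_inj] at hr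
    -- Adding a complement `P'` of `P` turns `H` into a summand of corank one in `M`, so that its
    -- functional is defined on all of `M`.
    have hcompl : IsCompl (H ⊔ P') R := by
      constructor
      · rw [sup_comm, disjoint_comm]
        refine hd.symm.disjoint_sup_right_of_disjoint_sup_left ?_ |>.mono_right (sup_comm _ _).le
        rw [sup_comm, e]
        exact hP'.disjoint
      · rw [codisjoint_iff, sup_right_comm, e, hP'.sup_eq_top]
    obtain ⟨v, f, hv, hf, hfv⟩ := exists_generator hcompl hr
    refine ⟨f, fun _ => ⟨⟨v, ?_, hfv⟩, ?_⟩⟩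
    · rw [← e]
      exact Submodule.mem_sup_right (hv ▸ Submodule.mem_span_singleton_self v)
    · rw [hf, sup_inf_assoc_of_le _ hle, hP'.symm.inf_eq_bot, sup_bot_eq]
  choose f hf using h1
  obtain ⟨w, hw, hu⟩ := exists_isUnit_apply hA T f P fun H hH => (hf H hH).1
  exact ⟨Submodule.span A {w}, fun H hH => span_isCompl_of_isUnit hw (hu H hH) (hf H hH).2⟩

end Ranks

/-! ### Normal forms of configurations with respect to a basis. -/

section Bases

variable {A : Type*} [CommRing A] {M : Type*} [AddCommGroup M] [Module A M]

/-- The submodule spanned by the linear combination of a basis with coefficients `C`. -/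
def combSpan {m : ℕ} (C : Fin m → A) (b : Module.Basis (Fin m) A M) : Submodule A M :=
  Submodule.span A {∑ j, C j • b j}

/-- This is the transitivity of `GL(M)` on bases; one automorphism serves all coefficient vectors,
and so moves whole configurations. -/
lemma exists_map_combSpan {m : ℕ} (b b' : Module.Basis (Fin m) A M) :
    ∃ g : M ≃ₗ[A] M, ∀ C, (combSpan C b).map (g : M →ₗ[A] M) = combSpan C b' := by
  refine ⟨b.equiv b' (Equiv.refl _), fun C => ?_⟩
  rw [combSpan, combSpan, Submodule.map_span, Set.image_singleton]
  simp

/-- The classes in the coinvariants of a family of cycles attached to the bases of `M` and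
equivariant under automorphisms are all equal. -/
lemma exists_cls_eq {m n d : ℕ} (C : Fin n → Fin m → A) (S : (Fin n → Submodule A M) → Prop)
    (y : (Fin n → Submodule A M) → Chain (Submodule A M))
    (hy : ∀ z, S z → y z ∈ cycles (Submodule A M) (2 * d))
    (hg : ∀ z, S z → ∀ g : M ≃ₗ[A] M,
      (autHom g).mapChain (y z) = y fun i => (z i).map (g : M →ₗ[A] M)) :
    ∃ t : cycles (Submodule A M) (2 * d), ∀ z, S z →
      (∃ b : Module.Basis (Fin m) A M, z = fun i => combSpan (C i) b) →
      y z - t ∈ (LinearMap.ker (cls A M d)).map (Submodule.subtype _) := by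
  -- The cycle of any one admissible family serves as reference; if there is none, the claim is
  -- vacuous and zero will do.
  by_cases h : ∃ z, S z ∧ ∃ b : Module.Basis (Fin m) A M, z = fun i => combSpan (C i) b
  · obtain ⟨z₀, hz₀, b₀, hb₀⟩ := h
    refine ⟨⟨y z₀, hy z₀ hz₀⟩, fun z hz ⟨b, hb⟩ => ?_⟩
    obtain ⟨g, hgb⟩ := exists_map_combSpan b₀ b
    have e : (fun i => (z₀ i).map (g : M →ₗ[A] M)) = z := by
      rw [hb, hb₀]
      exact funext fun i => hgb (C i)
    refine ⟨⟨y z, hy z hz⟩ - ⟨y z₀, hy z₀ hz₀⟩, ?_, rfl⟩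
    have h1 := cls_mapChain g ⟨y z₀, hy z₀ hz₀⟩
    have h2 : (⟨(autHom g).mapChain (y z₀), (autHom g).mapChain_mem_cycles (hy z₀ hz₀)⟩ :
        cycles (Submodule A M) (2 * d)) = ⟨y z, hy z hz⟩ :=
      Subtype.ext ((hg z₀ hz₀ g).trans (congrArg y e))
    rw [SetLike.mem_coe, LinearMap.mem_ker, map_sub, sub_eq_zero, ← h2]
    exact h1
  · push Not at h
    exact ⟨0, fun z hz ⟨b, hb⟩ => absurd hb (h z hz b)⟩

lemma mem_map_ker_cls {d : ℕ} {x : cycles (Submodule A M) (2 * d)}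
    (h : (x : Chain (Submodule A M)) ∈ (LinearMap.ker (cls A M d)).map (Submodule.subtype _)) :
    cls A M d x = 0 := by
  obtain ⟨y, hy, hyx⟩ := h
  rw [← Subtype.ext hyx]
  exact hy

/-- Generators with a dual system of functionals are linearly independent, and they span by `ht`. -/
lemma exists_basis_of_dual {n : ℕ} (z : Fin n → Submodule A M)
    (h : ∀ i, ∃ (v : M) (f : M →ₗ[A] A), z i = Submodule.span A {v} ∧
      (∀ j, j ≠ i → z j ≤ LinearMap.ker f) ∧ f v = 1) (ht : ⊤ ≤ ⨆ i, z i) :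
    ∃ b : Module.Basis (Fin n) A M, ∀ i, z i = Submodule.span A {b i} := by
  choose v f hz hf hv using h
  have hli : LinearIndependent A v :=
    LinearIndependent.of_pairwise_dual_eq_zero_one v f (fun i j hij => by
      have := hf i j hij.symm
      rw [hz, Submodule.span_singleton_le_iff_mem] at this
      exact this) hv
  refine ⟨Module.Basis.mk hli ?_, fun i => by rw [Module.Basis.mk_apply, hz]⟩
  refine ht.trans (iSup_le fun i => ?_)
  rw [hz, Submodule.span_singleton_le_iff_mem]
  exact Submodule.subset_span ⟨i, rfl⟩

/-- Writing `v = a w + y` with `y ∈ K` and applying `f` gives `1 = a f(w)`. This turns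
complementarity of points and lines into invertibility of coordinates. -/
lemma isUnit_of_sup_eq_top {w v : M} {K : Submodule A M} {f : M →ₗ[A] A}
    (h : Submodule.span A {w} ⊔ K = ⊤) (hK : K ≤ LinearMap.ker f) (hv : f v = 1) :
    IsUnit (f w) := by
  obtain ⟨x, hx, y, hy, rfl⟩ := Submodule.mem_sup.1 (h ▸ Submodule.mem_top : v ∈ _)
  obtain ⟨a, rfl⟩ := Submodule.mem_span_singleton.1 hx
  rw [map_add, hK hy, add_zero, map_smul, smul_eq_mul] at hv
  exact IsUnit.of_mul_eq_one_right a hv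

lemma span_le_ker_coord {n : ℕ} (b : Module.Basis (Fin n) A M) {i j : Fin n} (h : j ≠ i) :
    Submodule.span A {b j} ≤ LinearMap.ker (b.coord i) := by
  rw [Submodule.span_singleton_le_iff_mem, LinearMap.mem_ker, Module.Basis.coord_apply,
    Module.Basis.repr_self, Finsupp.single_eq_of_ne h.symm]

/-- A vector whose coordinates are zero or invertible is a partial sum of a rescaled basis. -/
lemma exists_rescaled_basis {n : ℕ} (b : Module.Basis (Fin n) A M) (w : M) (s : Finset (Fin n))
    (hs : ∀ i ∈ s, IsUnit (b.coord i w)) (hs' : ∀ i ∉ s, b.coord i w = 0) :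
    ∃ b' : Module.Basis (Fin n) A M, (∀ i, Submodule.span A {b' i} = Submodule.span A {b i}) ∧
      w = ∑ i ∈ s, b' i := by
  classical
  have hu : ∀ i, IsUnit (if i ∈ s then b.coord i w else 1) := fun i => by
    split_ifs with h
    exacts [hs i h, isUnit_one]
  refine ⟨b.isUnitSMul hu, fun i => ?_, ?_⟩
  · rw [Module.Basis.isUnitSMul_apply, Submodule.span_singleton_smul_eq (hu i)]
  · conv_lhs => rw [← b.sum_repr w]
    rw [← Finset.sum_subset (Finset.subset_univ s)]
    · refine Finset.sum_congr rfl fun i hi => ?_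
      rw [Module.Basis.isUnitSMul_apply, if_pos hi]
      rfl
    · intro i _ hi
      have := hs' i hi
      rw [Module.Basis.coord_apply] at this
      rw [this, zero_smul]

variable [ConnectedSpace (PrimeSpectrum A)] [Module.Finite A M] [Module.Projective A M]
  [Finite (MaximalSpectrum A)]

lemma exists_basis_of_isCompl (hM : summandRank (⊤ : Submodule A M) = 2) {x y : Submodule A M}
    (h : IsCompl x y) (hx : x ≠ ⊥) (hy : y ≠ ⊥) :
    ∃ b : Module.Basis (Fin 2) A M, x = Submodule.span A {b 0} ∧ y = Submodule.span A {b 1} := by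
  have hr := summandRank_sup ⟨y, h⟩ ⟨x, h.symm⟩ h.disjoint
  have hx1 := summandRank_pos ⟨y, h⟩ hx
  have hy1 := summandRank_pos ⟨x, h.symm⟩ hy
  rw [h.sup_eq_top, hM] at hr
  obtain ⟨v, f, hv, hf, hfv⟩ := exists_generator h.symm (by omega)
  obtain ⟨w, g, hw, hg, hgw⟩ := exists_generator h (by omega)
  obtain ⟨b, hb⟩ := exists_basis_of_dual ![x, y] (fun i => by
    fin_cases i
    · refine ⟨v, f, hv, fun j hj => ?_, hfv⟩
      fin_cases j
      exacts [absurd rfl hj, hf.ge]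
    · refine ⟨w, g, hw, fun j hj => ?_, hgw⟩
      fin_cases j
      exacts [hg.ge, absurd rfl hj]) (by
    rw [← h.sup_eq_top]
    exact sup_le (le_iSup ![x, y] 0) (le_iSup ![x, y] 1))
  exact ⟨b, hb 0, hb 1⟩

/-- Three positive ranks with sum three are all one. -/
lemma summandRank_eq_one_of_isFrame (hM : summandRank (⊤ : Submodule A M) = 3)
    {x y z : Submodule A M} (h : IsFrame x y z) (hx : x ≠ ⊥) (hy : y ≠ ⊥) (hz : z ≠ ⊥) :
    summandRank z = 1 := by
  have hxc : IsComplemented x := ⟨_, h.isCompl⟩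
  have hyc : IsComplemented y := ⟨_, h.rotate.isCompl⟩
  have hr := summandRank_sup h.isComplemented_sup ⟨_, h.2.symm⟩ h.2.disjoint
  rw [h.2.sup_eq_top, hM, summandRank_sup hxc hyc h.1] at hr
  have hx1 := summandRank_pos hxc hx
  have hy1 := summandRank_pos hyc hy
  have hz1 := summandRank_pos ⟨_, h.2.symm⟩ hz
  omega

lemma exists_basis_of_isFrame (hM : summandRank (⊤ : Submodule A M) = 3) {x y z : Submodule A M}
    (h : IsFrame x y z) (hx : x ≠ ⊥) (hy : y ≠ ⊥) (hz : z ≠ ⊥) :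
    ∃ b : Module.Basis (Fin 3) A M, x = Submodule.span A {b 0} ∧ y = Submodule.span A {b 1} ∧
      z = Submodule.span A {b 2} := by
  obtain ⟨v, f, hv, hf, hfv⟩ := exists_generator h.isCompl.symm
    (summandRank_eq_one_of_isFrame hM h.rotate hy hz hx)
  obtain ⟨w, g, hw, hg, hgw⟩ := exists_generator h.rotate.isCompl.symm
    (summandRank_eq_one_of_isFrame hM h.rotate.rotate hz hx hy)
  obtain ⟨u, e, hu, he, heu⟩ := exists_generator h.2 (summandRank_eq_one_of_isFrame hM h hx hy hz)
  obtain ⟨b, hb⟩ := exists_basis_of_dual ![x, y, z] (fun i => by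
    fin_cases i
    · refine ⟨v, f, hv, fun j hj => ?_, hfv⟩
      fin_cases j
      exacts [absurd rfl hj, le_sup_left.trans hf.ge, le_sup_right.trans hf.ge]
    · refine ⟨w, g, hw, fun j hj => ?_, hgw⟩
      fin_cases j
      exacts [le_sup_right.trans hg.ge, absurd rfl hj, le_sup_left.trans hg.ge]
    · refine ⟨u, e, hu, fun j hj => ?_, heu⟩
      fin_cases j
      exacts [le_sup_left.trans he.ge, le_sup_right.trans he.ge, absurd rfl hj]) (by
    rw [← h.2.sup_eq_top]
    exact sup_le (sup_le (le_iSup ![x, y, z] 0) (le_iSup ![x, y, z] 1)) (le_iSup ![x, y, z] 2))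
  exact ⟨b, hb 0, hb 1, hb 2⟩

lemma exists_combSpan_of_isCompl (hM : summandRank (⊤ : Submodule A M) = 2)
    {x y : Submodule A M} (h : IsCompl x y) (hx : x ≠ ⊥) (hy : y ≠ ⊥) :
    ∃ b : Module.Basis (Fin 2) A M,
      ![x, y] = fun i => combSpan (![![1, 0], ![0, 1]] i) b := by
  obtain ⟨b, rfl, rfl⟩ := exists_basis_of_isCompl hM h hx hy
  refine ⟨b, funext fun i => ?_⟩
  fin_cases i <;> simp [combSpan, Fin.sum_univ_two]

/-- The third point is complementary to each of the other two, so both coordinates of its generator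
are units and can be absorbed into the basis. -/
lemma exists_combSpan_of_three_points (hM : summandRank (⊤ : Submodule A M) = 2)
    {x y z : Submodule A M} (hxy : IsCompl x y) (hxz : IsCompl x z) (hyz : IsCompl y z)
    (hx : x ≠ ⊥) (hy : y ≠ ⊥) (hz : z ≠ ⊥) :
    ∃ b : Module.Basis (Fin 2) A M,
      ![x, y, z] = fun i => combSpan (![![1, 0], ![0, 1], ![1, 1]] i) b := by
  obtain ⟨b, rfl, rfl⟩ := exists_basis_of_isCompl hM hxy hx hy
  -- The second basis serves only to name a generator of the third point.
  obtain ⟨b₁, -, hz1⟩ := exists_basis_of_isCompl hM hxz hx hz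
  set w := b₁ 1
  subst hz1
  have h0 : ∀ i, b.coord i (b i) = 1 := fun i => by simp
  obtain ⟨b', hb', hw⟩ := exists_rescaled_basis b w Finset.univ (fun i _ => by
    fin_cases i
    · exact isUnit_of_sup_eq_top hyz.symm.sup_eq_top (span_le_ker_coord b (by decide)) (h0 0)
    · exact isUnit_of_sup_eq_top hxz.symm.sup_eq_top (span_le_ker_coord b (by decide)) (h0 1))
    (fun i hi => absurd (Finset.mem_univ i) hi)
  refine ⟨b', funext fun i => ?_⟩
  rw [Fin.sum_univ_two] at hw
  fin_cases i <;> simp [combSpan, Fin.sum_univ_two, hb', hw]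

lemma exists_combSpan_of_isFrame (hM : summandRank (⊤ : Submodule A M) = 3)
    {x y z : Submodule A M} (h : IsFrame x y z) (hx : x ≠ ⊥) (hy : y ≠ ⊥) (hz : z ≠ ⊥) :
    ∃ b : Module.Basis (Fin 3) A M,
      ![x, y, z] = fun i => combSpan (![![1, 0, 0], ![0, 1, 0], ![0, 0, 1]] i) b := by
  obtain ⟨b, rfl, rfl, rfl⟩ := exists_basis_of_isFrame hM h hx hy hz
  refine ⟨b, funext fun i => ?_⟩
  fin_cases i <;> simp [combSpan, Fin.sum_univ_three]

lemma exists_combSpan_of_collinear (hM : summandRank (⊤ : Submodule A M) = 3)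
    {c p p' q : Submodule A M} (hc : c ≠ ⊥) (hp : p ≠ ⊥) (hp' : p' ≠ ⊥) (hq : q ≠ ⊥)
    (h₃ : IsFrame c p p') (h₂ : IsFrame c p q) (h₁ : IsFrame c p' q) (e : p' ≤ p ⊔ q) :
    ∃ b : Module.Basis (Fin 3) A M, ![c, p, p', q] =
      fun i => combSpan (![![1, 0, 0], ![0, 1, 0], ![0, 1, 1], ![0, 0, 1]] i) b := by
  obtain ⟨b, rfl, rfl, rfl⟩ := exists_basis_of_isFrame hM h₂ hc hp hq
  obtain ⟨b₁, -, -, hw1⟩ := exists_basis_of_isFrame hM h₃ hc hp hp'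
  set w := b₁ 2
  subst hw1
  have h0 : ∀ i, b.coord i (b i) = 1 := fun i => by simp
  -- The generator of `p'` has no coordinate along `c` because `p'` lies on the line `p ⊔ q`. Its
  -- other two coordinates are units because `p'` forms a frame with `c` and either of `p`, `q`.
  obtain ⟨b', hb', hw⟩ := exists_rescaled_basis b w {1, 2} (fun i hi => by
    fin_cases i
    · exact absurd hi (by decide)
    · exact isUnit_of_sup_eq_top h₁.rotate.isCompl.sup_eq_top
        (sup_le (span_le_ker_coord b (by decide)) (span_le_ker_coord b (by decide))) (h0 1)
    · exact isUnit_of_sup_eq_top h₃.2.symm.sup_eq_top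
        (sup_le (span_le_ker_coord b (by decide)) (span_le_ker_coord b (by decide))) (h0 2))
    (fun i hi => by
      fin_cases i
      · have : w ∈ LinearMap.ker (b.coord 0) :=
          (e.trans (sup_le (span_le_ker_coord b (by decide)) (span_le_ker_coord b (by decide))))
            (Submodule.mem_span_singleton_self w)
        exact this
      · exact absurd (by decide) hi
      · exact absurd (by decide) hi)
  refine ⟨b', funext fun i => ?_⟩
  rw [Finset.sum_pair (by decide)] at hw
  fin_cases i <;> simp [combSpan, Fin.sum_univ_three, hb', hw]

/-- This is the projective frame of a plane: `c` is off the three sides of the triangle `u`, `p`,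
`p'`, so all its coordinates are units and can be scaled to one. -/
lemma exists_combSpan_of_general_position (hM : summandRank (⊤ : Submodule A M) = 3)
    {u p p' c : Submodule A M} (hu : u ≠ ⊥) (hp : p ≠ ⊥) (hp' : p' ≠ ⊥) (hc : c ≠ ⊥)
    (h₃ : IsFrame u p p') (h₂ : IsFrame u p c) (h₁ : IsFrame u p' c) (h₀ : IsFrame p p' c) :
    ∃ b : Module.Basis (Fin 3) A M, ![u, p, p', c] =
      fun i => combSpan (![![1, 0, 0], ![0, 1, 0], ![0, 0, 1], ![1, 1, 1]] i) b := by
  obtain ⟨b, rfl, rfl, rfl⟩ := exists_basis_of_isFrame hM h₃ hu hp hp'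
  obtain ⟨b₁, -, -, hw1⟩ := exists_basis_of_isFrame hM h₂ hu hp hc
  set w := b₁ 2
  subst hw1
  have h0 : ∀ i, b.coord i (b i) = 1 := fun i => by simp
  obtain ⟨b', hb', hw⟩ := exists_rescaled_basis b w Finset.univ (fun i _ => by
    fin_cases i
    · exact isUnit_of_sup_eq_top h₀.2.symm.sup_eq_top
        (sup_le (span_le_ker_coord b (by decide)) (span_le_ker_coord b (by decide))) (h0 0)
    · exact isUnit_of_sup_eq_top h₁.2.symm.sup_eq_top
        (sup_le (span_le_ker_coord b (by decide)) (span_le_ker_coord b (by decide))) (h0 1)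
    · exact isUnit_of_sup_eq_top h₂.2.symm.sup_eq_top
        (sup_le (span_le_ker_coord b (by decide)) (span_le_ker_coord b (by decide))) (h0 2))
    (fun i hi => absurd (Finset.mem_univ i) hi)
  refine ⟨b', funext fun i => ?_⟩
  rw [Fin.sum_univ_three] at hw
  fin_cases i <;> simp [combSpan, Fin.sum_univ_three, hb', hw]

end Bases

/-! ### The class of a product depends only on the type of its configuration. -/

section Classes

variable {A : Type*} [CommRing A] {M : Type*} [AddCommGroup M] [Module A M]

lemma IsPointSet.tens_mem_cycles {L : Type*} [Lattice L] [BoundedOrder L] {ι : Type*} {z : ι → L}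
    (hz : IsPointSet z) {i j i' j' : ι} (hij : i ≠ j) (hij' : i' ≠ j') :
    tens (pointDiff (z i) (z j)) (pointDiff (z i') (z j')) ∈ cycles L 4 :=
  DoubleBuilding.tens_mem_cycles (d := 1) (fun _ hF _ hG => hz.isCell hij hij' hF hG)
    (fun _ => mapDomain_flagFace_pointDiff _ _) (fun _ => mapDomain_flagFace_pointDiff _ _)

lemma exists_cls_eq_of_isPointSet {n : ℕ} (C : Fin n → Fin 2 → A) {i j i' j' : Fin n}
    (hij : i ≠ j) (hij' : i' ≠ j') :
    ∃ t : cycles (Submodule A M) (2 * 2), ∀ z : Fin n → Submodule A M, IsPointSet z →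
      (∃ b : Module.Basis (Fin 2) A M, z = fun i => combSpan (C i) b) →
      tens (pointDiff (z i) (z j)) (pointDiff (z i') (z j')) - t ∈
        (LinearMap.ker (cls A M 2)).map (Submodule.subtype _) := by
  refine exists_cls_eq C IsPointSet
    (fun z => tens (pointDiff (z i) (z j)) (pointDiff (z i') (z j')))
    (fun z hz => hz.tens_mem_cycles hij hij') fun z hz g => ?_
  rw [autHom, mapChain_tens _ fun F hF G hG => hz.isCell hij hij' hF hG,
    mapDomain_mapFlag_pointDiff, mapDomain_mapFlag_pointDiff]
  rfl

lemma IsConfiguration.tens_mem_cycles [Module.Projective A M] {ι : Type*} {z : ι → Submodule A M}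
    (hz : IsConfiguration z) {x y : Fin 3 → ι} (hx : Function.Injective x)
    (hy : Function.Injective y) :
    tens (triangle (z (x 0)) (z (x 1)) (z (x 2))) (triangle (z (y 0)) (z (y 1)) (z (y 2))) ∈
      cycles (Submodule A M) 6 :=
  DoubleBuilding.tens_mem_cycles (d := 2)
    (fun _ hF _ hG => hz.isCell (fun _ _ => isComplemented_inf_of_sup_eq_top) hx hy hF hG)
    (fun _ => mapDomain_flagFace_triangle _ _ _) (fun _ => mapDomain_flagFace_triangle _ _ _)

lemma exists_cls_eq_of_isConfiguration [Module.Projective A M] {n : ℕ} (C : Fin n → Fin 3 → A)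
    {x y : Fin 3 → Fin n} (hx : Function.Injective x) (hy : Function.Injective y) :
    ∃ t : cycles (Submodule A M) (2 * 3), ∀ z : Fin n → Submodule A M, IsConfiguration z →
      (∃ b : Module.Basis (Fin 3) A M, z = fun i => combSpan (C i) b) →
      tens (triangle (z (x 0)) (z (x 1)) (z (x 2))) (triangle (z (y 0)) (z (y 1)) (z (y 2))) - t ∈
        (LinearMap.ker (cls A M 3)).map (Submodule.subtype _) := by
  refine exists_cls_eq C IsConfiguration
    (fun z => tens (triangle (z (x 0)) (z (x 1)) (z (x 2)))
      (triangle (z (y 0)) (z (y 1)) (z (y 2))))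
    (fun z hz => hz.tens_mem_cycles hx hy) fun z hz g => ?_
  rw [autHom, mapChain_tens _ fun F hF G hG =>
      hz.isCell (fun _ _ => isComplemented_inf_of_sup_eq_top) hx hy hF hG,
    mapDomain_mapFlag_triangle, mapDomain_mapFlag_triangle]
  rfl

lemma disjoint_span_basis {n : ℕ} (b : Module.Basis (Fin n) A M) {i j : Fin n} (h : i ≠ j) :
    Disjoint (Submodule.span A {b i}) (Submodule.span A {b j}) := by
  have := b.linearIndependent.disjoint_span_image (Set.disjoint_singleton.2 h)
  rwa [Set.image_singleton, Set.image_singleton] at this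

lemma span_basis_ne_bot [Nontrivial A] {n : ℕ} (b : Module.Basis (Fin n) A M) (i : Fin n) :
    Submodule.span A {b i} ≠ ⊥ :=
  Submodule.span_singleton_eq_bot.not.2 (b.ne_zero i)

/-- The expansion theorems evaluate a linear map defined on all chains, whereas `cls` is defined on
cycles only. The quotient of the chains by the kernel of `cls` takes its place. -/
lemma cls_eq_smul_of_mkQ {d : ℕ} {x t : cycles (Submodule A M) (2 * d)} {n : ℤ}
    (h : ((LinearMap.ker (cls A M d)).map (Submodule.subtype _)).mkQ
      (x : Chain (Submodule A M)) = n • ((LinearMap.ker (cls A M d)).map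
        (Submodule.subtype _)).mkQ (t : Chain (Submodule A M))) :
    cls A M d x = n • cls A M d t := by
  rw [← map_smul, Submodule.mkQ_apply, Submodule.mkQ_apply, Submodule.Quotient.eq] at h
  rw [← sub_eq_zero, ← map_smul, ← map_sub]
  exact mem_map_ker_cls h

end Classes

/-! ### Rank two. -/

section RankTwo

variable {A : Type*} [CommRing A] [ConnectedSpace (PrimeSpectrum A)] {M : Type*} [AddCommGroup M]
  [Module A M] [Module.Finite A M] [Module.Projective A M] [Finite (MaximalSpectrum A)]

lemma nonempty_basis {d : ℕ} (hM : ∀ p : PrimeSpectrum A, Module.rankAtStalk M p = d) :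
    Nonempty (Module.Basis (Fin d) A M) :=
  Module.nonempty_basis_of_flat_of_finrank_eq A M d fun m => by
    let : Field (A ⧸ m.1) := Ideal.Quotient.field m.1
    exact finrank_tensor A M (A ⧸ m.1) hM

/-- Distinct elements of rank one in a cell of rank two are complementary. -/
lemma isCompl_of_rank_two (hr : IsRanked (summandRank (A := A) (M := M)) 2)
    {c : Cell (Submodule A M)} (hp : c.p = 2) (hq : c.q = 2) (h : c.left 1 ≠ c.right 1) :
    IsCompl (c.left 1) (c.right 1) := by
  have hl := hr.rk_left hp (n := 1) one_le_two
  have hr' := hr.rk_right hq (n := 1) one_le_two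
  have hlc := c.left_isComplemented 1
  have hrc := c.right_isComplemented 1
  have hne : ¬ c.left 1 ≤ c.right 1 := fun hle =>
    h (eq_of_le_of_summandRank_eq hlc hrc hle (hl.trans hr'.symm))
  have h1 := summandRank_lt (c.inf_isComplemented 1 1) hlc (inf_lt_left.2 hne)
  have h2 := summandRank_lt hrc (c.sup_isComplemented 1 1) (right_lt_sup.2 hne)
  constructor
  · rw [disjoint_iff]
    exact eq_bot_of_summandRank_eq_zero (c.inf_isComplemented 1 1) (by omega)
  · rw [codisjoint_iff]
    by_contra hne'
    have h3 := summandRank_lt (c.sup_isComplemented 1 1) isComplemented_top (lt_top_iff_ne_top.2 hne')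
    rw [hr.top] at h3
    omega

theorem bijective_augmentation_of_rank_two (hA : ∀ m : Ideal A, m.IsMaximal → Infinite (A ⧸ m))
    (hM : ∀ p : PrimeSpectrum A, Module.rankAtStalk M p = 2) (m : Ideal A) [m.IsMaximal] :
    Function.Bijective (augmentation A M 2 hM m) := by
  classical
  have hr := isRanked_summandRank hM
  -- `t₁` represents the class of `(a - c) ⊗ (a - c)`, and `t₂` that of `(a - c) ⊗ (b - c)` with `a
  -- ≠ b`.
  obtain ⟨t₁, ht₁⟩ := exists_cls_eq_of_isPointSet (M := M) (![![1, 0], ![0, 1]] : Fin 2 → Fin 2 → A)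
    (i := 0) (j := 1) (i' := 0) (j' := 1) (by decide) (by decide)
  obtain ⟨t₂, ht₂⟩ := exists_cls_eq_of_isPointSet (M := M)
    (![![1, 0], ![0, 1], ![1, 1]] : Fin 3 → Fin 2 → A)
    (i := 0) (j := 1) (i' := 0) (j' := 2) (by decide) (by decide)
  have hset₂ : ∀ {c a : Submodule A M}, c ≠ ⊥ → a ≠ ⊥ → IsCompl c a → IsPointSet ![c, a] := by
    intro c a hc ha h
    refine ⟨fun i => ?_, fun i j hij => ?_⟩
    · fin_cases i <;> assumption
    · fin_cases i <;> fin_cases j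
      exacts [absurd rfl hij, h, h.symm, absurd rfl hij]
  have hset₃ : ∀ {c a b : Submodule A M}, c ≠ ⊥ → a ≠ ⊥ → b ≠ ⊥ → IsCompl c a → IsCompl c b →
      IsCompl a b → IsPointSet ![c, a, b] := by
    intro c a b hc ha hb h1 h2 h3
    refine ⟨fun i => ?_, fun i j hij => ?_⟩
    · fin_cases i <;> assumption
    · fin_cases i <;> fin_cases j
      exacts [absurd rfl hij, h1, h2, h1.symm, absurd rfl hij, h3, h2.symm, h3.symm, absurd rfl hij]
  have htop : ∀ {c a : Submodule A M}, summandRank a = 1 → IsCompl a c → c ≠ ⊥ := by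
    rintro c a ha h rfl
    have h1 := h.sup_eq_top
    rw [sup_bot_eq] at h1
    have h2 := hr.top
    rw [← h1, ha] at h2
    omega
  have hbot : ∀ {a : Submodule A M}, summandRank a = 1 → a ≠ ⊥ := by
    rintro a ha rfl
    rw [summandRank_bot] at ha
    omega
  obtain ⟨b⟩ := nonempty_basis hM
  have : Nontrivial A := PrimeSpectrum.nonempty_iff_nontrivial.1 inferInstance
  have hb : IsCompl (Submodule.span A {b 0}) (Submodule.span A {b 1}) :=
    ⟨disjoint_span_basis b (by decide), by
      rw [codisjoint_iff, ← top_le_iff, ← b.span_eq, Submodule.span_le, Set.range_subset_iff]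
      intro i
      fin_cases i
      exacts [Submodule.mem_sup_left (Submodule.mem_span_singleton_self _),
        Submodule.mem_sup_right (Submodule.mem_span_singleton_self _)]⟩
  have hz := hset₂ (span_basis_ne_bot b 0) (span_basis_ne_bot b 1) hb
  refine bijective_augmentation A M 2 hM m (cls A M 2 (t₁ - t₂)) (fun x => ?_)
    ⟨_, hz.tens_mem_cycles (i := 0) (j := 1) (i' := 0) (j' := 1) (by decide) (by decide)⟩
    (chainPairing_tens_self_pos (fun F hF G hG => hz.isCell (by decide) (by decide) hF hG) ?_).ne'
  -- The base point `c` is complementary to every point that occurs in the cycle.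
  · obtain ⟨c, hc⟩ := exists_common_complement hA (isComplemented_top (α := Submodule A M))
      (((x : Chain (Submodule A M)).support.image fun k => k.left 1) ∪
        (x : Chain (Submodule A M)).support.image fun k => k.right 1) (fun H hH => by
      rw [hr.top]
      rcases Finset.mem_union.1 hH with hH | hH <;> obtain ⟨k, hk, rfl⟩ := Finset.mem_image.1 hH
      · refine ⟨k.left_isComplemented 1, le_top, ?_⟩
        rw [hr.rk_left (hr.p_eq_of_mem x.2.1 hk) one_le_two]
      · refine ⟨k.right_isComplemented 1, le_top, ?_⟩
        rw [hr.rk_right (hr.q_eq_of_mem x.2.1 hk) one_le_two])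
    have hl : ∀ k ∈ (x : Chain (Submodule A M)).support, IsCompl (k.left 1) c := fun k hk =>
      have h := hc _ (Finset.mem_union_left _ (Finset.mem_image_of_mem (fun k => k.left 1) hk))
      ⟨h.1, codisjoint_iff.2 h.2⟩
    have hr' : ∀ k ∈ (x : Chain (Submodule A M)).support, IsCompl (k.right 1) c := fun k hk =>
      have h := hc _ (Finset.mem_union_right _ (Finset.mem_image_of_mem (fun k => k.right 1) hk))
      ⟨h.1, codisjoint_iff.2 h.2⟩
    refine cls_eq_smul_of_mkQ ?_
    refine (map_eq_chainPairing_smul_of_rank_two hr x.2 (Submodule.mkQ _)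
      (Submodule.mkQ _ (t₁ : Chain (Submodule A M))) (Submodule.mkQ _ (t₂ : Chain _)) c
      ?_ ?_).trans ?_
    · intro k hk h
      have h1 := hr.rk_left (hr.p_eq_of_mem x.2.1 hk) one_le_two
      have hc0 := htop h1 (hl k hk)
      rw [← h, Submodule.mkQ_apply, Submodule.mkQ_apply, Submodule.Quotient.eq]
      exact ht₁ ![c, k.left 1] (hset₂ hc0 (hbot h1) (hl k hk).symm)
        (exists_combSpan_of_isCompl hr.top (hl k hk).symm hc0 (hbot h1))
    · intro k hk h
      have hp := hr.p_eq_of_mem x.2.1 hk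
      have hq := hr.q_eq_of_mem x.2.1 hk
      have h1 := hbot (hr.rk_left hp one_le_two)
      have h2 := hbot (hr.rk_right hq one_le_two)
      have hc0 := htop (hr.rk_left hp one_le_two) (hl k hk)
      have hcompl := isCompl_of_rank_two hr hp hq h
      rw [Submodule.mkQ_apply, Submodule.mkQ_apply, Submodule.Quotient.eq]
      exact ht₂ ![c, k.left 1, k.right 1]
        (hset₃ hc0 h1 h2 (hl k hk).symm (hr' k hk).symm hcompl)
        (exists_combSpan_of_three_points hr.top (hl k hk).symm (hr' k hk).symm hcompl hc0 h1 h2)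
    · rw [← map_sub]
      rfl
  · intro h
    have h1 := DFunLike.congr_fun h (midFlag (Submodule.span A {b 1}))
    have hne : midFlag (Submodule.span A {b 0}) ≠ midFlag (Submodule.span A {b 1}) := fun e =>
      hb.disjoint.ne (span_basis_ne_bot b 0) (congrArg (fun F : Fin 3 →o Submodule A M => F 1) e)
    simp [pointDiff, Finsupp.single_eq_of_ne hne.symm] at h1

end RankTwo

/-! ### Rank three. -/

section RankThree

variable {A : Type*} [CommRing A] [ConnectedSpace (PrimeSpectrum A)] {M : Type*} [AddCommGroup M]
  [Module A M] [Module.Finite A M] [Module.Projective A M]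

/-- A point not on a line is complementary to it, for points and lines in good position. -/
lemma isCompl_of_not_le (hM : summandRank (⊤ : Submodule A M) = 3) {p l : Submodule A M}
    (hp : IsComplemented p) (hl : IsComplemented l) (hp1 : summandRank p = 1)
    (hl2 : summandRank l = 2) (hi : IsComplemented (p ⊓ l)) (hs : IsComplemented (p ⊔ l))
    (h : ¬ p ≤ l) : IsCompl p l := by
  have h1 := summandRank_lt hi hp (inf_lt_left.2 h)
  have h2 := summandRank_lt hl hs (right_lt_sup.2 h)
  constructor
  · rw [disjoint_iff]
    exact eq_bot_of_summandRank_eq_zero hi (by omega)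
  · rw [codisjoint_iff]
    by_contra hne
    have h3 := summandRank_lt hs isComplemented_top (lt_top_iff_ne_top.2 hne)
    omega

/-- Distinct points in good position are disjoint and span a line. -/
lemma disjoint_of_ne {p p' : Submodule A M} (hp : IsComplemented p) (hp' : IsComplemented p')
    (hp1 : summandRank p = 1) (hp1' : summandRank p' = 1) (hi : IsComplemented (p ⊓ p'))
    (h : p ≠ p') : Disjoint p p' ∧ summandRank (p ⊔ p') = 2 := by
  have hne : ¬ p ≤ p' := fun hle =>
    h (eq_of_le_of_summandRank_eq hp hp' hle (hp1.trans hp1'.symm))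
  have h1 := summandRank_lt hi hp (inf_lt_left.2 hne)
  have hd : Disjoint p p' := by
    rw [disjoint_iff]
    exact eq_bot_of_summandRank_eq_zero hi (by omega)
  exact ⟨hd, by rw [summandRank_sup hp hp' hd, hp1, hp1']⟩

/-- A point on two distinct lines is their intersection. -/
lemma eq_inf_of_le {p l l' : Submodule A M} (hp : IsComplemented p) (hl : IsComplemented l)
    (hl' : IsComplemented l') (hp1 : summandRank p = 1) (hl2 : summandRank l = 2)
    (hl2' : summandRank l' = 2) (hi : IsComplemented (l ⊓ l')) (h : l ≠ l') (hpl : p ≤ l)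
    (hpl' : p ≤ l') : p = l ⊓ l' := by
  have hne : ¬ l ≤ l' := fun hle =>
    h (eq_of_le_of_summandRank_eq hl hl' hle (hl2.trans hl2'.symm))
  have h1 := summandRank_lt hi hl (inf_lt_left.2 hne)
  by_contra hne'
  have h2 := summandRank_lt hp hi ((le_inf hpl hpl').lt_of_ne hne')
  omega

variable [Finite (MaximalSpectrum A)]

lemma isFrame_basis (b : Module.Basis (Fin 3) A M) :
    IsFrame (Submodule.span A {b 0}) (Submodule.span A {b 1}) (Submodule.span A {b 2}) := by
  refine ⟨disjoint_span_basis b (by decide), ?_, ?_⟩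
  · have := b.linearIndependent.disjoint_span_image
      (show Disjoint ({0, 1} : Set (Fin 3)) {2} by simp)
    rwa [Set.image_pair, Set.image_singleton, Submodule.span_insert] at this
  · rw [codisjoint_iff, ← top_le_iff, ← b.span_eq, Submodule.span_le, Set.range_subset_iff]
    intro i
    have h := Submodule.mem_span_singleton_self (R := A) (b i)
    fin_cases i
    exacts [Submodule.mem_sup_left (Submodule.mem_sup_left h),
      Submodule.mem_sup_left (Submodule.mem_sup_right h), Submodule.mem_sup_right h]

lemma isFrame_of_sup_eq {L : Type*} [Lattice L] [BoundedOrder L] {p q l c : L}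
    (hd : Disjoint p q) (h : p ⊔ q = l) (hc : IsCompl l c) : IsFrame p q c :=
  ⟨hd, by rwa [h]⟩

/-- The flag of the point `p` on the line `p ⊔ q` differs from the other five flags of the triangle,
so its coefficient is one. -/
lemma triangle_ne_zero {L : Type*} [Lattice L] [BoundedOrder L] [IsModularLattice L] {c p q : L}
    (hc : c ≠ ⊥) (hp : p ≠ ⊥) (h : IsFrame c p q) : triangle c p q ≠ 0 := by
  intro h0
  have hpc : lineFlag p q ≠ lineFlag p c := fun e => by
    have e2 : p ⊔ q = p ⊔ c := congrArg (fun F : Fin 4 →o L => F 2) e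
    have hd := h.isCompl.disjoint
    rw [e2] at hd
    exact hc (hd.eq_bot_of_le le_sup_right)
  have hne : ∀ {x y}, Disjoint p x → lineFlag p q ≠ lineFlag x y := fun hd e =>
    hd.ne hp (congrArg (fun F : Fin 4 →o L => F 1) e)
  have h1 := DFunLike.congr_fun h0 (lineFlag p q)
  have hq : Disjoint p q := h.rotate.1
  simp [triangle, Finsupp.single_eq_of_ne hpc, Finsupp.single_eq_of_ne (hne (y := p) h.1.symm),
    Finsupp.single_eq_of_ne (hne (y := q) h.1.symm), Finsupp.single_eq_of_ne (hne (y := p) hq),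
    Finsupp.single_eq_of_ne (hne (y := c) hq)] at h1

/-- The point is chosen with respect to those `f k i` that happen to be summands of corank one in
`P`, so these conditions can be verified case by case afterwards. -/
lemma exists_generic_point (hA : ∀ m : Ideal A, m.IsMaximal → Infinite (A ⧸ m))
    {P : Submodule A M} (hP : IsComplemented P) {ι : Type*} {n : ℕ} (S : Finset ι)
    (f : ι → Fin n → Submodule A M) :
    ∃ R : Submodule A M, ∀ k ∈ S, ∀ i, IsComplemented (f k i) → f k i ≤ P →
      summandRank P = summandRank (f k i) + 1 → Disjoint (f k i) R ∧ f k i ⊔ R = P := by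
  classical
  obtain ⟨R, hR⟩ := exists_common_complement hA hP
    (((S ×ˢ Finset.univ).image fun x => f x.1 x.2).filter
      fun H => IsComplemented H ∧ H ≤ P ∧ summandRank P = summandRank H + 1)
    (fun H hH => (Finset.mem_filter.1 hH).2)
  exact ⟨R, fun k hk i h1 h2 h3 => hR _ (Finset.mem_filter.2
    ⟨Finset.mem_image.2 ⟨(k, i), Finset.mem_product.2 ⟨hk, Finset.mem_univ i⟩, rfl⟩, h1, h2, h3⟩)⟩

lemma exists_cls_eq_of_isFrame (hM : summandRank (⊤ : Submodule A M) = 3) :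
    ∃ t : cycles (Submodule A M) (2 * 3), ∀ c p q : Submodule A M, c ≠ ⊥ → p ≠ ⊥ → q ≠ ⊥ →
      IsFrame c p q → tens (triangle c p q) (triangle c p q) - t ∈
        (LinearMap.ker (cls A M 3)).map (Submodule.subtype _) := by
  obtain ⟨t, ht⟩ := exists_cls_eq_of_isConfiguration (M := M)
    (![![1, 0, 0], ![0, 1, 0], ![0, 0, 1]] : Fin 3 → Fin 3 → A)
    (x := ![0, 1, 2]) (y := ![0, 1, 2]) (by decide) (by decide)
  exact ⟨t, fun c p q hc hp hq h => ht ![c, p, q] (isConfiguration_three hc hp hq h)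
    (exists_combSpan_of_isFrame hM h hc hp hq)⟩

lemma exists_cls_eq_of_collinear (hM : summandRank (⊤ : Submodule A M) = 3) :
    ∃ t : cycles (Submodule A M) (2 * 3), ∀ c p p' q : Submodule A M,
      c ≠ ⊥ → p ≠ ⊥ → p' ≠ ⊥ → q ≠ ⊥ → IsFrame c p p' → IsFrame c p q → IsFrame c p' q →
      p ≤ p' ⊔ q → p' ≤ p ⊔ q → q ≤ p ⊔ p' → tens (triangle c p q) (triangle c p' q) - t ∈
        (LinearMap.ker (cls A M 3)).map (Submodule.subtype _) := by
  obtain ⟨t, ht⟩ := exists_cls_eq_of_isConfiguration (M := M)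
    (![![1, 0, 0], ![0, 1, 0], ![0, 1, 1], ![0, 0, 1]] : Fin 4 → Fin 3 → A)
    (x := ![0, 1, 3]) (y := ![0, 2, 3]) (by decide) (by decide)
  exact ⟨t, fun c p p' q hc hp hp' hq h₃ h₂ h₁ e₁ e₂ e₃ => ht ![c, p, p', q]
    (isConfiguration_of_collinear hc hp hp' hq h₃ h₂ h₁ e₁ e₂ e₃)
    (exists_combSpan_of_collinear hM hc hp hp' hq h₃ h₂ h₁ e₂)⟩

lemma exists_cls_eq_of_general_position (hM : summandRank (⊤ : Submodule A M) = 3) :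
    ∃ t : cycles (Submodule A M) (2 * 3), ∀ u p p' c : Submodule A M,
      u ≠ ⊥ → p ≠ ⊥ → p' ≠ ⊥ → c ≠ ⊥ → IsFrame u p p' → IsFrame u p c → IsFrame u p' c →
      IsFrame p p' c → tens (triangle c p u) (triangle c p' u) - t ∈
        (LinearMap.ker (cls A M 3)).map (Submodule.subtype _) := by
  obtain ⟨t, ht⟩ := exists_cls_eq_of_isConfiguration (M := M)
    (![![1, 0, 0], ![0, 1, 0], ![0, 0, 1], ![1, 1, 1]] : Fin 4 → Fin 3 → A)
    (x := ![3, 1, 0]) (y := ![3, 2, 0]) (by decide) (by decide)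
  exact ⟨t, fun u p p' c hu hp hp' hc h₃ h₂ h₁ h₀ => ht ![u, p, p', c]
    (isConfiguration_of_general_position hu hp hp' hc h₃ h₂ h₁ h₀)
    (exists_combSpan_of_general_position hM hu hp hp' hc h₃ h₂ h₁ h₀)⟩

/-- A point outside of all lines occurring in a finite set of cells, and on each of these lines a
further point. -/
lemma exists_generic_points (hA : ∀ m : Ideal A, m.IsMaximal → Infinite (A ⧸ m))
    (hr : IsRanked (summandRank (A := A) (M := M)) 3) (S : Finset (Cell (Submodule A M)))
    (hp : ∀ k ∈ S, k.p = 3) (hq : ∀ k ∈ S, k.q = 3) :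
    ∃ (c : Submodule A M) (q : Submodule A M → Submodule A M), ∀ k ∈ S,
      (IsCompl (k.left 2) c ∧ IsCompl (k.right 2) c ∧
        (summandRank (k.left 1 ⊔ k.right 1) = 2 → IsCompl (k.left 1 ⊔ k.right 1) c)) ∧
      (Disjoint (k.left 1) (q (k.left 2)) ∧ k.left 1 ⊔ q (k.left 2) = k.left 2) ∧
      (k.left 2 = k.right 2 →
        Disjoint (k.right 1) (q (k.left 2)) ∧ k.right 1 ⊔ q (k.left 2) = k.left 2) := by
  -- Besides the lines of both flags, `c` has to avoid the line joining the two points of a cell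
  -- whenever they differ; the triangles in general position need this.
  obtain ⟨c, hc⟩ := exists_generic_point hA (isComplemented_top (α := Submodule A M)) S
    fun k => ![k.left 2, k.right 2, k.left 1 ⊔ k.right 1]
  have hcompl : ∀ k ∈ S, ∀ i H, ![k.left 2, k.right 2, k.left 1 ⊔ k.right 1] i = H →
      IsComplemented H → summandRank H = 2 → IsCompl H c := by
    rintro k hk i _ rfl h1 h2
    have h := hc k hk i h1 le_top (by rw [hr.top, h2])
    exact ⟨h.1, codisjoint_iff.2 h.2⟩
  -- The auxiliary point may depend on the line only, so for each `l` it is chosen off all the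
  -- points on `l` that occur in any of the cells.
  have hex : ∀ l : Submodule A M, ∃ q : Submodule A M, IsComplemented l → summandRank l = 2 →
      ∀ k ∈ S, ∀ i p, ![k.left 1, k.right 1] i = p → IsComplemented p → summandRank p = 1 →
        p ≤ l → Disjoint p q ∧ p ⊔ q = l := by
    intro l
    by_cases hl : IsComplemented l
    · obtain ⟨q, hq⟩ := exists_generic_point hA hl S fun k => ![k.left 1, k.right 1]
      refine ⟨q, fun _ h2 k hk i p hp h3 h4 h5 => ?_⟩
      subst hp
      exact hq k hk i h3 h5 (by rw [h2, h4])
    · exact ⟨⊥, fun h => absurd h hl⟩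
  choose q hq' using hex
  refine ⟨c, q, fun k hk => ?_⟩
  have h1 : summandRank (k.left 1) = 1 := hr.rk_left (hp k hk) (by decide)
  have h2 : summandRank (k.left 2) = 2 := hr.rk_left (hp k hk) (by decide)
  have h1' : summandRank (k.right 1) = 1 := hr.rk_right (hq k hk) (by decide)
  have h2' : summandRank (k.right 2) = 2 := hr.rk_right (hq k hk) (by decide)
  refine ⟨⟨?_, ?_, fun h => ?_⟩, ?_, fun h => ?_⟩
  · exact hcompl k hk 0 _ rfl (k.left_isComplemented 2) h2
  · exact hcompl k hk 1 _ rfl (k.right_isComplemented 2) h2'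
  · exact hcompl k hk 2 _ rfl (k.sup_isComplemented 1 1) h
  · exact hq' _ (k.left_isComplemented 2) h2 k hk 0 _ rfl (k.left_isComplemented 1) h1
      (k.left_lt one_lt_two (by rw [hp k hk]; decide)).le
  · refine hq' _ (k.left_isComplemented 2) h2 k hk 1 _ rfl (k.right_isComplemented 1) h1' ?_
    rw [h]
    exact (k.right_lt one_lt_two (by rw [hq k hk]; decide)).le

theorem bijective_augmentation_of_rank_three (hA : ∀ m : Ideal A, m.IsMaximal → Infinite (A ⧸ m))
    (hM : ∀ p : PrimeSpectrum A, Module.rankAtStalk M p = 3) (m : Ideal A) [m.IsMaximal] :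
    Function.Bijective (augmentation A M 3 hM m) := by
  classical
  have hr := isRanked_summandRank hM
  -- These are the classes of the three types of products: a triangle with itself, two triangles on
  -- `c` whose opposite sides lie on one line, and two triangles with a common side from `c` to `l ∩
  -- l'`.
  obtain ⟨t₁, ht₁⟩ := exists_cls_eq_of_isFrame hr.top
  obtain ⟨t₂, ht₂⟩ := exists_cls_eq_of_collinear hr.top
  obtain ⟨t₃, ht₃⟩ := exists_cls_eq_of_general_position hr.top
  have hbot : ∀ {a : Submodule A M}, summandRank a = 1 → a ≠ ⊥ := by
    rintro a ha rfl
    rw [summandRank_bot] at ha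
    omega
  obtain ⟨b⟩ := nonempty_basis hM
  have : Nontrivial A := PrimeSpectrum.nonempty_iff_nontrivial.1 inferInstance
  have hz := isConfiguration_three (span_basis_ne_bot b 0) (span_basis_ne_bot b 1)
    (span_basis_ne_bot b 2) (isFrame_basis b)
  refine bijective_augmentation A M 3 hM m (cls A M 3 (t₁ - t₂ - t₃)) (fun x => ?_)
    ⟨_, hz.tens_mem_cycles Function.injective_id Function.injective_id⟩
    (chainPairing_tens_self_pos (fun F hF G hG =>
      hz.isCell (fun _ _ => isComplemented_inf_of_sup_eq_top) Function.injective_id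
        Function.injective_id hF hG)
      (triangle_ne_zero (span_basis_ne_bot b 0) (span_basis_ne_bot b 1) (isFrame_basis b))).ne'
  have hp : ∀ k ∈ (x : Chain (Submodule A M)).support, k.p = 3 := fun k hk =>
    hr.p_eq_of_mem x.2.1 hk
  have hq : ∀ k ∈ (x : Chain (Submodule A M)).support, k.q = 3 := fun k hk =>
    hr.q_eq_of_mem x.2.1 hk
  obtain ⟨c, q, hcq⟩ := exists_generic_points hA hr _ hp hq
  generalize hS : (x : Chain (Submodule A M)).support = S at *
  have rp : ∀ k ∈ S, summandRank (k.left 1) = 1 := fun k hk => hr.rk_left (hp k hk) (by decide)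
  have rl : ∀ k ∈ S, summandRank (k.left 2) = 2 := fun k hk => hr.rk_left (hp k hk) (by decide)
  have rp' : ∀ k ∈ S, summandRank (k.right 1) = 1 := fun k hk =>
    hr.rk_right (hq k hk) (by decide)
  have rl' : ∀ k ∈ S, summandRank (k.right 2) = 2 := fun k hk =>
    hr.rk_right (hq k hk) (by decide)
  have hle : ∀ k ∈ S, k.left 1 ≤ k.left 2 := fun k hk =>
    (k.left_lt (by decide) (by rw [hp k hk]; decide)).le
  have hle' : ∀ k ∈ S, k.right 1 ≤ k.right 2 := fun k hk =>
    (k.right_lt (by decide) (by rw [hq k hk]; decide)).le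
  have hcl : ∀ k ∈ S, IsCompl (k.left 2) c := fun k hk => (hcq k hk).1.1
  have hcl' : ∀ k ∈ S, IsCompl (k.right 2) c := fun k hk => (hcq k hk).1.2.1
  have hcpp : ∀ k ∈ S, summandRank (k.left 1 ⊔ k.right 1) = 2 →
      IsCompl (k.left 1 ⊔ k.right 1) c := fun k hk => (hcq k hk).1.2.2
  have hql : ∀ k ∈ S, Disjoint (k.left 1) (q (k.left 2)) ∧ k.left 1 ⊔ q (k.left 2) = k.left 2 :=
    fun k hk => (hcq k hk).2.1
  have hqr : ∀ k ∈ S, k.left 2 = k.right 2 →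
      Disjoint (k.right 1) (q (k.left 2)) ∧ k.right 1 ⊔ q (k.left 2) = k.left 2 :=
    fun k hk => (hcq k hk).2.2
  -- For an empty support nothing is known about `c`, so this is stated cell by cell.
  have hc0 : ∀ k ∈ S, c ≠ ⊥ := by
    rintro k hk rfl
    have h1 := (hcl k hk).sup_eq_top
    rw [sup_bot_eq] at h1
    have h2 := rl k hk
    rw [h1, hr.top] at h2
    omega
  have hq0 : ∀ k ∈ S, q (k.left 2) ≠ ⊥ := by
    intro k hk h
    have h1 := (hql k hk).2
    have h2 := rl k hk
    rw [h, sup_bot_eq] at h1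
    rw [← h1, rp k hk] at h2
    omega
  subst hS
  refine cls_eq_smul_of_mkQ ?_
  refine (map_eq_chainPairing_smul_of_rank_three hr x.2 (Submodule.mkQ _)
    (Submodule.mkQ _ (t₁ : Chain (Submodule A M))) (Submodule.mkQ _ (t₂ : Chain _))
    (Submodule.mkQ _ (t₃ : Chain _)) c q ?_ ?_ ?_ ?_ ?_ ?_).trans ?_
  · exact fun k hk h => ⟨(hql k hk).2, (hqr k hk h).2⟩
  · intro k hk _ _
    have hF : IsFrame c (k.left 1) (q (k.left 2)) :=
      (isFrame_of_sup_eq (hql k hk).1 (hql k hk).2 (hcl k hk)).rotate.rotate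
    have hp0 := hbot (rp k hk)
    rw [Submodule.mkQ_apply, Submodule.mkQ_apply, Submodule.Quotient.eq]
    exact ht₁ _ _ _ (hc0 k hk) hp0 (hq0 k hk) hF
  · intro k hk hll hpp
    have e1 := (hql k hk).2
    have e2 := (hqr k hk hll).2
    obtain ⟨hd, hr2⟩ := disjoint_of_ne (k.left_isComplemented 1) (k.right_isComplemented 1)
      (rp k hk) (rp' k hk) (k.inf_isComplemented 1 1) hpp
    have e3 : k.left 1 ⊔ k.right 1 = k.left 2 :=
      eq_of_le_of_summandRank_eq (k.sup_isComplemented 1 1) (k.left_isComplemented 2)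
        (sup_le (hle k hk) ((hle' k hk).trans hll.ge)) (hr2.trans (rl k hk).symm)
    have hF₃ : IsFrame c (k.left 1) (k.right 1) :=
      (isFrame_of_sup_eq hd e3 (hcl k hk)).rotate.rotate
    have hF₂ : IsFrame c (k.left 1) (q (k.left 2)) :=
      (isFrame_of_sup_eq (hql k hk).1 e1 (hcl k hk)).rotate.rotate
    have hF₁ : IsFrame c (k.right 1) (q (k.left 2)) :=
      (isFrame_of_sup_eq (hqr k hk hll).1 e2 (hcl k hk)).rotate.rotate
    have hp0 := hbot (rp k hk)
    have hp0' := hbot (rp' k hk)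
    rw [Submodule.mkQ_apply, Submodule.mkQ_apply, Submodule.Quotient.eq]
    exact ht₂ _ _ _ _ (hc0 k hk) hp0 hp0' (hq0 k hk) hF₃ hF₂ hF₁
      ((hle k hk).trans e2.ge) ((le_sup_right.trans e3.le).trans e1.ge)
      ((le_sup_right.trans e1.le).trans e3.ge)
  · intro k hk hll h1 h2
    have hC := isCompl_of_not_le hr.top (k.left_isComplemented 1) (k.right_isComplemented 2)
      (rp k hk) (rl' k hk) (k.inf_isComplemented 1 2) (k.sup_isComplemented 1 2) h1
    have hC' := isCompl_of_not_le hr.top (k.right_isComplemented 1) (k.left_isComplemented 2)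
      (rp' k hk) (rl k hk) (by rw [inf_comm]; exact k.inf_isComplemented 2 1)
      (by rw [sup_comm]; exact k.sup_isComplemented 2 1) h2
    -- The point `p` is complementary to `l'`, so the modular law shows that `p` and `l ∩ l'` span
    -- `l`.
    have e1 : k.left 1 ⊔ k.left 2 ⊓ k.right 2 = k.left 2 := by
      rw [inf_comm, ← sup_inf_assoc_of_le _ (hle k hk), hC.sup_eq_top, top_inf_eq]
    have e2 : k.right 1 ⊔ k.left 2 ⊓ k.right 2 = k.right 2 := by
      rw [← sup_inf_assoc_of_le _ (hle' k hk), hC'.sup_eq_top, top_inf_eq]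
    have hpp : k.left 1 ≠ k.right 1 := fun e => h1 (e.le.trans (hle' k hk))
    obtain ⟨hd, hr2⟩ := disjoint_of_ne (k.left_isComplemented 1) (k.right_isComplemented 1)
      (rp k hk) (rp' k hk) (k.inf_isComplemented 1 1) hpp
    have hu : k.left 2 ⊓ k.right 2 ≠ ⊥ := by
      intro e
      have h3 := rl k hk
      rw [e, sup_bot_eq] at e1
      rw [← e1, rp k hk] at h3
      omega
    have hdu : Disjoint (k.left 2 ⊓ k.right 2) (k.left 1) :=
      (hC.disjoint.mono_right inf_le_right).symm
    have hdu' : Disjoint (k.left 2 ⊓ k.right 2) (k.right 1) :=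
      (hC'.disjoint.mono_right inf_le_left).symm
    have e1' := (sup_comm _ _).trans e1
    have e2' := (sup_comm _ _).trans e2
    have hF₃ : IsFrame (k.left 2 ⊓ k.right 2) (k.left 1) (k.right 1) :=
      isFrame_of_sup_eq hdu e1' hC'.symm
    have hF₂ : IsFrame (k.left 2 ⊓ k.right 2) (k.left 1) c := isFrame_of_sup_eq hdu e1' (hcl k hk)
    have hF₁ : IsFrame (k.left 2 ⊓ k.right 2) (k.right 1) c := isFrame_of_sup_eq hdu' e2' (hcl' k hk)
    have hF₀ : IsFrame (k.left 1) (k.right 1) c := ⟨hd, hcpp k hk hr2⟩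
    have hp0 := hbot (rp k hk)
    have hp0' := hbot (rp' k hk)
    refine ⟨e1, e2, ?_⟩
    rw [Submodule.mkQ_apply, Submodule.mkQ_apply, Submodule.Quotient.eq]
    exact ht₃ _ _ _ _ hu hp0 hp0' (hc0 k hk) hF₃ hF₂ hF₁ hF₀
  · exact fun k hk hll h => eq_inf_of_le (k.left_isComplemented 1) (k.left_isComplemented 2)
      (k.right_isComplemented 2) (rp k hk) (rl k hk) (rl' k hk) (k.inf_isComplemented 2 2) hll
      (hle k hk) h
  · exact fun k hk hll h => eq_inf_of_le (k.right_isComplemented 1) (k.left_isComplemented 2)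
      (k.right_isComplemented 2) (rp' k hk) (rl k hk) (rl' k hk) (k.inf_isComplemented 2 2) hll
      h (hle' k hk)
  · rw [← map_sub, ← map_sub]
    rfl

end RankThree

/-! ### Rank zero and one. -/

section RankAtMostOne

section Cells

variable {L : Type*} [Lattice L] [BoundedOrder L]

/-- With both degrees at most one, every entry is prescribed by fullness. -/
lemma Cell.eq_of_le_one {c c' : Cell L} (hp : c.p = c'.p) (hq : c.q = c'.q) (hp1 : c.p ≤ 1)
    (hq1 : c.q ≤ 1) : c = c' := by
  obtain ⟨p, q, φ, h⟩ := c
  obtain ⟨p', q', φ', h'⟩ := c'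
  dsimp only at hp hq hp1 hq1
  subst hp hq
  have key : φ = φ' := by
    refine OrderHom.ext _ _ (funext fun x => ?_)
    obtain ⟨a, b⟩ := x
    rcases eq_or_ne a 0 with rfl | ha
    · rw [h.isFull.zero_left, h'.isFull.zero_left]
    rcases eq_or_ne b 0 with rfl | hb
    · rw [h.isFull.zero_right, h'.isFull.zero_right]
    have ha' : a = Fin.last p := Fin.ext (by
      have := Fin.val_ne_zero_iff.2 ha
      have := a.isLt
      rw [Fin.val_last]
      omega)
    have hb' : b = Fin.last q := Fin.ext (by
      have := Fin.val_ne_zero_iff.2 hb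
      have := b.isLt
      rw [Fin.val_last]
      omega)
    rw [h.isFull.apply_eq_top ha' hb', h'.isFull.apply_eq_top ha' hb']
  subst key
  rfl

lemma Cell.left_eq_right_of_le_one {c : Cell L} (hp : c.p ≤ 1) (hq : c.q = c.p) :
    c.left = c.right := by
  funext n
  rcases n.eq_zero_or_pos with rfl | hn
  · rw [c.left_zero, c.right_zero]
  · rw [c.left_top (by omega), c.right_top (by omega)]

/-- The sequence with entry `⊥` at `0` and `⊤` elsewhere. -/
def trivialFlag (L : Type*) [Lattice L] [BoundedOrder L] (d : ℕ) : Fin (d + 1) →o L where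
  toFun i := if i = 0 then ⊥ else ⊤
  monotone' i j h := by
    dsimp only
    split_ifs with hi hj hj
    · exact le_rfl
    · exact bot_le
    · exact absurd (le_antisymm (hj ▸ h) (Fin.zero_le i)) hi
    · exact le_rfl

lemma isCell_trivialFlag {d : ℕ} (hd : d ≤ 1) (h0 : d = 0 → (⊥ : L) = ⊤)
    (h1 : d = 1 → (⊥ : L) ≠ ⊤) : IsCell (meetGrid (trivialFlag L d) (trivialFlag L d)) := by
  have hlast : trivialFlag L d (Fin.last d) = ⊤ := by
    rcases Nat.le_one_iff_eq_zero_or_eq_one.1 hd with rfl | rfl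
    · exact h0 rfl
    · rfl
  have hm : StrictMono (trivialFlag L d) := by
    intro i j hij
    have hij' := Fin.lt_def.1 hij
    have hi : i = 0 := Fin.ext (by rw [Fin.val_zero]; omega)
    have hj : j ≠ 0 := Fin.ne_zero_of_lt hij
    change (if i = 0 then ⊥ else ⊤ : L) < if j = 0 then ⊥ else ⊤
    rw [if_pos hi, if_neg hj]
    exact (h1 (by omega)).symm.bot_lt
  have hc : ∀ i, trivialFlag L d i = ⊥ ∨ trivialFlag L d i = ⊤ := by
    intro i
    change (if i = 0 then ⊥ else ⊤ : L) = ⊥ ∨ (if i = 0 then ⊥ else ⊤ : L) = ⊤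
    split_ifs
    exacts [Or.inl rfl, Or.inr rfl]
  refine isCell_meetGrid hm hm rfl rfl hlast hlast (fun a b => ?_) fun a a' b b' _ _ _ _ => ?_
  · rcases hc a with h | h <;> rcases hc b with h' | h' <;>
      simp [h, h', isComplemented_bot, isComplemented_top]
  · rcases hc a with h | h <;> rcases hc b with h' | h' <;> rcases hc a' with h2 | h2 <;>
      rcases hc b' with h2' | h2' <;>
      simp [h, h', h2, h2', isComplemented_bot, isComplemented_top]

end Cells

variable {A : Type*} [CommRing A] [ConnectedSpace (PrimeSpectrum A)] {M : Type*} [AddCommGroup M]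
  [Module A M] [Module.Finite A M] [Module.Projective A M]

/-- There is exactly one cell of top degree; it is a cycle with equal flags, and the pairing reads
off its coefficient. -/
theorem bijective_augmentation_of_rank_le_one {d : ℕ} (hd : d ≤ 1)
    (hM : ∀ p : PrimeSpectrum A, Module.rankAtStalk M p = d) (m : Ideal A) [m.IsMaximal] :
    Function.Bijective (augmentation A M d hM m) := by
  have hr := isRanked_summandRank hM
  have hcell : IsCell (meetGrid (trivialFlag (Submodule A M) d) (trivialFlag _ d)) := by
    refine isCell_trivialFlag hd (fun h => ?_) fun h e => ?_
    · exact (eq_bot_of_summandRank_eq_zero isComplemented_top (hr.top.trans h)).symm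
    · have h1 := hr.top
      rw [← e, summandRank_bot] at h1
      omega
  let k₀ : Cell (Submodule A M) := ⟨d, d, _, hcell⟩
  have hmem : Finsupp.single k₀ (1 : ℤ) ∈ cycles (Submodule A M) (2 * d) := by
    rcases Nat.le_one_iff_eq_zero_or_eq_one.1 hd with rfl | rfl
    · refine ⟨Finsupp.single_mem_supported ℤ _ rfl, ?_⟩
      refine LinearMap.mem_ker.2 ?_
      rw [bdry_single]
      change (0 : Chain (Submodule A M)) + (-1 : ℤ) ^ 0 • (0 : Chain (Submodule A M)) = 0
      simp
    -- A flag of length one has only outer faces, so it is a cycle of flags for trivial reasons.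
    · have h : ∀ i : Fin 2, i ≠ 0 → i ≠ Fin.last 1 →
          (Finsupp.single (trivialFlag (Submodule A M) 1) (1 : ℤ)).mapDomain (flagFace i) = 0 := by
        intro i h0 h1
        fin_cases i
        exacts [absurd rfl h0, absurd rfl h1]
      have h2 := tens_mem_cycles (d := 0) (fun F hF G hG => by
        rw [Finsupp.mem_support_single] at hF hG
        rw [hF.1, hG.1]
        exact hcell) h h
      rwa [tens_single, gen_of_isCell hcell] at h2
  have hk : ∀ c : Cell (Submodule A M), c.p = d → c.q = d → c = k₀ := fun c hp hq =>
    Cell.eq_of_le_one hp hq (hp.trans_le hd) (hq.trans_le hd)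
  have hpair : ∀ n : ℤ, Finsupp.single k₀ n ∈ chains (Submodule A M) (2 * d) →
      chainPairing _ (Finsupp.single k₀ n) = n := by
    intro n hn
    have h : k₀.left = k₀.right := Cell.left_eq_right_of_le_one hd rfl
    rw [hr.chainPairing_eq hn, Finsupp.sum_single_index (by rw [zero_smul]), if_pos h,
      smul_eq_mul, mul_one]
  have hx : ∀ x : cycles (Submodule A M) (2 * d), x = chainPairing _ (x : Chain (Submodule A M)) •
      (⟨_, hmem⟩ : cycles (Submodule A M) (2 * d)) := by
    intro x
    have hsupp : ∀ c ∈ (x : Chain (Submodule A M)).support, c = k₀ := fun c hc =>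
      hk c (hr.p_eq_of_mem x.2.1 hc) (hr.q_eq_of_mem x.2.1 hc)
    have hsum : (x : Chain (Submodule A M)) = Finsupp.single k₀ ((x : Chain _) k₀) := by
      ext c
      by_cases h : c = k₀
      · rw [h, Finsupp.single_eq_same]
      · rw [Finsupp.single_eq_of_ne h]
        by_contra hne
        exact h (hsupp c (Finsupp.mem_support_iff.2 hne))
    have hcoef : chainPairing _ (x : Chain (Submodule A M)) = (x : Chain _) k₀ := by
      rw [hsum, hpair _ (hsum ▸ x.2.1), Finsupp.single_eq_same]
    refine Subtype.ext ?_
    rw [hcoef]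
    refine hsum.trans ?_
    change _ = _ • Finsupp.single k₀ (1 : ℤ)
    rw [Finsupp.smul_single, smul_eq_mul, mul_one]
  refine bijective_augmentation A M d hM m (cls A M d ⟨_, hmem⟩) (fun x => ?_) ⟨_, hmem⟩ ?_
  · rw [← map_smul, ← hx x]
  · rw [hpair 1 hmem.1]
    exact one_ne_zero

end RankAtMostOne

end DoubleBuilding

end

theorem mainTheorem10 {A : Type*} [CommRing A] [Finite (MaximalSpectrum A)]
    [ConnectedSpace (PrimeSpectrum A)]
    (hA : ∀ m : Ideal A, m.IsMaximal → Infinite (A ⧸ m))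
    {M : Type*} [AddCommGroup M] [Module A M] [Module.Finite A M] [Module.Projective A M]
    (d : ℕ) (hM : ∀ p : PrimeSpectrum A, Module.rankAtStalk M p = d) (hd : d ≤ 3)
    (m : Ideal A) [m.IsMaximal] :
    Function.Bijective (DoubleBuilding.augmentation A M d hM m) := by
  obtain h | rfl | rfl : d ≤ 1 ∨ d = 2 ∨ d = 3 := by omega
  · exact DoubleBuilding.bijective_augmentation_of_rank_le_one h hM m
  · exact DoubleBuilding.bijective_augmentation_of_rank_two hA hM m
  · exact DoubleBuilding.bijective_augmentation_of_rank_three hA hM m
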